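/- Setting. There are two classes $k=1,2$ with fixed sample sizes $n_1,n_2$, $n=n_1+n_2$, and for every dimension $p$ a training sample of independent random vectors $X_{kj}=X_{kj}^{(p)}\in\mathbb R^p$ ($1\le j\le n_k$), where $X_{k1},\dots,X_{kn_k}$ have the same absolutely continuous distribution with mean $\mu_{(k)}$ and covariance matrix $\Sigma_{(k)}$. Let $u_{(k),1},\dots,u_{(k),p}$ be orthonormal eigenvectors of $\Sigma_{(k)}$ with eigenvalues $\lambda_{(k),i}$, let $\mu=\mu_{(1)}-\mu_{(2)}$, and assume the following. 1. $p^{-1/2}\|\mu\|\to\delta$ as $p\to\infty$ for some $\delta>0$. 2. (Strong spikes.) There are fixed $m_k$ with $1\le m_k<n_k$ and numbers $\sigma_{(k),i}^2,\tau_{(k),i}^2>0$ not depending on $p$ such that $\lambda_{(k),i}=\sigma_{(k),i}^2\,p+\tau_{(k),i}^2$ for $i\le m_k$ and $\lambda_{(k),i}=\tau_{(k),i}^2$ for $i>m_k$. The $\tau_{(k),i}^2$ are uniformly bounded and $p^{-1}\sum_{i=1}^p\tau_{(k),i}^2\to\tau_k^2$ for some $\tau_k^2>0$. 3. For each observation there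 is one infinite sequence of random variables with uniformly (in $k$, $j$ and the index) bounded fourth moments, $\rho$-mixing after some permutation of the indices, such that for every $p$ the principal component scores $\lambda_{(k),i}^{-1/2}u_{(k),i}^\top(X_{kj}-\mu_{(k)})$, $1\le i\le p$, are its first $p$ elements. 4. For $1\le i\le m_k$, $\mathrm{Angle}(u_{(k),i},\mu)$ converges to some $\theta_{(k),i}\in[0,\pi/2]$ as $p\to\infty$. 5. For all large $p$ the common leading eigenspace $\mathcal U=\mathrm{span}\{u_{(k),i}:k=1,2,\ 1\le i\le m_k\}$ has an orthonormal basis $u_1,\dots,u_m$, with $m$ not depending on $p$, such that $\mathrm{Angle}(u_i,\mu)$ converges to some $\theta_i\in[0,\pi/2]$ for each $i$; the $m\times m_k$ matrices $R_{(k)}^{(p)}=(u_i^\top u_{(k),l})_{i,l}$ converge to matrices $R_{(k)}$ with orthonormal columns; and $[R_{(1)}\ R_{(2)}]$ has rank $m$. Sample quantities. Let $\bar X_k$ be the class means and $\bar X$ the total mean, $d=\bar X_1-\bar X_2$, $S_W=\sum_{k,j}(X_{kj}-\bar X_k)(X_{kj}-\bar X_k)^\top$ and $S_B=\sum_k n_k(\bar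 X_k-\bar X)(\bar X_k-\bar X)^\top$. Let $\hat u_1,\dots,\hat u_p$ be (measurably chosen) orthonormal eigenvectors of $S_W$ with eigenvalues $\hat\lambda_1\ge\dots\ge\hat\lambda_p$, and let $w_{\mathrm{MDP}}$ be a (measurably chosen) maximizer of $w^\top S_Bw$ subject to $\|w\|=1$ and $w^\top S_Ww=0$. Put $\mathcal S=\mathrm{span}(\hat u_1,\dots,\hat u_m,w_{\mathrm{MDP}})$, let $u_{i,\mathcal S}$ be the orthogonal projection of $u_i$ onto $\mathcal S$, and for $\alpha\in\mathbb R$ put $$\tilde v_\alpha=\sum_{i=1}^m\frac{\alpha p}{\hat\lambda_i+\alpha p}\,\hat u_i\hat u_i^\top d+\sum_{i=n-1}^p\hat u_i\hat u_i^\top d,\qquad v_\alpha=\tilde v_\alpha/\|\tilde v_\alpha\|.$$ Theorem. Suppose moreover that $\tau_1^2=\tau_2^2=:\tau^2$, and let $\hat\alpha=\hat\alpha_p$ be real random variables with $\hat\alpha\to-\tau^2$ in probability as $p\to\infty$. Then for every $1\le i\le m$, with probability tending to one $\hat\lambda_l+\hat\alpha p\neq0$ for all $l\le m$, $\tilde v_{\hat\alpha}\ne0$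 and $u_{i,\mathcal S}\neq 0$ (so that the angle below is defined), and $$\mathrm{Angle}(v_{\hat\alpha},u_{i,\mathcal S})\xrightarrow{P}\frac{\pi}{2}\qquad(p\to\infty).$$ In particular, $\Sigma_{(1)}=\Sigma_{(2)}$ is not required. -/

import Mathlib

open MeasureTheory ProbabilityTheory Filter Topology Matrix

noncomputable section

namespace DataPiling

/-- Euclidean `p`-space. -/
abbrev Vec (p : ℕ) := EuclideanSpace ℝ (Fin p)

/-! ### Rho-mixing sequences -/

section Mixing

variable {Ω : Type*}

/-- The correlation of two real random variables (`0` if one of them has zero variance). -/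
def corr [MeasurableSpace Ω] (f g : Ω → ℝ) (P : Measure Ω) : ℝ :=
  cov[f, g; P] / (Real.sqrt Var[f; P] * Real.sqrt Var[g; P])

/-- The maximal correlation of two sigma-fields: the supremum of `|Corr(f, g)|` over
square-integrable `f`, `g` that are measurable for the first and the second sigma-field. -/
def maxCorr (m₁ m₂ : MeasurableSpace Ω) [mΩ : MeasurableSpace Ω] (P : Measure Ω) : ENNReal :=
  ⨆ (f : Ω → ℝ) (g : Ω → ℝ) (_ : Measurable[m₁] f ∧ MemLp f 2 P)
    (_ : Measurable[m₂] g ∧ MemLp g 2 P), ENNReal.ofReal |corr f g P|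

/-- The sigma-field generated by the variables `y i` with `i ∈ I`. -/
abbrev sigmaField (y : ℕ → Ω → ℝ) (I : Set ℕ) : MeasurableSpace Ω :=
  ⨆ i ∈ I, MeasurableSpace.comap (y i) inferInstance

/-- The rho-mixing coefficient with gap `l` of a sequence. -/
def rhoCoeff [MeasurableSpace Ω] (P : Measure Ω) (y : ℕ → Ω → ℝ) (l : ℕ) : ENNReal :=
  ⨆ j : ℕ, maxCorr (sigmaField y (Set.Iic j)) (sigmaField y (Set.Ici (j + l))) P

/-- A sequence of random variables is rho-mixing if its mixing coefficients tend to zero. -/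
def RhoMixing [MeasurableSpace Ω] (P : Measure Ω) (y : ℕ → Ω → ℝ) : Prop :=
  Tendsto (rhoCoeff P y) atTop (𝓝 0)

end Mixing

/-! ### The two populations -/

/-- The population parameters of the two classes (indexed by `Fin 2`) in all dimensions `p`:
mean vectors, orthonormal eigenvectors of the covariance matrices, and the parameters of
their eigenvalues. Indices of eigenvectors and eigenvalues start at `0`. -/
structure Population where
  /-- the class means -/
  mean : Fin 2 → (p : ℕ) → Vec p
  /-- the orthonormal eigenvectors of the class covariance matrices -/
  eigvec : Fin 2 → (p : ℕ) → OrthonormalBasis (Fin p) ℝ (Vec p)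
  /-- the number of spikes of each class -/
  numSpikes : Fin 2 → ℕ
  /-- the coefficients of the spikes -/
  spikeSq : Fin 2 → ℕ → ℝ
  /-- the non-diverging parts of the eigenvalues -/
  tailSq : Fin 2 → ℕ → ℝ
  /-- the limiting averages of the non-diverging parts -/
  tauSq : Fin 2 → ℝ

namespace Population

/-- The `i`-th eigenvalue of the covariance matrix of class `k` in dimension `p`, in the case of
strong spikes: the first `numSpikes k` eigenvalues grow linearly in `p`. -/
def eigval (M : Population) (k : Fin 2) (p i : ℕ) : ℝ :=
  if i < M.numSpikes k then M.spikeSq k i * (p : ℝ) + M.tailSq k i else M.tailSq k i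

/-- The `i`-th eigenvector, indexed by a natural number; the value is `0` if `p ≤ i`. -/
def eigvecAt (M : Population) (k : Fin 2) (p i : ℕ) : Vec p :=
  if h : i < p then M.eigvec k p ⟨i, h⟩ else 0

/-- The mean difference of the two classes. -/
def meanDiff (M : Population) (p : ℕ) : Vec p := M.mean 0 p - M.mean 1 p

/-- The leading eigenspace of class `k`. -/
def leadingSpace (M : Population) (k : Fin 2) (p : ℕ) : Submodule ℝ (Vec p) :=
  Submodule.span ℝ (Set.range fun i : Fin (M.numSpikes k) => M.eigvecAt k p i)

/-- The common leading eigenspace (both classes have strong spikes). -/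
def commonSpace (M : Population) (p : ℕ) : Submodule ℝ (Vec p) :=
  M.leadingSpace 0 p ⊔ M.leadingSpace 1 p

/-- The norm of the mean difference is asymptotically `δ √p` with `δ > 0`. -/
def MeanGrowth (M : Population) : Prop :=
  ∃ δ : ℝ, 0 < δ ∧ Tendsto (fun p : ℕ => ‖M.meanDiff p‖ / Real.sqrt p) atTop (𝓝 δ)

/-- The spiked covariance model: conditions on the parameters of the eigenvalues. -/
structure Spiked (M : Population) : Prop where
  one_le_numSpikes : ∀ k, 1 ≤ M.numSpikes k
  spikeSq_pos : ∀ k i, i < M.numSpikes k → 0 < M.spikeSq k i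
  tailSq_pos : ∀ k i, 0 < M.tailSq k i
  tailSq_bdd : ∃ C : ℝ, ∀ k i, M.tailSq k i ≤ C
  tauSq_pos : ∀ k, 0 < M.tauSq k
  tendsto_tauSq : ∀ k,
    Tendsto (fun p : ℕ => (p : ℝ)⁻¹ * ∑ i ∈ Finset.range p, M.tailSq k i) atTop (𝓝 (M.tauSq k))

/-- The angles between the leading eigenvectors and the mean difference converge. -/
def LeadingAngles (M : Population) : Prop :=
  ∀ k, ∀ i < M.numSpikes k, ∃ θ ∈ Set.Icc (0 : ℝ) (Real.pi / 2),
    Tendsto (fun p => InnerProductGeometry.angle (M.eigvecAt k p i) (M.meanDiff p)) atTop (𝓝 θ)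

/-- `u p 0, …, u p (m - 1)` is, for all large `p`, an orthonormal basis of the common leading
eigenspace; its angles with the mean difference converge, the coordinates of the leading
eigenvectors of class `k` in this basis converge to a matrix `R k` with orthonormal columns, and
the concatenation of `R 0` and `R 1` has rank `m`. -/
structure CommonBasis (M : Population) (m : ℕ) (u : (p : ℕ) → Fin m → Vec p) : Prop where
  orthonormal : ∀ᶠ p in atTop, Orthonormal ℝ (u p)
  span_eq : ∀ᶠ p in atTop, Submodule.span ℝ (Set.range (u p)) = M.commonSpace p
  angles : ∀ i, ∃ θ ∈ Set.Icc (0 : ℝ) (Real.pi / 2),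
    Tendsto (fun p => InnerProductGeometry.angle (u p i) (M.meanDiff p)) atTop (𝓝 θ)
  coords : ∃ R : (k : Fin 2) → Matrix (Fin m) (Fin (M.numSpikes k)) ℝ,
    (∀ k, (R k)ᵀ * R k = 1) ∧
    (∀ k i (l : Fin (M.numSpikes k)),
      Tendsto (fun p => inner ℝ (u p i) (M.eigvecAt k p l)) atTop (𝓝 (R k i l))) ∧
    (Matrix.fromCols (R 0) (R 1)).rank = m

end Population

/-! ### The training sample -/

section Training

variable {Ω : Type*} [mΩ : MeasurableSpace Ω]

/-- The covariance matrix of a random vector. -/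
def covMatrix {p : ℕ} (P : Measure Ω) (Y : Ω → Vec p) : Matrix (Fin p) (Fin p) ℝ :=
  Matrix.of fun a b => cov[fun ω => Y ω a, fun ω => Y ω b; P]

/-- For every `p`, the `X p k j` are independent random vectors, those of class `k` being
identically distributed with an absolutely continuous law, with mean `M.mean k p` and with a
covariance matrix having the eigenvectors and eigenvalues prescribed by `M`. -/
structure TrainingSample (M : Population) (P : Measure Ω) (n : Fin 2 → ℕ)
    (X : (p : ℕ) → (k : Fin 2) → Fin (n k) → Ω → Vec p) : Prop where
  measurable : ∀ p k j, Measurable (X p k j)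
  indep : ∀ p, iIndepFun (fun s : (k : Fin 2) × Fin (n k) => X p s.1 s.2) P
  identDistrib : ∀ p k j j', IdentDistrib (X p k j) (X p k j') P P
  absCont : ∀ p k j, P.map (X p k j) ≪ volume
  memLp : ∀ p k j a, MemLp (fun ω => X p k j ω a) 2 P
  mean_eq : ∀ p k j a, ∫ ω, X p k j ω a ∂P = M.mean k p a
  cov_eigen : ∀ p k j (i : Fin p),
    covMatrix P (X p k j) *ᵥ (M.eigvec k p i).ofLp = M.eigval k p i • (M.eigvec k p i).ofLp

/-- The `i`-th true principal component score of a vector `x` of class `k`. -/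
def score (M : Population) (k : Fin 2) {p : ℕ} (x : Vec p) (i : Fin p) : ℝ :=
  (Real.sqrt (M.eigval k p i))⁻¹ * inner ℝ (M.eigvec k p i) (x - M.mean k p)

/-- For every observation there is one infinite random sequence, with uniformly bounded fourth
moments and rho-mixing after some permutation, such that for every `p` the vector of scores
consists of the first `p` elements of the sequence. -/
def RegularScores (M : Population) (P : Measure Ω) (n : Fin 2 → ℕ)
    (X : (p : ℕ) → (k : Fin 2) → Fin (n k) → Ω → Vec p) : Prop :=
  ∃ z : (k : Fin 2) → Fin (n k) → ℕ → Ω → ℝ,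
    (∀ k j i, Measurable (z k j i)) ∧
    (∀ p k j (i : Fin p), ∀ᵐ ω ∂P, score M k (X p k j ω) i = z k j i ω) ∧
    (∃ C : ℝ, ∀ k j i, MemLp (z k j i) 4 P ∧ ∫ ω, z k j i ω ^ 4 ∂P ≤ C) ∧
    (∀ k j, ∃ π : Equiv.Perm ℕ, RhoMixing P fun i => z k j (π i))

end Training

/-! ### Sample quantities

Here `x k j` is the `j`-th observation of class `k`. -/

section Sample

variable {n : Fin 2 → ℕ} {p : ℕ}

/-- The sample mean of class `k`. -/
def classMean (x : (k : Fin 2) → Fin (n k) → Vec p) (k : Fin 2) : Vec p :=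
  (n k : ℝ)⁻¹ • ∑ j, x k j

/-- The total sample mean. -/
def totalMean (x : (k : Fin 2) → Fin (n k) → Vec p) : Vec p :=
  ((n 0 + n 1 : ℕ) : ℝ)⁻¹ • ∑ k, ∑ j, x k j

/-- The sample mean difference. -/
def sampleDiff (x : (k : Fin 2) → Fin (n k) → Vec p) : Vec p :=
  classMean x 0 - classMean x 1

/-- The within-class scatter matrix. -/
def withinScatter (x : (k : Fin 2) → Fin (n k) → Vec p) : Matrix (Fin p) (Fin p) ℝ :=
  ∑ k, ∑ j, Matrix.vecMulVec (x k j - classMean x k).ofLp (x k j - classMean x k).ofLp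

/-- The between-class scatter matrix. -/
def betweenScatter (x : (k : Fin 2) → Fin (n k) → Vec p) : Matrix (Fin p) (Fin p) ℝ :=
  ∑ k, (n k : ℝ) •
    Matrix.vecMulVec (classMean x k - totalMean x).ofLp (classMean x k - totalMean x).ofLp

/-- The quadratic form of a matrix. -/
def quadForm (A : Matrix (Fin p) (Fin p) ℝ) (w : Vec p) : ℝ := w.ofLp ⬝ᵥ (A *ᵥ w.ofLp)

/-- `w` is a maximal data piling direction: it maximizes the between-class scatter among the unit
vectors along which the within-class scatter vanishes. -/
def IsMDP (x : (k : Fin 2) → Fin (n k) → Vec p) (w : Vec p) : Prop :=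
  (‖w‖ = 1 ∧ quadForm (withinScatter x) w = 0) ∧
    ∀ w' : Vec p, ‖w'‖ = 1 → quadForm (withinScatter x) w' = 0 →
      quadForm (betweenScatter x) w' ≤ quadForm (betweenScatter x) w

/-- `A = Û Diag(lam) Ûᵀ` with orthonormal eigenvectors and eigenvalues in descending order. -/
def IsEigenDecomp (A : Matrix (Fin p) (Fin p) ℝ) (lam : Fin p → ℝ)
    (U : OrthonormalBasis (Fin p) ℝ (Vec p)) : Prop :=
  Antitone lam ∧ ∀ i, A *ᵥ (U i).ofLp = lam i • (U i).ofLp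

/-- The signal subspace spanned by the first `m` sample eigenvectors and `w`. -/
def signalSpace (m : ℕ) (U : OrthonormalBasis (Fin p) ℝ (Vec p)) (w : Vec p) :
    Submodule ℝ (Vec p) :=
  Submodule.span ℝ ({v | ∃ i : Fin p, (i : ℕ) < m ∧ v = U i} ∪ {w})

/-- The projected ridged linear discriminant vector before normalization. With `N` the total
sample size, the second sum is the projection of `d` onto the span of the sample eigenvectors of
(one-based) index at least `N - 1`. -/
def ridgeVec (m N : ℕ) (α : ℝ) (lam : Fin p → ℝ) (U : OrthonormalBasis (Fin p) ℝ (Vec p))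
    (d : Vec p) : Vec p :=
  (∑ i ∈ (Finset.univ : Finset (Fin p)).filter (fun i : Fin p => i.val < m),
      (α * (p : ℝ) / (lam i + α * (p : ℝ)) * inner ℝ (U i) d) • U i) +
    ∑ i ∈ (Finset.univ : Finset (Fin p)).filter (fun i : Fin p => N ≤ i.val + 2), inner ℝ (U i) d • U i

/-- The projected ridged linear discriminant vector, normalized to length one. -/
def ridgeDir (m N : ℕ) (α : ℝ) (lam : Fin p → ℝ) (U : OrthonormalBasis (Fin p) ℝ (Vec p))
    (d : Vec p) : Vec p :=
  ‖ridgeVec m N α lam U d‖⁻¹ • ridgeVec m N α lam U d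

end Sample

end DataPiling

end

/-! After division by `√p` the problem has a fixed-size limit. Let `Y` be the scaled observations
centered at their class means, so that `Y Y‡ = S_W / p`; let `d` be the scaled sample mean
difference and `Q` the isometry onto the common leading eigenspace. The spike scores do not depend
on `p`. The noise is asymptotically white with the same variance `t = τ²` in both classes and
orthogonal to everything else. Hence `Y‡Y → W‡W + tC` (`C` the within-class centering), `Q‡Y → W`,
`Q‡d → η`, and `Y‡d → W‡η`, because the noise in the class means is removed by centering.
`SpikeLimit` records these limits; equality of the two noise levels is what makes the noise term a
multiple of `C`, while the spike parts of the two classes may differ freely.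

Since `W‡` is injective, the first `m` eigenvalues of `Y Y‡` stay above `t + c`, the remaining ones
up to the rank `r = n₁ + n₂ - 2` of `C` tend to `t`, and the rest vanish. Every signal vector is `u
= Q x` with `x = W W‡ y`. Put `z = Y W‡ y`. For `α → -t` the limits give `(Y Y‡ + α) z ≈ Y Y‡ u`, so
on a leading eigenvector `α/(λ+α)·⟨b,u⟩ ≈ ⟨b,u⟩ - ⟨b,z⟩`. The same holds with weight 1 beyond the
rank, where `⟨b,z⟩ = 0`, and with weight 0 in between, where both coordinates are small. Summing
against `d`, the inner product of the ridged vector with `u` is close to `⟨d,u⟩ - ⟨d,z⟩`, whose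
limit is `⟨η, W W‡ y⟩ - ⟨W‡η, W‡y⟩ = 0` (`tendsto_inner_scaledRidge`).

The ridged vector lies in the signal subspace because its null-space part is a multiple of the data
piling direction (`IsMDP.tail_mem_span`), so replacing `u` by its projection does not change the
inner product. Both vectors have norms bounded below, hence the angle tends to `π/2`
(`SpikeLimit.tendsto_angle`).

Probability enters through `tendsto_measure_bad`. It reduces the claim to filters on `ℕ × Ω` along
which the noise deviations vanish and the score sequence converges to a limit in general position.
The deviations are handled by second moments and a law of large numbers under rho-mixing, general
position by absolute continuity. -/

noncomputable section
namespace DataPiling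
local postfix:max "‡" => ContinuousLinearMap.adjoint

/-! ### Eigenvalues of `Y Y‡` -/

section Spectral

variable {q : ℕ} {F : Type*} [NormedAddCommGroup F] [InnerProductSpace ℝ F]
  [FiniteDimensional ℝ F]

/-- `b` is an orthonormal eigenbasis of `Y Y‡` with eigenvalues `lam` in descending order. -/
structure IsEigenbasis (Y : F →L[ℝ] Vec q) (lam : Fin q → ℝ)
    (b : OrthonormalBasis (Fin q) ℝ (Vec q)) : Prop where
  antitone : Antitone lam
  eigen : ∀ l, Y (Y‡ (b l)) = lam l • b l

variable {Y : F →L[ℝ] Vec q} {lam : Fin q → ℝ} {b : OrthonormalBasis (Fin q) ℝ (Vec q)}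

theorem IsEigenbasis.inner_apply (h : IsEigenbasis Y lam b) (l : Fin q) (x : Vec q) :
    inner ℝ (b l) (Y (Y‡ x)) = lam l * inner ℝ (b l) x := by
  rw [← ContinuousLinearMap.adjoint_inner_left, ContinuousLinearMap.adjoint_inner_right, h.eigen,
    real_inner_smul_left]

theorem IsEigenbasis.norm_adjoint_sq (h : IsEigenbasis Y lam b) (x : Vec q) :
    ‖Y‡ x‖ ^ 2 = ∑ l, lam l * inner ℝ (b l) x ^ 2 := by
  rw [← real_inner_self_eq_norm_sq, ContinuousLinearMap.adjoint_inner_left,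
    ← b.sum_inner_mul_inner]
  refine Finset.sum_congr rfl fun l _ => ?_
  rw [h.inner_apply, real_inner_comm]
  ring

theorem IsEigenbasis.eq_norm_sq (h : IsEigenbasis Y lam b) (l : Fin q) :
    lam l = ‖Y‡ (b l)‖ ^ 2 := by
  rw [← real_inner_self_eq_norm_sq, ContinuousLinearMap.adjoint_inner_left, h.eigen,
    real_inner_smul_right, real_inner_self_eq_norm_sq, b.norm_eq_one]
  simp

theorem IsEigenbasis.nonneg (h : IsEigenbasis Y lam b) (l : Fin q) : 0 ≤ lam l := by
  rw [h.eq_norm_sq]; positivity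

theorem IsEigenbasis.le_norm_sq (h : IsEigenbasis Y lam b) (l : Fin q) :
    lam l ≤ ‖Y‖ ^ 2 := by
  rw [h.eq_norm_sq]
  have := (Y‡).le_opNorm (b l)
  rw [b.norm_eq_one, mul_one, LinearIsometryEquiv.norm_map] at this
  gcongr

theorem sum_sq_inner (b : OrthonormalBasis (Fin q) ℝ (Vec q)) (x : Vec q) :
    ∑ l, inner ℝ (b l) x ^ 2 = ‖x‖ ^ 2 := by
  rw [← b.sum_sq_norm_inner_right x]
  simp

/-- A vector in the span of `b 0, …, b k` annihilated by a map to a space of dimension `≤ k`. -/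
theorem IsEigenbasis.exists_unit_le (h : IsEigenbasis Y lam b) (k : Fin q)
    {G : Type*} [AddCommGroup G] [Module ℝ G] [FiniteDimensional ℝ G] (Φ : Vec q →ₗ[ℝ] G)
    (hG : Module.finrank ℝ G ≤ k) :
    ∃ x : Vec q, ‖x‖ = 1 ∧ Φ x = 0 ∧ lam k ≤ ‖Y‡ x‖ ^ 2 := by
  classical
  let s : Set (Fin q) := Set.Iic k
  let E : Submodule ℝ (Vec q) := Submodule.span ℝ (b '' s)
  have hE : Module.finrank ℝ E = k + 1 := by
    have h1 : LinearIndependent ℝ (fun i : s => b i) :=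
      b.orthonormal.linearIndependent.comp _ Subtype.val_injective
    have h2 := finrank_span_eq_card h1
    have h3 : Set.range (fun i : s => b i) = b '' s := by
      rw [Set.image_eq_range]
    rw [h3] at h2
    rw [h2]
    simp [s]
  -- The dimension count of Courant–Fischer: a space of dimension `k + 1` is mapped into one of
  -- dimension at most `k`.
  have hker : (Φ.domRestrict E).ker ≠ ⊥ := by
    apply LinearMap.ker_ne_bot_of_finrank_lt
    omega
  obtain ⟨y, hy, hy0⟩ := (Submodule.ne_bot_iff _).1 hker
  have hy0' : (y : Vec q) ≠ 0 := by simpa using hy0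
  have hn : 0 < ‖(y : Vec q)‖ := norm_pos_iff.2 hy0'
  have hz : ∀ l, k < l → inner ℝ (b l) (y : Vec q) = 0 := by
    intro l hl
    refine Submodule.span_induction (p := fun v _ => inner ℝ (b l) v = 0) ?_ ?_ ?_ ?_ y.2
    · rintro _ ⟨i, hi, rfl⟩
      exact b.orthonormal.2 (ne_of_gt (lt_of_le_of_lt hi hl))
    · simp
    · intro v w _ _ hv hw
      rw [inner_add_right, hv, hw, add_zero]
    · intro a v _ hv
      rw [real_inner_smul_right, hv, mul_zero]
  have key : lam k * ‖(y : Vec q)‖ ^ 2 ≤ ‖Y‡ (y : Vec q)‖ ^ 2 := by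
    rw [h.norm_adjoint_sq, ← sum_sq_inner b, Finset.mul_sum]
    refine Finset.sum_le_sum fun l _ => ?_
    rcases le_or_gt l k with hl | hl
    · exact mul_le_mul_of_nonneg_right (h.antitone hl) (sq_nonneg _)
    · simp [hz l hl]
  refine ⟨‖(y : Vec q)‖⁻¹ • (y : Vec q), ?_, ?_, ?_⟩
  · rw [norm_smul, norm_inv, norm_norm, inv_mul_cancel₀ hn.ne']
  · have : Φ y = 0 := by simpa using hy
    rw [map_smul, this, smul_zero]
  · rw [map_smul, norm_smul, norm_inv, norm_norm, mul_pow, inv_pow, inv_mul_eq_div,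
      le_div_iff₀ (by positivity)]
    exact key

/-- If `‖Y a‖² ≥ κ ‖a‖²` on a subspace of dimension `> k`, then `κ` bounds the eigenvalue with
index `k` from below. -/
theorem IsEigenbasis.le_of_forall_le (h : IsEigenbasis Y lam b) (k : Fin q) {κ : ℝ} (hκ : 0 < κ)
    (V : Submodule ℝ F) (hV : k < Module.finrank ℝ V)
    (hle : ∀ a ∈ V, κ * ‖a‖ ^ 2 ≤ ‖Y a‖ ^ 2) : κ ≤ lam k := by
  -- Since `dim V > k`, some nonzero `a ∈ V` makes `Y a` orthogonal to the first `k` eigenvectors.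
  let Φ : V →ₗ[ℝ] (Fin k → ℝ) :=
    LinearMap.pi fun l => ((innerSL ℝ (b ⟨l, l.2.trans k.2⟩)).toLinearMap ∘ₗ Y.toLinearMap) ∘ₗ
      V.subtype
  have hker : Φ.ker ≠ ⊥ := by
    apply LinearMap.ker_ne_bot_of_finrank_lt
    simpa using hV
  obtain ⟨a, ha, ha0⟩ := (Submodule.ne_bot_iff _).1 hker
  have ha0' : 0 < ‖(a : F)‖ := norm_pos_iff.2 (by simpa using ha0)
  set x := Y a with hx
  have hz : ∀ l, l < k → inner ℝ (b l) x = 0 := by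
    intro l hl
    have := congrFun (LinearMap.mem_ker.1 ha) ⟨l, hl⟩
    simpa [Φ] using this
  have h1 : ‖Y‡ x‖ ^ 2 ≤ lam k * ‖x‖ ^ 2 := by
    rw [h.norm_adjoint_sq, ← sum_sq_inner b, Finset.mul_sum]
    refine Finset.sum_le_sum fun l _ => ?_
    rcases lt_or_ge l k with hl | hl
    · simp [hz l hl]
    · exact mul_le_mul_of_nonneg_right (h.antitone hl) (sq_nonneg _)
  -- This passes from `Y Y‡` to `Y‡ Y`: `‖x‖⁴ ≤ ‖a‖² ‖Y‡ x‖² ≤ ‖a‖² λ ‖x‖²`, hence `κ ‖a‖² ≤ ‖x‖² ≤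
  -- λ ‖a‖²`.
  have h2 : ‖x‖ ^ 2 ≤ ‖(a : F)‖ * ‖Y‡ x‖ := by
    rw [← real_inner_self_eq_norm_sq, hx, ← ContinuousLinearMap.adjoint_inner_right]
    exact real_inner_le_norm _ _
  have h3 : κ * ‖(a : F)‖ ^ 2 ≤ ‖x‖ ^ 2 := hle a a.2
  have hx2 : 0 < ‖x‖ ^ 2 := lt_of_lt_of_le (by positivity) h3
  have h4 : (‖x‖ ^ 2) ^ 2 ≤ ‖(a : F)‖ ^ 2 * (lam k * ‖x‖ ^ 2) := by
    calc (‖x‖ ^ 2) ^ 2 ≤ (‖(a : F)‖ * ‖Y‡ x‖) ^ 2 := by gcongr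
      _ = ‖(a : F)‖ ^ 2 * ‖Y‡ x‖ ^ 2 := by ring
      _ ≤ _ := by gcongr
  have h5 : ‖x‖ ^ 2 ≤ ‖(a : F)‖ ^ 2 * lam k := by
    nlinarith
  have h6 : 0 < ‖(a : F)‖ ^ 2 := by positivity
  nlinarith

/-- The eigenvalues vanish beyond the dimension of the range of `Y‡`. -/
theorem IsEigenbasis.eq_zero_of_finrank_le (h : IsEigenbasis Y lam b) (k : Fin q)
    (V : Submodule ℝ F) (hV : Module.finrank ℝ V ≤ k) (hY : ∀ x, Y‡ x ∈ V) : lam k = 0 := by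
  obtain ⟨x, -, hx, hle⟩ :=
    h.exists_unit_le k ((Y‡).toLinearMap.codRestrict V hY) hV
  have : Y‡ x = 0 := by simpa using congrArg Subtype.val hx
  rw [this] at hle
  exact le_antisymm (by simpa using hle) (h.nonneg k)

/-- The C*-identity trades an operator on a space of growing dimension for its Gram operator on the
fixed space `F`, where limits are available. -/
theorem adjoint_norm_sq_le (N : F →L[ℝ] Vec q) (x : Vec q) :
    ‖N‡ x‖ ^ 2 ≤ ‖N‡ ∘L N‖ * ‖x‖ ^ 2 := by
  rw [ContinuousLinearMap.norm_adjoint_comp_self]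
  have := (N‡).le_opNorm x
  rw [LinearIsometryEquiv.norm_map] at this
  calc ‖N‡ x‖ ^ 2 ≤ (‖N‖ * ‖x‖) ^ 2 := by gcongr
    _ = _ := by ring

end Spectral

/-! ### The asymptotic Gram structure and the limits of the sample eigenvalues. -/

section Limit

variable {ι : Type*} {L : Filter ι} {q : ι → ℕ}
  {F H : Type*} [NormedAddCommGroup F] [InnerProductSpace ℝ F] [FiniteDimensional ℝ F]
  [NormedAddCommGroup H] [InnerProductSpace ℝ H] [FiniteDimensional ℝ H]

/-- Asymptotic Gram structure of scaled data `Y` and a scaled mean difference `d` relative to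
isometric embeddings `Q` of a fixed signal space `H`: outside of the range of `Q`, the data are
asymptotically white with variance `t`. -/
structure SpikeLimit (L : Filter ι) (Y : ∀ i, F →L[ℝ] Vec (q i)) (Q : ∀ i, H →L[ℝ] Vec (q i))
    (d : ∀ i, Vec (q i)) (W : F →L[ℝ] H) (C : F →L[ℝ] F) (η : H) (t κ : ℝ) : Prop where
  t_pos : 0 < t
  κ_pos : 0 < κ
  isometry : ∀ᶠ i in L, (Q i)‡ ∘L Q i = 1
  C_adj : C‡ = C
  C_idem : C ∘L C = C
  Y_C : ∀ i, Y i ∘L C = Y i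
  W_C : W ∘L C = W
  W_inj : Function.Injective (W‡)
  gram : Tendsto (fun i => (Y i)‡ ∘L Y i) L (𝓝 (W‡ ∘L W + t • C))
  cross : Tendsto (fun i => (Q i)‡ ∘L Y i) L (𝓝 W)
  d_cross : Tendsto (fun i => (Q i)‡ (d i)) L (𝓝 η)
  d_gram : Tendsto (fun i => (Y i)‡ (d i)) L (𝓝 (W‡ η))
  d_norm : Tendsto (fun i => ‖d i‖ ^ 2) L (𝓝 (‖η‖ ^ 2 + κ))

namespace SpikeLimit

variable {Y : ∀ i, F →L[ℝ] Vec (q i)} {Q : ∀ i, H →L[ℝ] Vec (q i)}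
  {d : ∀ i, Vec (q i)} {W : F →L[ℝ] H} {C : F →L[ℝ] F} {η : H} {t κ : ℝ}
  {lam : ∀ i, Fin (q i) → ℝ} {b : ∀ i, OrthonormalBasis (Fin (q i)) ℝ (Vec (q i))}
  {α : ι → ℝ}

theorem inner_C (h : SpikeLimit L Y Q d W C η t κ) (a : F) : inner ℝ a (C a) = ‖C a‖ ^ 2 := by
  rw [← real_inner_self_eq_norm_sq, ← ContinuousLinearMap.adjoint_inner_right, h.C_adj]
  have : C (C a) = C a := congrArg (fun T : F →L[ℝ] F => T a) h.C_idem
  rw [this]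

theorem norm_C_le (h : SpikeLimit L Y Q d W C η t κ) : ‖C‖ ≤ 1 := by
  have h1 := ContinuousLinearMap.norm_adjoint_comp_self C
  rw [h.C_adj, h.C_idem] at h1
  by_contra! h2
  nlinarith

theorem C_W_adj (h : SpikeLimit L Y Q d W C η t κ) (x : H) : C (W‡ x) = W‡ x := by
  have := congrArg ContinuousLinearMap.adjoint h.W_C
  rw [ContinuousLinearMap.adjoint_comp, h.C_adj] at this
  exact congrArg (fun T : H →L[ℝ] F => T x) this

theorem C_Y_adj (h : SpikeLimit L Y Q d W C η t κ) (i : ι) (x : Vec (q i)) :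
    C ((Y i)‡ x) = (Y i)‡ x := by
  have := congrArg ContinuousLinearMap.adjoint (h.Y_C i)
  rw [ContinuousLinearMap.adjoint_comp, h.C_adj] at this
  exact congrArg (fun T : Vec (q i) →L[ℝ] F => T x) this

theorem norm_bdd (h : SpikeLimit L Y Q d W C η t κ) :
    ∃ B : ℝ, 0 < B ∧ ∀ᶠ i in L, ‖Y i‖ ≤ B := by
  refine ⟨‖W‡ ∘L W + t • C‖ + 1 + 1, by positivity, ?_⟩
  have := h.gram.norm.eventually_lt_const (lt_add_one _)
  filter_upwards [this] with i hi
  rw [ContinuousLinearMap.norm_adjoint_comp_self] at hi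
  have := norm_nonneg (W‡ ∘L W + t • C)
  by_contra! h2
  nlinarith

theorem tendsto_apply_zero (h : SpikeLimit L Y Q d W C η t κ) {z : ι → F}
    (hz : Tendsto z L (𝓝 0)) : Tendsto (fun i => ‖Y i (z i)‖) L (𝓝 0) := by
  obtain ⟨B, hB, hY⟩ := h.norm_bdd
  have : Tendsto (fun i => B * ‖z i‖) L (𝓝 0) := by
    simpa using hz.norm.const_mul B
  refine squeeze_zero' (Eventually.of_forall fun i => norm_nonneg _) ?_ this
  filter_upwards [hY] with i hi
  exact (Y i).le_of_opNorm_le hi _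

theorem d_bdd (h : SpikeLimit L Y Q d W C η t κ) :
    ∃ B : ℝ, 0 < B ∧ ∀ᶠ i in L, ‖d i‖ ≤ B := by
  have hκ := h.κ_pos
  refine ⟨‖η‖ ^ 2 + κ + 1 + 1, by positivity, ?_⟩
  filter_upwards [h.d_norm.eventually_lt_const (lt_add_one _)] with i hi
  by_contra! h2
  have := sq_nonneg ‖η‖
  nlinarith

/-- Norm convergence of the Gram operators makes the quadratic forms close uniformly in `a`, as the
variational bounds on eigenvalues require. -/
theorem gram_sub_le (h : SpikeLimit L Y Q d W C η t κ) {ε : ℝ} (hε : 0 < ε) :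
    ∀ᶠ i in L, ∀ a, |‖Y i a‖ ^ 2 - (‖W a‖ ^ 2 + t * ‖C a‖ ^ 2)| ≤ ε * ‖a‖ ^ 2 := by
  have h1 := (tendsto_iff_norm_sub_tendsto_zero.1 h.gram).eventually_lt_const hε
  filter_upwards [h1] with i hi a
  have h2 : ‖Y i a‖ ^ 2 - (‖W a‖ ^ 2 + t * ‖C a‖ ^ 2) =
      inner ℝ a (((Y i)‡ ∘L Y i - (W‡ ∘L W + t • C)) a) := by
    simp only [_root_.sub_apply, _root_.add_apply,
      ContinuousLinearMap.comp_apply, _root_.smul_apply, inner_sub_right,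
      inner_add_right, inner_smul_right, ContinuousLinearMap.adjoint_inner_right,
      real_inner_self_eq_norm_sq, h.inner_C]
  rw [h2]
  calc _ ≤ ‖a‖ * ‖((Y i)‡ ∘L Y i - (W‡ ∘L W + t • C)) a‖ := abs_real_inner_le_norm _ _
    _ ≤ ‖a‖ * (ε * ‖a‖) := by
      gcongr
      exact ContinuousLinearMap.le_of_opNorm_le _ hi.le _
    _ = _ := by ring

/-- The leading eigenvalues are bounded away from `t` from above. -/
theorem exists_add_le_eigenvalue (h : SpikeLimit L Y Q d W C η t κ)
    (hb : ∀ᶠ i in L, IsEigenbasis (Y i) (lam i) (b i)) :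
    ∃ c : ℝ, 0 < c ∧ ∀ᶠ i in L, ∀ l : Fin (q i), l < Module.finrank ℝ H → t + c ≤ lam i l := by
  obtain ⟨K, hK, hanti⟩ := (W‡).toLinearMap.injective_iff_antilipschitz.1 h.W_inj
  have hKx : ∀ x, ‖x‖ ≤ K * ‖W‡ x‖ := fun x => by
    simpa using hanti.le_mul_dist x 0
  have hK' : (0 : ℝ) < K := hK
  have hW : ∀ x, ‖W‡ x‖ ≤ K * ‖W (W‡ x)‖ := by
    intro x
    have h1 : ‖W‡ x‖ ^ 2 ≤ ‖x‖ * ‖W (W‡ x)‖ := by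
      rw [← real_inner_self_eq_norm_sq, ContinuousLinearMap.adjoint_inner_left]
      exact real_inner_le_norm _ _
    rcases (norm_nonneg (W‡ x)).eq_or_lt with h0 | h0
    · rw [← h0]; positivity
    · have h2 : ‖x‖ * ‖W (W‡ x)‖ ≤ (K * ‖W‡ x‖) * ‖W (W‡ x)‖ := by
        gcongr; exact hKx x
      nlinarith
  -- On the range of `W‡`, which `C` fixes, the limiting form is at least `(t + K⁻²) ‖a‖²`. Half of
  -- the excess absorbs the Gram error.
  refine ⟨(K ^ 2 : ℝ)⁻¹ / 2, by positivity, ?_⟩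
  have hc : 0 < (K ^ 2 : ℝ)⁻¹ / 2 := by positivity
  filter_upwards [h.gram_sub_le hc, hb] with i hi hbi l hl
  refine hbi.le_of_forall_le l (by have := h.t_pos; positivity) (W‡).toLinearMap.range ?_ ?_
  · rwa [LinearMap.finrank_range_of_inj h.W_inj]
  · rintro _ ⟨x, rfl⟩
    have h1 := (abs_le.1 (hi (W‡ x))).1
    rw [h.C_W_adj] at h1
    have h2 : (K ^ 2 : ℝ)⁻¹ * ‖W‡ x‖ ^ 2 ≤ ‖W (W‡ x)‖ ^ 2 := by
      rw [inv_mul_le_iff₀ (by positivity), ← mul_pow]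
      gcongr
      exact hW x
    change _ * ‖W‡ x‖ ^ 2 ≤ ‖Y i (W‡ x)‖ ^ 2
    nlinarith

/-- The middle eigenvalues converge to `t`. -/
theorem eigenvalue_sub_le (h : SpikeLimit L Y Q d W C η t κ)
    (hb : ∀ᶠ i in L, IsEigenbasis (Y i) (lam i) (b i)) {ε : ℝ} (hε : 0 < ε) :
    ∀ᶠ i in L, ∀ l : Fin (q i), Module.finrank ℝ H ≤ l →
      l < Module.finrank ℝ C.toLinearMap.range → |lam i l - t| ≤ ε := by
  have ht := h.t_pos
  -- Removing the signal component of `Y` subtracts `W‡W` from the Gram limit and leaves `tC`, of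
  -- norm at most `t`.
  have hN : Tendsto (fun i => ‖(Y i)‡ ∘L Y i - ((Q i)‡ ∘L Y i)‡ ∘L ((Q i)‡ ∘L Y i)‖) L
      (𝓝 ‖t • C‖) := by
    have h1 : Tendsto (fun i => ((Q i)‡ ∘L Y i)‡ ∘L ((Q i)‡ ∘L Y i)) L (𝓝 (W‡ ∘L W)) := by
      have h2 : Continuous fun T : F →L[ℝ] H => T‡ ∘L T :=
        (ContinuousLinearMap.adjoint.continuous).clm_comp continuous_id
      exact (h2.tendsto W).comp h.cross
    have := (h.gram.sub h1).norm
    simpa using this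
  have hCle : ‖t • C‖ < t + ε := by
    rw [norm_smul, Real.norm_of_nonneg ht.le]
    have := h.norm_C_le
    nlinarith
  -- The cap `t / 2` keeps the lower bound `t - min ε (t / 2)` positive, as `le_of_forall_le`
  -- demands.
  have hδ : 0 < min ε (t / 2) := by positivity
  filter_upwards [h.gram_sub_le hδ, hb, hN.eventually_lt_const hCle, h.isometry]
    with i hi hbi hNi hQ l hl hl'
  rw [abs_le]
  constructor
  · have : t - min ε (t / 2) ≤ lam i l := by
      have h3 := min_le_right ε (t / 2)
      refine hbi.le_of_forall_le l (by linarith) C.toLinearMap.range hl' ?_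
      rintro _ ⟨a, rfl⟩
      have h1 := (abs_le.1 (hi (C a))).1
      have h2 : C (C a) = C a := congrArg (fun T : F →L[ℝ] F => T a) h.C_idem
      rw [h2] at h1
      change _ * ‖C a‖ ^ 2 ≤ ‖Y i (C a)‖ ^ 2
      nlinarith [sq_nonneg ‖W (C a)‖]
    have := min_le_left ε (t / 2)
    linarith
  -- As `dim H ≤ l`, a unit vector in the span of the first `l + 1` eigenvectors can be chosen
  -- orthogonal to the signal; there `Y‡` agrees with the adjoint of the signal-free part `N`.
  · obtain ⟨x, hx1, hx0, hx⟩ := hbi.exists_unit_le l ((Q i)‡).toLinearMap hl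
    have hx0 : (Q i)‡ x = 0 := hx0
    let N : F →L[ℝ] Vec (q i) := Y i - Q i ∘L ((Q i)‡ ∘L Y i)
    have hNadj : N‡ = (Y i)‡ - ((Q i)‡ ∘L Y i)‡ ∘L (Q i)‡ := by
      simp only [N, map_sub, ContinuousLinearMap.adjoint_comp]
    have hNx : N‡ x = (Y i)‡ x := by
      rw [hNadj]
      simp [hx0]
    have hNN : N‡ ∘L N = (Y i)‡ ∘L Y i - ((Q i)‡ ∘L Y i)‡ ∘L ((Q i)‡ ∘L Y i) := by
      rw [hNadj]
      have hQ' : ∀ y, (Q i)‡ (Q i y) = y := fun y =>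
        congrArg (fun T : H →L[ℝ] H => T y) hQ
      ext1 a
      simp [N, hQ', ContinuousLinearMap.adjoint_comp]
    have := adjoint_norm_sq_le N x
    rw [hNx, hNN, hx1] at this
    nlinarith

/-- The trailing eigenvalues vanish. -/
theorem eigenvalue_eq_zero (h : SpikeLimit L Y Q d W C η t κ) {i : ι}
    (hb : IsEigenbasis (Y i) (lam i) (b i)) (l : Fin (q i))
    (hl : Module.finrank ℝ C.toLinearMap.range ≤ l) : lam i l = 0 :=
  hb.eq_zero_of_finrank_le l _ hl fun x => ⟨_, h.C_Y_adj i x⟩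

theorem inner_basis_eq_zero (h : SpikeLimit L Y Q d W C η t κ) {i : ι}
    (hb : IsEigenbasis (Y i) (lam i) (b i)) (l : Fin (q i))
    (hl : Module.finrank ℝ C.toLinearMap.range ≤ l) (a : F) : inner ℝ (b i l) (Y i a) = 0 := by
  have h1 := hb.eq_norm_sq l
  rw [h.eigenvalue_eq_zero hb l hl] at h1
  have h2 : (Y i)‡ (b i l) = 0 := by simpa using h1.symm
  rw [← ContinuousLinearMap.adjoint_inner_left, h2, inner_zero_left]

theorem finrank_le (h : SpikeLimit L Y Q d W C η t κ) :
    Module.finrank ℝ H ≤ Module.finrank ℝ C.toLinearMap.range := by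
  rw [← LinearMap.finrank_range_of_inj (f := (W‡).toLinearMap) h.W_inj]
  refine Submodule.finrank_mono ?_
  rintro _ ⟨x, rfl⟩
  exact ⟨W‡ x, h.C_W_adj x⟩

theorem tendsto_adjoint_apply (h : SpikeLimit L Y Q d W C η t κ) (x : H) :
    Tendsto (fun i => (Y i)‡ (Q i x)) L (𝓝 (W‡ x)) := by
  have h1 : Tendsto (fun i => ((Q i)‡ ∘L Y i)‡) L (𝓝 (W‡)) :=
    ((ContinuousLinearMap.adjoint (𝕜 := ℝ) (E := F) (F := H)).continuous.tendsto W).comp h.cross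
  have h2 : Tendsto (fun i => (((Q i)‡ ∘L Y i)‡) x) L (𝓝 (W‡ x)) :=
    ((ContinuousLinearMap.apply ℝ F x).continuous.tendsto _).comp h1
  refine h2.congr fun i => ?_
  rw [ContinuousLinearMap.adjoint_comp]
  simp

end SpikeLimit
end Limit

/-- The combination of eigenvectors defining the ridged discriminant vector, for scaled data. -/
def scaledRidge {q : ℕ} (m r : ℕ) (α : ℝ) (lam : Fin q → ℝ)
    (b : OrthonormalBasis (Fin q) ℝ (Vec q)) (d : Vec q) : Vec q :=
  (∑ l ∈ (Finset.univ : Finset (Fin q)).filter (fun l : Fin q => l.val < m),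
      (α / (lam l + α) * inner ℝ (b l) d) • b l) +
    ∑ l ∈ (Finset.univ : Finset (Fin q)).filter (fun l : Fin q => r ≤ l.val), inner ℝ (b l) d • b l

theorem inner_sum_filter_smul {q : ℕ} (b : OrthonormalBasis (Fin q) ℝ (Vec q))
    (s : Fin q → Prop) [DecidablePred s] (c : Fin q → ℝ) (l : Fin q) :
    inner ℝ (b l) (∑ l ∈ Finset.univ.filter s, c l • b l) = if s l then c l else 0 := by
  classical
  rw [inner_sum]
  simp only [inner_smul_right, b.inner_eq_ite]
  simp

theorem norm_tail_le_norm_scaledRidge {q m r : ℕ} (hmr : m ≤ r) (α : ℝ) (lam : Fin q → ℝ)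
    (b : OrthonormalBasis (Fin q) ℝ (Vec q)) (d : Vec q) :
    ‖∑ l ∈ (Finset.univ : Finset (Fin q)).filter (fun l : Fin q => r ≤ l.val),
      inner ℝ (b l) d • b l‖ ^ 2 ≤ ‖scaledRidge m r α lam b d‖ ^ 2 := by
  rw [← sum_sq_inner b, ← sum_sq_inner b]
  refine Finset.sum_le_sum fun l _ => ?_
  rw [scaledRidge, inner_add_right, inner_sum_filter_smul, inner_sum_filter_smul]
  by_cases h : r ≤ l.val
  · have : ¬ l.val < m := by omega
    simp [h, this]
  · simp [h]
    positivity

/-! ### Position of the sample eigenvectors relative to the signal space. -/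

section Limit

variable {ι : Type*} {L : Filter ι} {q : ι → ℕ}
  {F H : Type*} [NormedAddCommGroup F] [InnerProductSpace ℝ F] [FiniteDimensional ℝ F]
  [NormedAddCommGroup H] [InnerProductSpace ℝ H] [FiniteDimensional ℝ H]

namespace SpikeLimit

variable {Y : ∀ i, F →L[ℝ] Vec (q i)} {Q : ∀ i, H →L[ℝ] Vec (q i)}
  {d : ∀ i, Vec (q i)} {W : F →L[ℝ] H} {C : F →L[ℝ] F} {η : H} {t κ : ℝ}
  {lam : ∀ i, Fin (q i) → ℝ} {b : ∀ i, OrthonormalBasis (Fin (q i)) ℝ (Vec (q i))}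
  {α : ι → ℝ}

/-- Injectivity of `W‡` makes `W W‡` injective, hence bijective in finite dimension. Every signal
direction is thus accessible to the resolvent relation below. -/
theorem surjective_W_comp_adjoint (h : SpikeLimit L Y Q d W C η t κ) (x : H) :
    ∃ y, W (W‡ y) = x := by
  have : Function.Injective (W ∘L W‡).toLinearMap := by
    rw [injective_iff_map_eq_zero]
    intro y hy
    have hy : W (W‡ y) = 0 := hy
    have h1 : inner ℝ y (W (W‡ y)) = (0 : ℝ) := by rw [hy, inner_zero_right]
    rw [← ContinuousLinearMap.adjoint_inner_left, inner_self_eq_zero] at h1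
    exact h.W_inj (by rw [h1, map_zero])
  exact LinearMap.injective_iff_surjective.1 this x

/-- With `z = Y W‡ y` and `u = Q W W‡ y`, the vector inside the norm is `(Y Y‡ + α) z - Y Y‡ u`. The
limit `-t` of `α` cancels exactly the noise term `tC`, since `C` fixes `W‡ y`. In eigencoordinates
this reads `(λ + α) ⟨b,z⟩ ≈ λ ⟨b,u⟩`. -/
theorem tendsto_resolvent_error (h : SpikeLimit L Y Q d W C η t κ)
    (hα : Tendsto α L (𝓝 (-t))) (y : H) :
    Tendsto (fun i => ‖Y i ((Y i)‡ (Y i (W‡ y)) + α i • W‡ y - (Y i)‡ (Q i (W (W‡ y))))‖)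
      L (𝓝 0) := by
  refine h.tendsto_apply_zero ?_
  have h1 : Tendsto (fun i => ((Y i)‡ ∘L Y i) (W‡ y)) L (𝓝 ((W‡ ∘L W + t • C) (W‡ y))) :=
    ((ContinuousLinearMap.apply ℝ F (W‡ y)).continuous.tendsto _).comp h.gram
  have h2 := (h1.add (hα.smul_const (W‡ y))).sub (h.tendsto_adjoint_apply (W (W‡ y)))
  have h3 : (W‡ ∘L W + t • C) (W‡ y) + -t • W‡ y - W‡ (W (W‡ y)) = 0 := by
    simp [h.C_W_adj]
  rwa [h3] at h2

theorem apply_bdd (h : SpikeLimit L Y Q d W C η t κ) (a : F) :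
    ∃ B : ℝ, 0 < B ∧ ∀ᶠ i in L, ‖Y i a‖ ≤ B := by
  obtain ⟨B, hB, hY⟩ := h.norm_bdd
  refine ⟨B * (‖a‖ + 1), by positivity, ?_⟩
  filter_upwards [hY] with i hi
  refine ((Y i).le_of_opNorm_le hi a).trans ?_
  gcongr
  linarith

theorem _root_.OrthonormalBasis.abs_inner_le_norm {κ E : Type*} [Fintype κ] [NormedAddCommGroup E]
    [InnerProductSpace ℝ E] (b : OrthonormalBasis κ ℝ E) (l : κ) (x : E) :
    |inner ℝ (b l) x| ≤ ‖x‖ := by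
  simpa using abs_real_inner_le_norm (b l) x

/-- The middle eigenvectors are asymptotically orthogonal to the signal space. -/
theorem abs_inner_basis_le (h : SpikeLimit L Y Q d W C η t κ)
    (hb : ∀ᶠ i in L, IsEigenbasis (Y i) (lam i) (b i)) (x : H) {ε : ℝ} (hε : 0 < ε) :
    ∀ᶠ i in L, ∀ l : Fin (q i), Module.finrank ℝ H ≤ l →
      l < Module.finrank ℝ C.toLinearMap.range → |inner ℝ (b i l) (Q i x)| ≤ ε := by
  obtain ⟨y, rfl⟩ := h.surjective_W_comp_adjoint x
  have ht := h.t_pos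
  obtain ⟨B, hB, hYa⟩ := h.apply_bdd (W‡ y)
  -- The first bound keeps `λ ≥ t / 2` for the final division; the second makes `(λ - t) ⟨b,z⟩` at
  -- most `tε / 4`. The resolvent error supplies the other `tε / 4`.
  have h1 : 0 < min (t / 2) (t * ε / (4 * B)) := by positivity
  have h2 := h.tendsto_resolvent_error (α := fun _ => -t) tendsto_const_nhds y
  have h3 : 0 < t * ε / 4 := by positivity
  filter_upwards [h.eigenvalue_sub_le hb h1, hb, hYa, h2.eventually_lt_const h3]
    with i hi hbi hBi herr l hl hl'
  have hlam := hi l hl hl'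
  have hl1 : |lam i l - t| ≤ t / 2 := hlam.trans (min_le_left _ _)
  have hl2 : |lam i l - t| ≤ t * ε / (4 * B) := hlam.trans (min_le_right _ _)
  have e1 := ((b i).abs_inner_le_norm l _).trans herr.le
  have e2 := ((b i).abs_inner_le_norm l _).trans hBi
  have e3 : inner ℝ (b i l)
      (Y i ((Y i)‡ (Y i (W‡ y)) + (-t) • W‡ y - (Y i)‡ (Q i (W (W‡ y))))) =
      (lam i l - t) * inner ℝ (b i l) (Y i (W‡ y)) -
        lam i l * inner ℝ (b i l) (Q i (W (W‡ y))) := by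
    rw [map_sub, map_add, map_smul, inner_sub_right, inner_add_right, hbi.inner_apply,
      hbi.inner_apply, inner_smul_right]
    ring
  rw [e3] at e1
  have e4 : |(lam i l - t) * inner ℝ (b i l) (Y i (W‡ y))| ≤ t * ε / (4 * B) * B := by
    rw [abs_mul]
    gcongr
  have e5 : t * ε / (4 * B) * B = t * ε / 4 := by field_simp
  rw [e5] at e4
  have e6 : |lam i l * inner ℝ (b i l) (Q i (W (W‡ y)))| ≤ t * ε / 2 := by
    rw [abs_le] at *
    constructor <;> linarith
  rw [abs_mul] at e6
  have e7 : t / 2 ≤ |lam i l| := by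
    rw [abs_le] at hl1
    rw [abs_of_nonneg] <;> linarith
  have e8 : t / 2 * |inner ℝ (b i l) (Q i (W (W‡ y)))| ≤ t / 2 * ε := by
    calc _ ≤ |lam i l| * |inner ℝ (b i l) (Q i (W (W‡ y)))| := by gcongr
      _ ≤ _ := e6
      _ = _ := by ring
  exact le_of_mul_le_mul_left e8 (by positivity)

/-- The middle eigenvectors are asymptotically orthogonal to the images `Y (W‡ y)`. -/
theorem abs_inner_basis_apply_le (h : SpikeLimit L Y Q d W C η t κ)
    (hb : ∀ᶠ i in L, IsEigenbasis (Y i) (lam i) (b i)) (y : H) {ε : ℝ} (hε : 0 < ε) :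
    ∀ᶠ i in L, ∀ l : Fin (q i), Module.finrank ℝ H ≤ l →
      l < Module.finrank ℝ C.toLinearMap.range → |inner ℝ (b i l) (Y i (W‡ y))| ≤ ε := by
  have ht := h.t_pos
  -- `Y W‡ y` is close to `Y Y‡ Q y`, whose coordinates `λ ⟨b, Q y⟩` are small by the preceding
  -- result.
  have h1 : Tendsto (fun i => ‖Y i ((Y i)‡ (Q i y) - W‡ y)‖) L (𝓝 0) := by
    refine h.tendsto_apply_zero ?_
    simpa using (h.tendsto_adjoint_apply y).sub_const (W‡ y)
  have h2 : 0 < ε / (4 * t) := by positivity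
  have h3 : 0 < ε / 2 := by positivity
  filter_upwards [h.eigenvalue_sub_le hb ht, hb, h.abs_inner_basis_le hb y h2,
    h1.eventually_lt_const h3] with i hi hbi hQi herr l hl hl'
  have hlam := hi l hl hl'
  have e1 := ((b i).abs_inner_le_norm l _).trans herr.le
  rw [map_sub, inner_sub_right, hbi.inner_apply] at e1
  have e2 : |lam i l| ≤ 2 * t := by
    rw [abs_le] at *
    constructor <;> linarith
  have e3 : |lam i l * inner ℝ (b i l) (Q i y)| ≤ 2 * t * (ε / (4 * t)) := by
    rw [abs_mul]
    exact mul_le_mul e2 (hQi l hl hl') (abs_nonneg _) (by positivity)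
  have e4 : 2 * t * (ε / (4 * t)) = ε / 2 := by field_simp; norm_num
  rw [e4] at e3
  rw [abs_le] at *
  constructor <;> linarith

/-- The signal vectors keep a non-negligible component in the leading eigenspace. -/
theorem exists_le_sum_sq_inner (h : SpikeLimit L Y Q d W C η t κ)
    (hb : ∀ᶠ i in L, IsEigenbasis (Y i) (lam i) (b i)) {x : H} (hx : x ≠ 0) :
    ∃ c : ℝ, 0 < c ∧ ∀ᶠ i in L,
      c ≤ ∑ l ∈ Finset.univ.filter (fun l : Fin (q i) => l.val < Module.finrank ℝ H),
        inner ℝ (b i l) (Q i x) ^ 2 := by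
  obtain ⟨B, hB, hY⟩ := h.norm_bdd
  set r := Module.finrank ℝ C.toLinearMap.range with hr
  have hw : 0 < ‖W‡ x‖ ^ 2 := by
    have : W‡ x ≠ 0 := fun h0 => hx (h.W_inj (by rw [h0, map_zero]))
    positivity
  set v := ‖W‡ x‖ ^ 2
  have h1 : Tendsto (fun i => ‖(Y i)‡ (Q i x)‖ ^ 2) L (𝓝 v) :=
    (h.tendsto_adjoint_apply x).norm.pow 2
  -- the middle part is negligible
  have hε : 0 < min 1 (v / (4 * B ^ 2 * (r + 1))) := by positivity
  -- `∑ λ ⟨b, Q x⟩² = ‖Y‡ Q x‖²` eventually exceeds `v / 2`. Middle indices take at most `v / 4` and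
  -- trailing ones nothing, so the leading ones, with `λ ≤ B²`, carry at least `v / 4`.
  refine ⟨v / (4 * B ^ 2), by positivity, ?_⟩
  filter_upwards [h1.eventually_const_lt (half_lt_self hw), hY, hb,
    h.abs_inner_basis_le hb x hε] with i hi hYi hbi hmid
  rw [hbi.norm_adjoint_sq] at hi
  have hle : ∀ l, lam i l ≤ B ^ 2 := fun l =>
    (hbi.le_norm_sq l).trans (by gcongr)
  set f : Fin (q i) → ℝ := fun l => inner ℝ (b i l) (Q i x) ^ 2
  have hf : ∀ l, 0 ≤ f l := fun l => sq_nonneg _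
  have key : ∑ l, lam i l * f l ≤
      B ^ 2 * ∑ l ∈ Finset.univ.filter (fun l : Fin (q i) => l.val < Module.finrank ℝ H), f l +
      ∑ l ∈ Finset.univ.filter (fun l : Fin (q i) => l.val < r), v / (4 * (r + 1)) := by
    rw [Finset.mul_sum, Finset.sum_filter, Finset.sum_filter, ← Finset.sum_add_distrib]
    refine Finset.sum_le_sum fun l _ => ?_
    have p1 : 0 ≤ v / (4 * (r + 1)) := by positivity
    have p2 : lam i l * f l ≤ B ^ 2 * f l := mul_le_mul_of_nonneg_right (hle l) (hf l)
    by_cases c1 : l.val < Module.finrank ℝ H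
    · by_cases c2 : l.val < r <;> simp only [c1, c2, if_true, if_false] <;> linarith
    · by_cases c2 : l.val < r
      · simp only [c1, c2, if_true, if_false]
        have m1 := hmid l (not_lt.1 c1) c2
        have m2 : |inner ℝ (b i l) (Q i x)| ≤ 1 := m1.trans (min_le_left _ _)
        have m3 : |inner ℝ (b i l) (Q i x)| ≤ v / (4 * B ^ 2 * (r + 1)) :=
          m1.trans (min_le_right _ _)
        have m4 : f l ≤ v / (4 * B ^ 2 * (r + 1)) := by
          simp only [f]
          rw [← sq_abs]
          nlinarith [abs_nonneg (inner ℝ (b i l) (Q i x))]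
        calc _ ≤ B ^ 2 * f l := p2
          _ ≤ B ^ 2 * (v / (4 * B ^ 2 * (r + 1))) := by gcongr
          _ = 0 + v / (4 * (r + 1)) := by field_simp; ring
      · simp only [c1, c2, if_false]
        rw [h.eigenvalue_eq_zero hbi l (not_lt.1 c2)]
        simp
  have hcard : ((Finset.univ.filter (fun l : Fin (q i) => l.val < r)).card : ℝ) ≤ r + 1 := by
    have : (Finset.univ.filter (fun l : Fin (q i) => l.val < r)).card ≤ r := by
      have := Finset.card_le_card_of_injOn (s := Finset.univ.filter (fun l : Fin (q i) => l.val < r))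
        (t := Finset.range r) (fun l => l.val) (by intro l hl; simpa using hl)
        (fun _ _ _ _ h => Fin.ext h)
      simpa using this
    exact_mod_cast this.trans (Nat.le_succ r)
  rw [Finset.sum_const, nsmul_eq_mul] at key
  have k2 : ((Finset.univ.filter (fun l : Fin (q i) => l.val < r)).card : ℝ) *
      (v / (4 * (r + 1))) ≤ v / 4 := by
    calc _ ≤ ((r : ℝ) + 1) * (v / (4 * (r + 1))) := by gcongr
      _ = _ := by field_simp
  rw [div_le_iff₀ (by positivity)]
  nlinarith

end SpikeLimit
end Limit

/-! ### Asymptotic orthogonality of the ridged vector and the signal. -/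

section Limit

variable {ι : Type*} {L : Filter ι} {q : ι → ℕ}
  {F H : Type*} [NormedAddCommGroup F] [InnerProductSpace ℝ F] [FiniteDimensional ℝ F]
  [NormedAddCommGroup H] [InnerProductSpace ℝ H] [FiniteDimensional ℝ H]

theorem card_filter_val_lt_le (q r : ℕ) :
    (Finset.univ.filter (fun l : Fin q => l.val < r)).card ≤ r := by
  have := Finset.card_le_card_of_injOn (s := Finset.univ.filter (fun l : Fin q => l.val < r))
    (t := Finset.range r) (fun l => l.val) (by intro l hl; simpa using hl)
    (fun _ _ _ _ h => Fin.ext h)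
  simpa using this

namespace SpikeLimit

variable {Y : ∀ i, F →L[ℝ] Vec (q i)} {Q : ∀ i, H →L[ℝ] Vec (q i)}
  {d : ∀ i, Vec (q i)} {W : F →L[ℝ] H} {C : F →L[ℝ] F} {η : H} {t κ : ℝ}
  {lam : ∀ i, Fin (q i) → ℝ} {b : ∀ i, OrthonormalBasis (Fin (q i)) ℝ (Vec (q i))}
  {α : ι → ℝ}

/-- The distance of the mean difference to the span of the data is bounded from below. -/
theorem le_norm_sub_sq (h : SpikeLimit L Y Q d W C η t κ) :
    ∀ᶠ i in L, ∀ a, C a = a → κ / 2 ≤ ‖d i - Y i a‖ ^ 2 := by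
  have ht := h.t_pos
  have hκ := h.κ_pos
  -- For `C a = a`, `‖d - Y a‖²` is close to `‖η - W a‖² + κ + t ‖a‖²`. The errors linear and
  -- quadratic in `‖a‖` are absorbed by `t ‖a‖²` and `κ`, the linear one through `2‖a‖ ≤ 1 + ‖a‖²`.
  set ε := min (κ / 4) (t / 2) with hε
  have hε0 : 0 < ε := by positivity
  have hε1 : ε ≤ κ / 4 := min_le_left _ _
  have hε2 : ε ≤ t / 2 := min_le_right _ _
  have h1 := (tendsto_iff_norm_sub_tendsto_zero.1 h.d_gram).eventually_lt_const (half_pos hε0)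
  have h2 := h.d_norm.eventually_const_lt
    (show ‖η‖ ^ 2 + κ - ε < ‖η‖ ^ 2 + κ by linarith)
  filter_upwards [h.gram_sub_le (half_pos hε0), h1, h2] with i hi h1i h2i a ha
  have e1 := (abs_le.1 (hi a)).1
  rw [ha] at e1
  have e2 : inner ℝ (d i) (Y i a) ≤ inner ℝ η (W a) + ε / 2 * ‖a‖ := by
    have : inner ℝ (d i) (Y i a) - inner ℝ η (W a) = inner ℝ ((Y i)‡ (d i) - W‡ η) a := by
      rw [inner_sub_left, ContinuousLinearMap.adjoint_inner_left,
        ContinuousLinearMap.adjoint_inner_left]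
    have h3 : inner ℝ ((Y i)‡ (d i) - W‡ η) a ≤ ε / 2 * ‖a‖ :=
      (real_inner_le_norm _ _).trans (by gcongr)
    linarith
  have e3 : 0 ≤ ‖η‖ ^ 2 - 2 * inner ℝ η (W a) + ‖W a‖ ^ 2 := by
    rw [← norm_sub_sq_real]; positivity
  rw [norm_sub_sq_real]
  nlinarith [sq_nonneg (‖a‖ - 1)]

theorem eventually_ne_zero (h : SpikeLimit L Y Q d W C η t κ)
    (hb : ∀ᶠ i in L, IsEigenbasis (Y i) (lam i) (b i)) :
    ∀ᶠ i in L, ∀ l : Fin (q i), l < Module.finrank ℝ C.toLinearMap.range → lam i l ≠ 0 := by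
  have ht := h.t_pos
  obtain ⟨c, hc, htop⟩ := h.exists_add_le_eigenvalue hb
  filter_upwards [htop, h.eigenvalue_sub_le hb (half_pos ht)] with i htopi hmid l hl
  by_cases c1 : l.val < Module.finrank ℝ H
  · have := htopi l c1
    linarith
  · have := (abs_le.1 (hmid l (not_lt.1 c1) hl)).1
    intro h0
    linarith

/-- The trailing component of `d` is `d - Y a` with `a = ∑ (⟨b_l,d⟩ / λ_l) Y‡ b_l` over `l < r`: the
nonzero eigenvalues allow each such `b_l` to be written as an image under `Y`. The distance bound
therefore applies. -/
theorem half_le_norm_tail_sq (h : SpikeLimit L Y Q d W C η t κ)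
    (hb : ∀ᶠ i in L, IsEigenbasis (Y i) (lam i) (b i)) :
    ∀ᶠ i in L, κ / 2 ≤ ‖∑ l ∈ Finset.univ.filter
      (fun l : Fin (q i) => Module.finrank ℝ C.toLinearMap.range ≤ l.val),
        inner ℝ (b i l) (d i) • b i l‖ ^ 2 := by
  set r := Module.finrank ℝ C.toLinearMap.range with hr
  filter_upwards [h.le_norm_sub_sq, hb, h.eventually_ne_zero hb] with i hi hbi hpos
  let a : F := ∑ l ∈ Finset.univ.filter (fun l : Fin (q i) => l.val < r),
    (inner ℝ (b i l) (d i) / lam i l) • (Y i)‡ (b i l)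
  have ha : C a = a := by
    simp only [a, map_sum, map_smul, h.C_Y_adj]
  have hY : d i - Y i a = ∑ l ∈ Finset.univ.filter
      (fun l : Fin (q i) => r ≤ l.val), inner ℝ (b i l) (d i) • b i l := by
    have h1 : Y i a = ∑ l ∈ Finset.univ.filter (fun l : Fin (q i) => l.val < r),
        inner ℝ (b i l) (d i) • b i l := by
      simp only [a, map_sum, map_smul, hbi.eigen]
      refine Finset.sum_congr rfl fun l hl => ?_
      rw [smul_smul, div_mul_cancel₀ _ (hpos l (by simpa using hl))]
    rw [h1, sub_eq_iff_eq_add]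
    nth_rw 1 [← (b i).sum_repr' (d i)]
    rw [← Finset.sum_filter_add_sum_filter_not Finset.univ (fun l : Fin (q i) => r ≤ l.val)]
    simp only [not_le]
  rw [← hY]
  exact hi a ha

/-- The ridged vector is asymptotically orthogonal to the signal space if `α → -t`. -/
theorem tendsto_inner_scaledRidge (h : SpikeLimit L Y Q d W C η t κ)
    (hb : ∀ᶠ i in L, IsEigenbasis (Y i) (lam i) (b i)) (hα : Tendsto α L (𝓝 (-t))) (x : H) :
    Tendsto (fun i => inner ℝ (scaledRidge (Module.finrank ℝ H)
      (Module.finrank ℝ C.toLinearMap.range) (α i) (lam i) (b i) (d i)) (Q i x)) L (𝓝 0) := by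
  obtain ⟨y, rfl⟩ := h.surjective_W_comp_adjoint x
  set m := Module.finrank ℝ H with hm
  set r := Module.finrank ℝ C.toLinearMap.range with hr
  have hmr : m ≤ r := h.finrank_le
  set e : ∀ i, Vec (q i) := fun i =>
    Y i ((Y i)‡ (Y i (W‡ y)) + α i • W‡ y - (Y i)‡ (Q i (W (W‡ y)))) with he
  have he0 : Tendsto (fun i => ‖e i‖) L (𝓝 0) := h.tendsto_resolvent_error hα y
  obtain ⟨c, hc, htop⟩ := h.exists_add_le_eigenvalue hb
  obtain ⟨D, hD, hdD⟩ := h.d_bdd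
  -- The cancellation behind the theorem: `⟨η, W W‡ y⟩ = ⟨W‡ η, W‡ y⟩`, so `⟨d,u⟩` and `⟨d,z⟩` have
  -- the same limit.
  have hdiff : Tendsto (fun i => inner ℝ (d i) (Q i (W (W‡ y))) - inner ℝ (d i) (Y i (W‡ y))) L
      (𝓝 0) := by
    have h1 : Tendsto (fun i => inner ℝ ((Q i)‡ (d i)) (W (W‡ y)) -
        inner ℝ ((Y i)‡ (d i)) (W‡ y)) L (𝓝 (inner ℝ η (W (W‡ y)) - inner ℝ (W‡ η) (W‡ y))) :=
      (h.d_cross.inner tendsto_const_nhds).sub (h.d_gram.inner tendsto_const_nhds)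
    simp only [ContinuousLinearMap.adjoint_inner_left, sub_self] at h1
    exact h1
  rw [Metric.tendsto_nhds]
  intro ε hε
  -- At most `r` coordinates have an error, each at most `D * 2δ`; this choice keeps their sum below
  -- `ε / 4`.
  have hδ : 0 < ε / (8 * (r + 1) * D) := by positivity
  have hδ2 : 0 < c / 2 * (ε / (8 * (r + 1) * D)) := by positivity
  have hαc : ∀ᶠ i in L, -t - c / 2 < α i := hα.eventually_const_lt (by linarith)
  filter_upwards [h.abs_inner_basis_le hb (W (W‡ y)) hδ, h.abs_inner_basis_apply_le hb y hδ,
    hb, htop, hdD, hαc, he0.eventually_lt_const hδ2, Metric.tendsto_nhds.1 hdiff (ε / 4)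
      (by positivity)] with i hQ hYy hbi htopi hDi hαi hei hdi
  rw [Real.dist_eq, sub_zero] at hdi ⊢
  set δ := ε / (8 * (r + 1) * D) with hδdef
  set u := Q i (W (W‡ y))
  set z := Y i (W‡ y)
  set β : Fin (q i) → ℝ := fun l => inner ℝ (b i l) (d i)
  have hβ : ∀ l, |β l| ≤ D := fun l => ((b i).abs_inner_le_norm l _).trans hDi
  -- the error made in each coordinate
  set g : Fin (q i) → ℝ := fun l =>
    if l.val < m then β l * (inner ℝ (b i l) (e i) / (lam i l + α i))
    else if l.val < r then β l * (inner ℝ (b i l) z - inner ℝ (b i l) u) else 0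
  have hg : ∀ l, |g l| ≤ if l.val < r then D * (2 * δ) else 0 := by
    intro l
    by_cases c1 : l.val < m
    · have c2 : l.val < r := by omega
      simp only [g, c1, c2, if_true]
      rw [abs_mul, abs_div]
      have h1 := htopi l c1
      have h2 : c / 2 ≤ |lam i l + α i| := by
        rw [abs_of_nonneg] <;> linarith
      have h3 := ((b i).abs_inner_le_norm l (e i)).trans hei.le
      have h4 : |inner ℝ (b i l) (e i)| / |lam i l + α i| ≤ 2 * δ := by
        rw [div_le_iff₀ (by linarith)]
        calc _ ≤ c / 2 * δ := h3
          _ ≤ |lam i l + α i| * (2 * δ) := by gcongr; linarith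
          _ = _ := by ring
      exact mul_le_mul (hβ l) h4 (by positivity) hD.le
    · by_cases c2 : l.val < r
      · simp only [g, c1, c2, if_true, if_false]
        rw [abs_mul]
        have h1 := hQ l (not_lt.1 c1) c2
        have h2 := hYy l (not_lt.1 c1) c2
        have h3 : |inner ℝ (b i l) z - inner ℝ (b i l) u| ≤ 2 * δ := by
          rw [abs_le] at *
          constructor <;> linarith
        exact mul_le_mul (hβ l) h3 (by positivity) hD.le
      · simp [g, c1, c2]
  -- Coordinatewise, the ridged vector acts on `u` as `d` acts on `u - z`, up to `g`. For leading
  -- indices this is the resolvent relation divided by `λ + α`; middle coordinates go entirely into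
  -- `g`; for trailing ones `⟨b,z⟩ = 0` and the relation is exact.
  have hcoord : ∀ l, inner ℝ (scaledRidge m r (α i) (lam i) (b i) (d i)) (b i l) *
      inner ℝ (b i l) u = inner ℝ (d i) (b i l) * inner ℝ (b i l) u -
        inner ℝ (d i) (b i l) * inner ℝ (b i l) z + g l := by
    intro l
    rw [real_inner_comm, scaledRidge, inner_add_right, inner_sum_filter_smul,
      inner_sum_filter_smul, real_inner_comm (b i l) (d i)]
    change (_ + if _ then β l else 0) * _ = β l * _ - β l * _ + _
    by_cases c1 : l.val < m
    · have c2 : ¬ r ≤ l.val := by omega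
      simp only [g, c1, c2, if_true, if_false]
      have h1 := htopi l c1
      have h2 : lam i l + α i ≠ 0 := by
        have : 0 < lam i l + α i := by linarith
        exact this.ne'
      have h3 : inner ℝ (b i l) (e i) = (lam i l + α i) * inner ℝ (b i l) z -
          lam i l * inner ℝ (b i l) u := by
        simp only [he, map_sub, map_add, map_smul, inner_sub_right, inner_add_right,
          hbi.inner_apply, inner_smul_right]
        ring
      rw [h3]
      change (α i / (lam i l + α i) * β l + 0) * _ = _
      field_simp
      ring
    · by_cases c2 : l.val < r
      · have c3 : ¬ r ≤ l.val := by omega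
        simp only [g, c1, c2, c3, if_true, if_false]
        ring
      · have c3 : r ≤ l.val := by omega
        have h4 : inner ℝ (b i l) z = 0 := h.inner_basis_eq_zero hbi l c3 _
        simp only [g, c1, c2, c3, if_true, if_false, h4]
        ring
  rw [← (b i).sum_inner_mul_inner, Finset.sum_congr rfl fun l _ => hcoord l,
    Finset.sum_add_distrib, Finset.sum_sub_distrib, (b i).sum_inner_mul_inner,
    (b i).sum_inner_mul_inner]
  have hsum : |∑ l, g l| ≤ ε / 4 := by
    calc |∑ l, g l| ≤ ∑ l, |g l| := Finset.abs_sum_le_sum_abs _ _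
      _ ≤ ∑ l : Fin (q i), if l.val < r then D * (2 * δ) else 0 :=
        Finset.sum_le_sum fun l _ => hg l
      _ = (Finset.univ.filter (fun l : Fin (q i) => l.val < r)).card * (D * (2 * δ)) := by
        rw [← Finset.sum_filter, Finset.sum_const, nsmul_eq_mul]
      _ ≤ (r + 1) * (D * (2 * δ)) := by
        gcongr
        have := card_filter_val_lt_le (q i) r
        exact_mod_cast this.trans (Nat.le_succ r)
      _ = ε / 4 := by rw [hδdef]; field_simp; norm_num
  have := abs_add_le (inner ℝ (d i) u - inner ℝ (d i) z) (∑ l, g l)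
  linarith

theorem eventually_add_ne_zero (h : SpikeLimit L Y Q d W C η t κ)
    (hb : ∀ᶠ i in L, IsEigenbasis (Y i) (lam i) (b i)) (hα : Tendsto α L (𝓝 (-t))) :
    ∀ᶠ i in L, ∀ l : Fin (q i), l < Module.finrank ℝ H → lam i l + α i ≠ 0 := by
  obtain ⟨c, hc, htop⟩ := h.exists_add_le_eigenvalue hb
  filter_upwards [htop, hα.eventually_const_lt (show -t - c < -t by linarith)] with i hi hαi l hl
  have := hi l hl
  have : 0 < lam i l + α i := by linarith
  exact this.ne'

/-- If `S` contains the leading eigenvectors and the ridged vector, then the ridged vector and the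
projection of a signal vector onto `S` are asymptotically orthogonal, and do not vanish. -/
theorem tendsto_angle (h : SpikeLimit L Y Q d W C η t κ)
    (hb : ∀ᶠ i in L, IsEigenbasis (Y i) (lam i) (b i)) (hα : Tendsto α L (𝓝 (-t)))
    (S : ∀ i, Submodule ℝ (Vec (q i)))
    (hS : ∀ᶠ i in L, ∀ l : Fin (q i), l < Module.finrank ℝ H → b i l ∈ S i)
    (hS' : ∀ᶠ i in L, scaledRidge (Module.finrank ℝ H)
      (Module.finrank ℝ C.toLinearMap.range) (α i) (lam i) (b i) (d i) ∈ S i)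
    {x : H} (hx : x ≠ 0) :
    Tendsto (fun i => InnerProductGeometry.angle (scaledRidge (Module.finrank ℝ H)
      (Module.finrank ℝ C.toLinearMap.range) (α i) (lam i) (b i) (d i))
        ((S i).starProjection (Q i x))) L (𝓝 (Real.pi / 2)) ∧
    (∀ᶠ i in L, scaledRidge (Module.finrank ℝ H)
      (Module.finrank ℝ C.toLinearMap.range) (α i) (lam i) (b i) (d i) ≠ 0) ∧
    ∀ᶠ i in L, (S i).starProjection (Q i x) ≠ 0 := by
  obtain ⟨c, hc, hproj⟩ := h.exists_le_sum_sq_inner hb hx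
  have hκ := h.κ_pos
  set v : ∀ i, Vec (q i) := fun i => scaledRidge (Module.finrank ℝ H)
      (Module.finrank ℝ C.toLinearMap.range) (α i) (lam i) (b i) (d i) with hv
  have hv1 : ∀ᶠ i in L, √(κ / 2) ≤ ‖v i‖ := by
    filter_upwards [h.half_le_norm_tail_sq hb] with i hi
    rw [Real.sqrt_le_left (norm_nonneg _)]
    exact hi.trans (norm_tail_le_norm_scaledRidge h.finrank_le _ _ _ _)
  -- The projection keeps the leading coordinates, because the leading eigenvectors belong to `S`.
  have hp1 : ∀ᶠ i in L, √c ≤ ‖(S i).starProjection (Q i x)‖ := by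
    filter_upwards [hproj, hS] with i hi hSi
    rw [Real.sqrt_le_left (norm_nonneg _)]
    refine hi.trans ?_
    rw [← sum_sq_inner (b i)]
    refine (Finset.sum_le_sum fun l hl => ?_).trans
      (Finset.sum_le_univ_sum_of_nonneg fun l => sq_nonneg _)
    have hl' : b i l ∈ S i := hSi l (by simpa using hl)
    rw [← Submodule.inner_starProjection_left_eq_right,
      Submodule.starProjection_eq_self_iff.2 hl']
  have hinner : ∀ᶠ i in L, inner ℝ (v i) ((S i).starProjection (Q i x)) =
      inner ℝ (v i) (Q i x) := by
    filter_upwards [hS'] with i hi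
    rw [← Submodule.inner_starProjection_left_eq_right, Submodule.starProjection_eq_self_iff.2 hi]
  have hs1 : 0 < √(κ / 2) := Real.sqrt_pos.2 (by positivity)
  have hs2 : 0 < √c := Real.sqrt_pos.2 hc
  refine ⟨?_, ?_, ?_⟩
  · have h0 : Tendsto (fun i => inner ℝ (v i) ((S i).starProjection (Q i x)) /
        (‖v i‖ * ‖(S i).starProjection (Q i x)‖)) L (𝓝 0) := by
      have h1 := (h.tendsto_inner_scaledRidge hb hα x).abs.div_const (√(κ / 2) * √c)
      rw [abs_zero, zero_div] at h1
      rw [tendsto_zero_iff_abs_tendsto_zero]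
      refine squeeze_zero' (Eventually.of_forall fun i => abs_nonneg _) ?_ h1
      filter_upwards [hv1, hp1, hinner] with i h1 h2 h3
      simp only [Function.comp]
      rw [h3, abs_div, abs_of_nonneg (a := ‖v i‖ * _) (by positivity)]
      gcongr
    have h2 := (Real.continuous_arccos.tendsto 0).comp h0
    rw [Real.arccos_zero] at h2
    exact h2
  · filter_upwards [hv1] with i hi h0
    change v i = 0 at h0
    rw [h0, norm_zero] at hi
    linarith
  · filter_upwards [hp1] with i hi h0
    rw [h0, norm_zero] at hi
    linarith

end SpikeLimit
end Limit

/-! ### Linear maps given by coefficient vectors, and entrywise convergence. -/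

theorem tendsto_congr_limit {ι X : Type*} [TopologicalSpace X] {L : Filter ι} {f : ι → X}
    {a b : X} (h : Tendsto f L (𝓝 a)) (hab : a = b) : Tendsto f L (𝓝 b) := hab ▸ h

theorem tendsto_clm_apply {ι E G : Type*} [NormedAddCommGroup E] [NormedSpace ℝ E]
    [NormedAddCommGroup G] [NormedSpace ℝ G] {L : Filter ι} {T : ι → E →L[ℝ] G} {T' : E →L[ℝ] G}
    (h : Tendsto T L (𝓝 T')) (a : E) : Tendsto (fun i => T i a) L (𝓝 (T' a)) :=
  ((ContinuousLinearMap.apply ℝ G a).continuous.tendsto T').comp h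

theorem inner_single_one {S : Type*} [Fintype S] [DecidableEq S] (s : S)
    (a : EuclideanSpace ℝ S) : inner ℝ (EuclideanSpace.single s (1 : ℝ)) a = a s := by
  rw [EuclideanSpace.inner_single_left]
  simp

theorem tendsto_euclidean {S ι : Type*} {L : Filter ι} {f : ι → EuclideanSpace ℝ S}
    {a : EuclideanSpace ℝ S} (h : ∀ s, Tendsto (fun i => f i s) L (𝓝 (a s))) :
    Tendsto f L (𝓝 a) := by
  have h1 : Tendsto (fun i => (f i).ofLp) L (𝓝 a.ofLp) := tendsto_pi_nhds.2 h
  exact ((PiLp.continuous_toLp 2 _).tendsto _).comp h1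

section Combination

variable {S : Type*} [Fintype S] [DecidableEq S] {E : Type*} [NormedAddCommGroup E]
  [InnerProductSpace ℝ E]

/-- The linear map sending coefficients `a` to `∑ s, a s • v s`. -/
def combination (v : S → E) : EuclideanSpace ℝ S →L[ℝ] E :=
  ∑ s, (innerSL ℝ (EuclideanSpace.single s (1 : ℝ))).smulRight (v s)

theorem combination_apply (v : S → E) (a : EuclideanSpace ℝ S) :
    combination v a = ∑ s, a s • v s := by
  simp [combination, inner_single_one]

@[simp]
theorem combination_single (v : S → E) (s : S) :
    combination v (EuclideanSpace.single s 1) = v s := by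
  rw [combination_apply, Finset.sum_eq_single s] <;> simp +contextual

theorem adjoint_combination_apply [CompleteSpace E] (v : S → E) (x : E) (s : S) :
    (combination v)‡ x s = inner ℝ (v s) x := by
  have : inner ℝ (EuclideanSpace.single s (1 : ℝ)) ((combination v)‡ x) = inner ℝ (v s) x := by
    rw [ContinuousLinearMap.adjoint_inner_right, combination_single]
  rwa [inner_single_one] at this

theorem eq_combination (T : EuclideanSpace ℝ S →L[ℝ] E) :
    T = combination fun s => T (EuclideanSpace.single s 1) := by
  refine ContinuousLinearMap.ext fun a => ?_
  rw [combination_apply]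
  have h : a = ∑ s, a s • EuclideanSpace.single s (1 : ℝ) := by
    ext t
    simp [Finset.sum_apply, Pi.single_apply]
  conv_lhs => rw [h]
  simp

/-- The domain is fixed and finite-dimensional, so norm convergence can be checked on unit vectors;
Gram limits may then be proved entry by entry. -/
theorem tendsto_of_forall_single {ι : Type*} {L : Filter ι}
    {T : ι → EuclideanSpace ℝ S →L[ℝ] E} {T' : EuclideanSpace ℝ S →L[ℝ] E}
    (h : ∀ s, Tendsto (fun i => T i (EuclideanSpace.single s 1)) L
      (𝓝 (T' (EuclideanSpace.single s 1)))) : Tendsto T L (𝓝 T') := by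
  rw [eq_combination T', funext fun i => eq_combination (T i)]
  refine tendsto_finsetSum _ fun s _ => ?_
  exact (((ContinuousLinearMap.smulRightL ℝ (EuclideanSpace ℝ S) E
    (innerSL ℝ (EuclideanSpace.single s (1 : ℝ)))).continuous).tendsto _).comp (h s)

end Combination

/-! ### Centering within the classes and the limit of the centered data. -/

section Centering

variable {n : Fin 2 → ℕ}

/-- The index set of the training sample. -/
abbrev SampleIdx (n : Fin 2 → ℕ) := (k : Fin 2) × Fin (n k)

/-- The coefficient vector indicating the observations of class `k`. -/
def classInd (n : Fin 2 → ℕ) (k : Fin 2) : EuclideanSpace ℝ (SampleIdx n) :=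
  WithLp.toLp 2 fun s => if s.1 = k then 1 else 0

@[simp]
theorem classInd_apply (k : Fin 2) (s : SampleIdx n) :
    classInd n k s = if s.1 = k then 1 else 0 := rfl

theorem inner_classInd (k : Fin 2) (a : EuclideanSpace ℝ (SampleIdx n)) :
    inner ℝ (classInd n k) a = ∑ j, a ⟨k, j⟩ := by
  rw [PiLp.inner_apply, Fintype.sum_sigma]
  simp only [classInd_apply, RCLike.inner_apply, conj_trivial, mul_ite, mul_one, mul_zero]
  rw [Finset.sum_eq_single k]
  · simp
  · intro k' _ hk'
    simp [hk']
  · simp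

theorem inner_classInd_classInd (k l : Fin 2) :
    inner ℝ (classInd n k) (classInd n l) = if k = l then (n k : ℝ) else 0 := by
  rw [inner_classInd]
  by_cases h : k = l <;> simp [h]

/-- The span of the class indicators. -/
def classSpace (n : Fin 2 → ℕ) : Submodule ℝ (EuclideanSpace ℝ (SampleIdx n)) :=
  Submodule.span ℝ (Set.range (classInd n))

theorem classInd_mem (k : Fin 2) : classInd n k ∈ classSpace n :=
  Submodule.subset_span ⟨k, rfl⟩

/-- Centering within the classes. -/
def centering (n : Fin 2 → ℕ) :
    EuclideanSpace ℝ (SampleIdx n) →L[ℝ] EuclideanSpace ℝ (SampleIdx n) :=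
  (classSpace n)ᗮ.starProjection

theorem adjoint_centering : (centering n)‡ = centering n :=
  (isSelfAdjoint_starProjection _).adjoint_eq

theorem centering_comp_centering : centering n ∘L centering n = centering n := by
  ext1 a
  exact Submodule.starProjection_eq_self_iff.2 (Submodule.starProjection_apply_mem _ _)

theorem centering_eq_zero_iff (a : EuclideanSpace ℝ (SampleIdx n)) :
    centering n a = 0 ↔ a ∈ classSpace n := by
  rw [centering, Submodule.starProjection_apply_eq_zero_iff, Submodule.orthogonal_orthogonal]

theorem linearIndependent_classInd (hn : ∀ k, 0 < n k) : LinearIndependent ℝ (classInd n) := by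
  refine linearIndependent_of_ne_zero_of_inner_eq_zero (𝕜 := ℝ) ?_ ?_
  · intro k h0
    have := inner_classInd_classInd (n := n) k k
    rw [h0, inner_zero_left, if_pos rfl] at this
    have h2 : (n k : ℝ) ≠ 0 := by exact_mod_cast (hn k).ne'
    exact h2 this.symm
  · intro k l hkl
    change inner ℝ (classInd n k) (classInd n l) = 0
    rw [inner_classInd_classInd, if_neg hkl]

/-- Centering loses one dimension per class. The resulting rank is also the zero-based index at
which the second sum of the ridged vector starts. -/
theorem finrank_range_centering (hn : ∀ k, 0 < n k) :
    Module.finrank ℝ (centering n).toLinearMap.range = n 0 + n 1 - 2 := by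
  have h1 : (centering n).toLinearMap.range = (classSpace n)ᗮ := Submodule.range_starProjection _
  rw [h1]
  have h2 := (classSpace n).finrank_add_finrank_orthogonal
  have h3 : Module.finrank ℝ (classSpace n) = 2 := by
    rw [classSpace, finrank_span_eq_card (linearIndependent_classInd hn)]
    simp
  rw [finrank_euclideanSpace, Fintype.card_sigma] at h2
  simp only [Fintype.card_fin, Fin.sum_univ_two] at h2
  omega

theorem centering_single (hn : ∀ k, 0 < n k) (s : SampleIdx n) :
    centering n (EuclideanSpace.single s 1) =
      EuclideanSpace.single s 1 - (n s.1 : ℝ)⁻¹ • classInd n s.1 := by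
  rw [centering, Submodule.starProjection_orthogonal']
  have : (classSpace n).starProjection (EuclideanSpace.single s 1) =
      (n s.1 : ℝ)⁻¹ • classInd n s.1 := by
    refine Submodule.eq_starProjection_of_mem_of_inner_eq_zero
      (Submodule.smul_mem _ _ (classInd_mem _)) ?_ 
    intro x hx
    refine Submodule.span_induction (p := fun v _ => inner ℝ (EuclideanSpace.single s (1 : ℝ) -
      (n s.1 : ℝ)⁻¹ • classInd n s.1) v = 0) ?_ ?_ ?_ ?_ hx
    · rintro _ ⟨k, rfl⟩
      have h2 : (n s.1 : ℝ) ≠ 0 := by exact_mod_cast (hn s.1).ne'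
      rw [inner_sub_left, real_inner_smul_left, inner_classInd_classInd, inner_single_one,
        classInd_apply, mul_ite, inv_mul_cancel₀ h2, mul_zero, sub_self]
    · simp
    · intro v w _ _ hv hw
      rw [inner_add_right, hv, hw, add_zero]
    · intro a v _ hv
      rw [real_inner_smul_right, hv, mul_zero]
  simp [this]

theorem combination_classInd {E : Type*} [NormedAddCommGroup E] [InnerProductSpace ℝ E]
    (v : SampleIdx n → E) (k : Fin 2) : combination v (classInd n k) = ∑ j, v ⟨k, j⟩ := by
  rw [combination_apply, Fintype.sum_sigma]
  rw [Finset.sum_eq_single k]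
  · simp
  · intro k' _ hk'
    simp [hk']
  · simp

/-- The coefficients of the difference of the class means. -/
def contrast (n : Fin 2 → ℕ) : EuclideanSpace ℝ (SampleIdx n) :=
  (n 0 : ℝ)⁻¹ • classInd n 0 - (n 1 : ℝ)⁻¹ • classInd n 1

/-- The reason the noise in the mean difference is asymptotically uncorrelated with the centered
data. -/
theorem centering_contrast : centering n (contrast n) = 0 :=
  (centering_eq_zero_iff _).2 (sub_mem (Submodule.smul_mem _ _ (classInd_mem _))
    (Submodule.smul_mem _ _ (classInd_mem _)))

theorem contrast_ne_zero (hn : ∀ k, 0 < n k) : contrast n ≠ 0 := by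
  intro h
  have := congrArg (fun a : EuclideanSpace ℝ (SampleIdx n) => a ⟨0, ⟨0, hn 0⟩⟩) h
  have h0 := hn 0
  simp [contrast] at this
  omega

theorem exists_coeff_of_mem_classSpace {a : EuclideanSpace ℝ (SampleIdx n)}
    (ha : a ∈ classSpace n) (k : Fin 2) (j j' : Fin (n k)) : a ⟨k, j⟩ = a ⟨k, j'⟩ := by
  refine Submodule.span_induction (p := fun v _ => v ⟨k, j⟩ = v ⟨k, j'⟩) ?_ ?_ ?_ ?_ ha
  · rintro _ ⟨l, rfl⟩
    simp
  · simp
  · intro v w _ _ hv hw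
    simp [hv, hw]
  · intro c v _ hv
    simp [hv]

set_option maxHeartbeats 1000000 in
/-- The scaled observations, centered at their class means, satisfy `SpikeLimit`. -/
theorem spikeLimit_of_tendsto {ι : Type*} {L : Filter ι} [L.NeBot] {q : ι → ℕ}
    {H : Type*} [NormedAddCommGroup H] [InnerProductSpace ℝ H] [FiniteDimensional ℝ H]
    (hn : ∀ k, 0 < n k)
    {y : ∀ i, SampleIdx n → Vec (q i)} {μ : ∀ i, Vec (q i)} {Q : ∀ i, H →L[ℝ] Vec (q i)}
    {w : SampleIdx n → H} {ν : H} {t D : ℝ} (ht : 0 < t)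
    (hQ : ∀ᶠ i in L, (Q i)‡ ∘L Q i = 1)
    (hy : ∀ s, Tendsto (fun i => (Q i)‡ (y i s)) L (𝓝 (w s)))
    (hyy : ∀ r s, Tendsto (fun i => inner ℝ (y i r) (y i s)) L
      (𝓝 (inner ℝ (w r) (w s) + if r = s then t else 0)))
    (hμ : Tendsto (fun i => (Q i)‡ (μ i)) L (𝓝 ν))
    (hyμ : ∀ s, Tendsto (fun i => inner ℝ (y i s) (μ i)) L (𝓝 (inner ℝ (w s) ν)))
    (hμμ : Tendsto (fun i => ‖μ i‖ ^ 2) L (𝓝 D))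
    (hw : ∀ x : H, (∀ k j j', inner ℝ (w ⟨k, j⟩) x = inner ℝ (w ⟨k, j'⟩) x) → x = 0) :
    ∃ κ : ℝ, SpikeLimit L (fun i => combination (y i) ∘L centering n) Q
      (fun i => combination (y i) (contrast n) + μ i) (combination w ∘L centering n)
      (centering n) (combination w (contrast n) + ν) t κ := by
  -- Bessel's inequality in the limit; it ensures that `κ` below is positive.
  have hD : ‖ν‖ ^ 2 ≤ D := by
    refine le_of_tendsto_of_tendsto (hμ.norm.pow 2) hμμ ?_
    filter_upwards [hQ] with i hi
    have h1 : ‖Q i ((Q i)‡ (μ i))‖ = ‖(Q i)‡ (μ i)‖ := by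
      have h2 : (Q i)‡ (Q i ((Q i)‡ (μ i))) = (Q i)‡ (μ i) :=
        congrArg (fun T : H →L[ℝ] H => T ((Q i)‡ (μ i))) hi
      rw [← sq_eq_sq₀ (norm_nonneg _) (norm_nonneg _), ← real_inner_self_eq_norm_sq,
        ← ContinuousLinearMap.adjoint_inner_left, h2, real_inner_self_eq_norm_sq]
    have h3 : ‖(Q i)‡ (μ i)‖ ^ 2 ≤ ‖(Q i)‡ (μ i)‖ * ‖μ i‖ := by
      calc _ = inner ℝ (Q i ((Q i)‡ (μ i))) (μ i) := by
            rw [← ContinuousLinearMap.adjoint_inner_right, real_inner_self_eq_norm_sq]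
        _ ≤ _ := by rw [← h1]; exact real_inner_le_norm _ _
    have h4 : ‖(Q i)‡ (μ i)‖ ≤ ‖μ i‖ := by
      by_contra! h5
      nlinarith [norm_nonneg (μ i), norm_nonneg ((Q i)‡ (μ i))]
    gcongr
  have hc : 0 < ‖contrast n‖ := norm_pos_iff.2 (contrast_ne_zero hn)
  have gram0 : Tendsto (fun i => (combination (y i))‡ ∘L combination (y i)) L
      (𝓝 ((combination w)‡ ∘L combination w + t • 1)) := by
    refine tendsto_of_forall_single fun s => tendsto_euclidean fun r => ?_
    have := hyy r s
    simp only [ContinuousLinearMap.comp_apply, combination_single, adjoint_combination_apply]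
    refine tendsto_congr_limit this ?_
    simp [adjoint_combination_apply]
  have cross0 : Tendsto (fun i => (Q i)‡ ∘L combination (y i)) L (𝓝 (combination w)) := by
    refine tendsto_of_forall_single fun s => ?_
    simpa using hy s
  have dgram0 : Tendsto (fun i => (combination (y i))‡ (μ i)) L (𝓝 ((combination w)‡ ν)) := by
    refine tendsto_euclidean fun s => ?_
    simpa only [adjoint_combination_apply] using hyμ s
  have gramc : Tendsto (fun i => (combination (y i))‡ (combination (y i) (contrast n))) L
      (𝓝 ((combination w)‡ (combination w (contrast n)) + t • contrast n)) :=
    tendsto_clm_apply gram0 (contrast n)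
  -- The part of `d` outside the signal space: the noise of the class means, plus the component of
  -- the true mean difference orthogonal to the signal.
  refine ⟨t * ‖contrast n‖ ^ 2 + (D - ‖ν‖ ^ 2), ?_⟩
  refine ⟨ht, by positivity, hQ, adjoint_centering, centering_comp_centering, ?_, ?_, ?_, ?_, ?_,
    ?_, ?_, ?_⟩
  · intro i
    rw [ContinuousLinearMap.comp_assoc, centering_comp_centering]
  · rw [ContinuousLinearMap.comp_assoc, centering_comp_centering]
  · rw [injective_iff_map_eq_zero]
    intro x hx
    rw [ContinuousLinearMap.adjoint_comp, adjoint_centering] at hx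
    -- A vector killed by `W‡` has inner products with the `w s` that are constant on each class,
    -- which is the hypothesis of `hw`.
    have hx' := (centering_eq_zero_iff _).1 hx
    refine hw x fun k j j' => ?_
    have := exists_coeff_of_mem_classSpace hx' k j j'
    rwa [← adjoint_combination_apply w x ⟨k, j⟩, ← adjoint_combination_apply w x ⟨k, j'⟩]
  · have h1 : Tendsto (fun i => centering n ∘L ((combination (y i))‡ ∘L combination (y i)) ∘L
        centering n) L
        (𝓝 (centering n ∘L ((combination w)‡ ∘L combination w + t • 1) ∘L centering n)) := by
      have h2 : Continuous fun T : EuclideanSpace ℝ (SampleIdx n) →L[ℝ]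
          EuclideanSpace ℝ (SampleIdx n) => centering n ∘L T ∘L centering n :=
        continuous_const.clm_comp (continuous_id.clm_comp continuous_const)
      exact (h2.tendsto _).comp gram0
    refine tendsto_congr_limit (h1.congr fun i => ?_) ?_
    · rw [ContinuousLinearMap.adjoint_comp, adjoint_centering]
      rfl
    · rw [ContinuousLinearMap.adjoint_comp, adjoint_centering]
      ext1 a
      have : centering n (centering n a) = centering n a :=
        congrArg (fun T : _ →L[ℝ] _ => T a) centering_comp_centering
      simp [this]
  · have h2 : Continuous fun T : EuclideanSpace ℝ (SampleIdx n) →L[ℝ] H => T ∘L centering n :=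
      continuous_id.clm_comp continuous_const
    exact (h2.tendsto _).comp cross0
  · have h1 := tendsto_clm_apply cross0 (contrast n)
    refine (h1.add hμ).congr fun i => ?_
    rw [map_add]
    rfl
  -- The uncentered limit contains the extra term `t • contrast n`, which centering removes.
  · have h1 := ((centering n).continuous.tendsto _).comp (gramc.add dgram0)
    refine tendsto_congr_limit (h1.congr fun i => ?_) ?_
    · rw [ContinuousLinearMap.adjoint_comp, adjoint_centering]
      simp
    · rw [ContinuousLinearMap.adjoint_comp, adjoint_centering]
      simp [centering_contrast]
  · have h1 : Tendsto (fun i => inner ℝ (contrast n)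
        ((combination (y i))‡ (combination (y i) (contrast n))) +
        2 * inner ℝ (contrast n) ((combination (y i))‡ (μ i)) + ‖μ i‖ ^ 2) L
        (𝓝 (inner ℝ (contrast n) ((combination w)‡ (combination w (contrast n)) +
          t • contrast n) + 2 * inner ℝ (contrast n) ((combination w)‡ ν) + D)) :=
      ((tendsto_const_nhds.inner gramc).add
        ((tendsto_const_nhds.inner dgram0).const_mul 2)).add hμμ
    refine tendsto_congr_limit (h1.congr fun i => ?_) ?_
    · rw [norm_add_sq_real, ContinuousLinearMap.adjoint_inner_right,
        ContinuousLinearMap.adjoint_inner_right, real_inner_self_eq_norm_sq]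
    · rw [inner_add_right, ContinuousLinearMap.adjoint_inner_right,
        ContinuousLinearMap.adjoint_inner_right, real_inner_self_eq_norm_sq,
        inner_smul_right, real_inner_self_eq_norm_sq, norm_add_sq_real]
      ring

end Centering

/-! ### Scatter matrices as operators, and the maximal data piling direction. -/

section Scatter

variable {n : Fin 2 → ℕ} {p : ℕ}

theorem dotProduct_ofLp (v w : Vec p) : v.ofLp ⬝ᵥ w.ofLp = inner ℝ v w := by
  rw [PiLp.inner_apply, dotProduct]
  simp [mul_comm]

theorem vecMulVec_mulVec_ofLp (v w : Vec p) :
    Matrix.vecMulVec v.ofLp v.ofLp *ᵥ w.ofLp = (inner ℝ v w • v).ofLp := by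
  rw [Matrix.vecMulVec_mulVec, dotProduct_ofLp]
  ext i
  simp [mul_comm]

theorem withinScatter_mulVec (x : (k : Fin 2) → Fin (n k) → Vec p) (v : Vec p) :
    withinScatter x *ᵥ v.ofLp =
      (∑ k, ∑ j, inner ℝ (x k j - classMean x k) v • (x k j - classMean x k)).ofLp := by
  simp only [withinScatter, Matrix.sum_mulVec, vecMulVec_mulVec_ofLp, WithLp.ofLp_sum]

theorem quadForm_eq_inner (A : Matrix (Fin p) (Fin p) ℝ) (v z : Vec p)
    (h : A *ᵥ v.ofLp = z.ofLp) : quadForm A v = inner ℝ v z := by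
  rw [quadForm, h, dotProduct_ofLp]

/-- With two classes both deviations from the total mean are multiples of the mean difference, so
the between-class scatter has rank at most one. -/
theorem quadForm_betweenScatter (hn : ∀ k, 0 < n k) (x : (k : Fin 2) → Fin (n k) → Vec p)
    (v : Vec p) : quadForm (betweenScatter x) v =
      ((n 0 : ℝ) * n 1 / (n 0 + n 1)) * inner ℝ v (sampleDiff x) ^ 2 := by
  have h0 : (0 : ℝ) < n 0 := by exact_mod_cast hn 0
  have h1 : (0 : ℝ) < n 1 := by exact_mod_cast hn 1
  have hs : ∀ k, ∑ j, x k j = (n k : ℝ) • classMean x k := by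
    intro k
    have hk : (n k : ℝ) ≠ 0 := by exact_mod_cast (hn k).ne'
    rw [classMean, smul_smul, mul_inv_cancel₀ hk, one_smul]
  have ht : totalMean x = ((n 0 : ℝ) + n 1)⁻¹ • ((n 0 : ℝ) • classMean x 0 +
      (n 1 : ℝ) • classMean x 1) := by
    rw [totalMean, Fin.sum_univ_two, hs, hs]
    push_cast
    rfl
  have key : ∀ k, quadForm ((n k : ℝ) • Matrix.vecMulVec (classMean x k - totalMean x).ofLp
      (classMean x k - totalMean x).ofLp) v =
      n k * inner ℝ v (classMean x k - totalMean x) ^ 2 := by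
    intro k
    rw [quadForm_eq_inner _ v ((n k : ℝ) • (inner ℝ (classMean x k - totalMean x) v •
      (classMean x k - totalMean x)))]
    · rw [inner_smul_right, inner_smul_right, real_inner_comm]
      ring
    · rw [Matrix.smul_mulVec, vecMulVec_mulVec_ofLp]
      rfl
  have hsum : quadForm (betweenScatter x) v =
      ∑ k, n k * inner ℝ v (classMean x k - totalMean x) ^ 2 := by
    rw [← Finset.sum_congr rfl fun k _ => key k]
    simp only [quadForm, betweenScatter, Matrix.sum_mulVec, dotProduct_sum]
  rw [hsum, Fin.sum_univ_two, ht, sampleDiff]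
  simp only [inner_sub_right, inner_smul_right, inner_add_right]
  field_simp
  ring

/-- The observations, centered at `mn` and scaled by `1 / √p`. -/
def scaledObs (x : (k : Fin 2) → Fin (n k) → Vec p) (mn : Fin 2 → Vec p) (s : SampleIdx n) :
    Vec p := (√(p : ℝ))⁻¹ • (x s.1 s.2 - mn s.1)

/-- The matrix of the observations centered at the class means and scaled by `1 / √p`. -/
def scaledData (x : (k : Fin 2) → Fin (n k) → Vec p) (mn : Fin 2 → Vec p) :
    EuclideanSpace ℝ (SampleIdx n) →L[ℝ] Vec p :=
  combination (scaledObs x mn) ∘L centering n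

theorem sum_scaledObs (hn : ∀ k, 0 < n k) (x : (k : Fin 2) → Fin (n k) → Vec p)
    (mn : Fin 2 → Vec p) (k : Fin 2) :
    (n k : ℝ)⁻¹ • ∑ j, scaledObs x mn ⟨k, j⟩ = (√(p : ℝ))⁻¹ • (classMean x k - mn k) := by
  have hk : (n k : ℝ) ≠ 0 := by exact_mod_cast (hn k).ne'
  simp only [scaledObs, ← Finset.smul_sum, Finset.sum_sub_distrib, Finset.sum_const,
    Finset.card_univ, Fintype.card_fin]
  rw [smul_comm, smul_sub, classMean, ← Nat.cast_smul_eq_nsmul ℝ, smul_smul (n k : ℝ)⁻¹,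
    inv_mul_cancel₀ hk, one_smul]

theorem scaledData_single (hn : ∀ k, 0 < n k) (x : (k : Fin 2) → Fin (n k) → Vec p)
    (mn : Fin 2 → Vec p) (s : SampleIdx n) : scaledData x mn (EuclideanSpace.single s 1) =
      (√(p : ℝ))⁻¹ • (x s.1 s.2 - classMean x s.1) := by
  rw [scaledData, ContinuousLinearMap.comp_apply, centering_single hn, map_sub, map_smul,
    combination_single, combination_classInd, sum_scaledObs hn, scaledObs, ← smul_sub]
  congr 1
  abel

theorem scaled_sampleDiff (hn : ∀ k, 0 < n k) (x : (k : Fin 2) → Fin (n k) → Vec p)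
    (mn : Fin 2 → Vec p) :
    combination (scaledObs x mn) (contrast n) + (√(p : ℝ))⁻¹ • (mn 0 - mn 1) =
      (√(p : ℝ))⁻¹ • sampleDiff x := by
  rw [contrast, map_sub, map_smul, map_smul, combination_classInd, combination_classInd,
    sum_scaledObs hn, sum_scaledObs hn, sampleDiff, ← smul_sub, ← smul_add]
  congr 1
  abel

/-- Links the abstract `Y` to the sample. The population means `mn` disappear because centering
removes any class-wise constant shift. -/
theorem scaledData_adjoint (hn : ∀ k, 0 < n k) (x : (k : Fin 2) → Fin (n k) → Vec p)
    (mn : Fin 2 → Vec p) (v : Vec p) :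
    (scaledData x mn ((scaledData x mn)‡ v)).ofLp = (p : ℝ)⁻¹ • (withinScatter x *ᵥ v.ofLp) := by
  rw [withinScatter_mulVec, eq_combination (scaledData x mn), combination_apply,
    Fintype.sum_sigma, ← WithLp.ofLp_smul]
  congr 1
  simp only [adjoint_combination_apply, scaledData_single hn, Finset.smul_sum, inner_smul_left,
    smul_smul]
  refine Finset.sum_congr rfl fun k _ => Finset.sum_congr rfl fun j _ => ?_
  congr 1
  have : (√(p : ℝ))⁻¹ * (√(p : ℝ))⁻¹ = (p : ℝ)⁻¹ := by
    rw [← mul_inv, Real.mul_self_sqrt (Nat.cast_nonneg _)]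
  simp only [conj_trivial]
  rw [← this]
  ring

theorem IsEigenDecomp.isEigenbasis (hn : ∀ k, 0 < n k) {x : (k : Fin 2) → Fin (n k) → Vec p}
    (mn : Fin 2 → Vec p) {lam : Fin p → ℝ} {U : OrthonormalBasis (Fin p) ℝ (Vec p)}
    (h : IsEigenDecomp (withinScatter x) lam U) :
    IsEigenbasis (scaledData x mn) (fun l => lam l / p) U where
  antitone := fun i j hij => by
    have := h.1 hij
    dsimp only
    gcongr
  eigen l := by
    have h1 := scaledData_adjoint hn x mn (U l)
    rw [h.2 l, smul_smul] at h1
    rw [← WithLp.toLp_ofLp 2 ((scaledData x mn) _), h1, div_eq_inv_mul]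
    rfl

/-- The weights are unchanged by scaling: `αp / (λ + αp) = α / (λ/p + α)`. -/
theorem ridgeVec_eq (hp : 0 < p) {m N : ℕ} (hN : 2 ≤ N) (α : ℝ) (lam : Fin p → ℝ)
    (U : OrthonormalBasis (Fin p) ℝ (Vec p)) (d : Vec p) :
    ridgeVec m N α lam U d =
      √(p : ℝ) • scaledRidge m (N - 2) α (fun l => lam l / p) U ((√(p : ℝ))⁻¹ • d) := by
  have hp' : (0 : ℝ) < p := by exact_mod_cast hp
  have hs : √(p : ℝ) ≠ 0 := (Real.sqrt_pos.2 hp').ne'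
  have e : ∀ l, √(p : ℝ) * inner ℝ (U l) ((√(p : ℝ))⁻¹ • d) = inner ℝ (U l) d := by
    intro l
    rw [inner_smul_right, ← mul_assoc, mul_inv_cancel₀ hs, one_mul]
  rw [ridgeVec, scaledRidge, smul_add, Finset.smul_sum, Finset.smul_sum]
  congr 1
  · refine Finset.sum_congr rfl fun l _ => ?_
    rw [smul_smul, mul_left_comm, e]
    congr 2
    rw [div_add' _ _ _ hp'.ne', div_div_eq_mul_div]
  · have : ∀ l : Fin p, N ≤ l.val + 2 ↔ N - 2 ≤ l.val := fun l => by omega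
    simp only [this]
    refine Finset.sum_congr rfl fun l _ => ?_
    rw [smul_smul, e]

theorem angle_ridgeDir (m N : ℕ) (α : ℝ) (lam : Fin p → ℝ)
    (U : OrthonormalBasis (Fin p) ℝ (Vec p)) (d z : Vec p) :
    InnerProductGeometry.angle (ridgeDir m N α lam U d) z =
      InnerProductGeometry.angle (ridgeVec m N α lam U d) z := by
  rw [ridgeDir]
  by_cases h : ridgeVec m N α lam U d = 0
  · simp [h]
  · rw [InnerProductGeometry.angle_smul_left_of_pos]
    exact inv_pos.2 (norm_pos_iff.2 h)

theorem IsEigenDecomp.quadForm_eq {A : Matrix (Fin p) (Fin p) ℝ} {lam : Fin p → ℝ}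
    {U : OrthonormalBasis (Fin p) ℝ (Vec p)} (h : IsEigenDecomp A lam U) (v : Vec p) :
    quadForm A v = ∑ l, lam l * inner ℝ (U l) v ^ 2 := by
  have h1 : A *ᵥ v.ofLp = (∑ l, inner ℝ (U l) v • lam l • U l).ofLp := by
    conv_lhs => rw [← U.sum_repr' v]
    rw [WithLp.ofLp_sum, WithLp.ofLp_sum, Matrix.mulVec_sum]
    refine Finset.sum_congr rfl fun l _ => ?_
    rw [WithLp.ofLp_smul, Matrix.mulVec_smul, h.2 l]
    rfl
  rw [quadForm_eq_inner A v _ h1, inner_sum]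
  refine Finset.sum_congr rfl fun l _ => ?_
  rw [inner_smul_right, inner_smul_right, real_inner_comm v]
  ring

/-- The component of the mean difference in the null space of the within-class scatter matrix is
a multiple of the maximal data piling direction. -/
theorem IsMDP.tail_mem_span (hn : ∀ k, 0 < n k) {x : (k : Fin 2) → Fin (n k) → Vec p}
    {w : Vec p} (hw : IsMDP x w) {lam : Fin p → ℝ} {U : OrthonormalBasis (Fin p) ℝ (Vec p)}
    (h : IsEigenDecomp (withinScatter x) lam U) {r : ℕ} (hnn : ∀ l, 0 ≤ lam l)
    (hpos : ∀ l : Fin p, l < r → lam l ≠ 0) (hzero : ∀ l : Fin p, r ≤ l → lam l = 0) :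
    ∑ l ∈ Finset.univ.filter (fun l : Fin p => r ≤ l.val), inner ℝ (U l) (sampleDiff x) • U l ∈
      Submodule.span ℝ {w} := by
  classical
  set d := sampleDiff x
  set z := ∑ l ∈ Finset.univ.filter (fun l : Fin p => r ≤ l.val), inner ℝ (U l) d • U l with hz
  by_cases hz0 : z = 0
  · rw [hz0]; exact Submodule.zero_mem _
  have hzn : 0 < ‖z‖ := norm_pos_iff.2 hz0
  have hzl : ∀ l, inner ℝ (U l) z = if r ≤ l.val then inner ℝ (U l) d else 0 := fun l =>
    inner_sum_filter_smul U _ _ l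
  -- A vanishing sum of nonnegative terms `λ_l ⟨U_l, w⟩²` forces orthogonality wherever `λ_l ≠ 0`.
  have hwl : ∀ l : Fin p, l.val < r → inner ℝ (U l) w = 0 := by
    intro l hl
    have h1 := hw.1.2
    rw [h.quadForm_eq, Finset.sum_eq_zero_iff_of_nonneg
      fun l _ => mul_nonneg (hnn l) (sq_nonneg _)] at h1
    simpa [hpos l hl] using h1 l (Finset.mem_univ _)
  have hwd : inner ℝ w d = inner ℝ w z := by
    rw [← U.sum_inner_mul_inner, ← U.sum_inner_mul_inner]
    refine Finset.sum_congr rfl fun l _ => ?_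
    rw [hzl]
    by_cases hl : r ≤ l.val
    · rw [if_pos hl]
    · rw [real_inner_comm, hwl l (not_le.1 hl), zero_mul, zero_mul]
  have hzd : inner ℝ z d = ‖z‖ ^ 2 := by
    rw [← real_inner_self_eq_norm_sq, ← U.sum_inner_mul_inner, ← U.sum_inner_mul_inner]
    refine Finset.sum_congr rfl fun l _ => ?_
    rw [real_inner_comm, hzl]
    by_cases hl : r ≤ l.val
    · rw [if_pos hl]
    · rw [if_neg hl, zero_mul, zero_mul]
  -- Normalized `z` is itself admissible, so maximality yields `‖z‖² ≤ ⟨w,z⟩²` with `‖w‖ = 1`. This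
  -- is equality in Cauchy–Schwarz, hence `z = ⟨w,z⟩ w`.
  have hmax := hw.2 (‖z‖⁻¹ • z) (by
    rw [norm_smul, norm_inv, norm_norm, inv_mul_cancel₀ hzn.ne']) (by
    rw [h.quadForm_eq]
    refine Finset.sum_eq_zero fun l _ => ?_
    rw [inner_smul_right, hzl]
    by_cases hl : r ≤ l.val
    · rw [hzero l hl, zero_mul]
    · rw [if_neg hl]; ring)
  rw [quadForm_betweenScatter hn, quadForm_betweenScatter hn, hwd, real_inner_smul_left, hzd] at hmax
  have h0 : (0 : ℝ) < n 0 := by exact_mod_cast hn 0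
  have h1 : (0 : ℝ) < n 1 := by exact_mod_cast hn 1
  have hmax' := le_of_mul_le_mul_left hmax (by positivity)
  have e1 : ‖z‖⁻¹ * ‖z‖ ^ 2 = ‖z‖ := by field_simp
  rw [e1] at hmax'
  have e2 : ‖z - inner ℝ w z • w‖ ^ 2 ≤ 0 := by
    rw [norm_sub_sq_real, norm_smul, hw.1.1, inner_smul_right, mul_one, real_inner_comm w z,
      Real.norm_eq_abs, sq_abs]
    nlinarith
  have e3 : z - inner ℝ w z • w = 0 := by
    have : ‖z - inner ℝ w z • w‖ ^ 2 = 0 := le_antisymm e2 (sq_nonneg _)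
    simpa using this
  rw [sub_eq_zero.1 e3]
  exact Submodule.smul_mem _ _ (Submodule.mem_span_singleton_self w)

end Scatter

/-! ### The common basis and the splitting of observations into spike and noise parts. -/

section Frame

variable {m p : ℕ} {u : Fin m → Vec p}

theorem adjoint_comp_combination (hu : Orthonormal ℝ u) :
    (combination u)‡ ∘L combination u = 1 := by
  refine ContinuousLinearMap.ext fun a => ?_
  ext s
  rw [ContinuousLinearMap.comp_apply, adjoint_combination_apply, combination_apply,
    hu.inner_right_fintype]
  rfl

theorem combination_adjoint_of_mem_span (hu : Orthonormal ℝ u) {v : Vec p}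
    (hv : v ∈ Submodule.span ℝ (Set.range u)) : combination u ((combination u)‡ v) = v := by
  refine Submodule.span_induction
    (p := fun v _ => combination u ((combination u)‡ v) = v) ?_ ?_ ?_ ?_ hv
  · rintro _ ⟨a, rfl⟩
    have h1 : (combination u)‡ (combination u (EuclideanSpace.single a 1)) =
        EuclideanSpace.single a 1 :=
      congrArg (fun T : _ →L[ℝ] _ => T (EuclideanSpace.single a (1 : ℝ)))
        (adjoint_comp_combination hu)
    rw [combination_single] at h1
    rw [h1, combination_single]
  · simp
  · intro v w _ _ hv hw
    rw [map_add, map_add, hv, hw]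
  · intro c v _ hv
    rw [map_smul, map_smul, hv]

end Frame

namespace Population

/-- The part of a centered vector of class `k` in the span of the leading eigenvectors. -/
def spikePart (M : Population) (k : Fin 2) {p : ℕ} (v : Vec p) : Vec p :=
  ∑ l : Fin (M.numSpikes k), inner ℝ (M.eigvecAt k p l) v • M.eigvecAt k p l

/-- The part of a centered vector of class `k` orthogonal to the leading eigenvectors. -/
def noisePart (M : Population) (k : Fin 2) {p : ℕ} (v : Vec p) : Vec p := v - M.spikePart k v

theorem spikePart_mem (M : Population) (k : Fin 2) {p : ℕ} (v : Vec p) :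
    M.spikePart k v ∈ M.commonSpace p := by
  refine Submodule.sum_mem _ fun l _ => Submodule.smul_mem _ _ ?_
  have h : M.eigvecAt k p l ∈ M.leadingSpace k p := Submodule.subset_span ⟨l, rfl⟩
  fin_cases k
  · exact Submodule.mem_sup_left h
  · exact Submodule.mem_sup_right h

/-- The spike scores `ζ` of each class affinely span the space of the leading coordinates. -/
def GoodScores (M : Population) {n : Fin 2 → ℕ} (ζ : SampleIdx n → ℕ → ℝ) : Prop :=
  ∀ (k : Fin 2) (y : Fin (M.numSpikes k) → ℝ),
    (∀ j j', ∑ l, y l * ζ ⟨k, j⟩ l = ∑ l, y l * ζ ⟨k, j'⟩ l) → y = 0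

end Population

/-- Full row rank makes the transpose injective, by rank–nullity. -/
theorem eq_zero_of_rank_fromCols {m a b : ℕ} {A : Matrix (Fin m) (Fin a) ℝ}
    {B : Matrix (Fin m) (Fin b) ℝ} (h : (Matrix.fromCols A B).rank = m) {x : Fin m → ℝ}
    (hA : ∀ l, ∑ i, A i l * x i = 0) (hB : ∀ l, ∑ i, B i l * x i = 0) : x = 0 := by
  rw [← Matrix.rank_transpose] at h
  have h1 := (Matrix.fromCols A B)ᵀ.mulVecLin.finrank_range_add_finrank_ker
  rw [← Matrix.rank, h] at h1
  simp only [Module.finrank_fintype_fun_eq_card, Fintype.card_fin] at h1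
  have h2 : (Matrix.fromCols A B)ᵀ.mulVecLin.ker = ⊥ := by
    rw [← Submodule.finrank_eq_zero (R := ℝ)]
    omega
  rw [LinearMap.ker_eq_bot'] at h2
  refine h2 x ?_
  ext l
  cases l with
  | inl l => simpa [Matrix.vecMul, dotProduct, mul_comm] using hA l
  | inr l => simpa [Matrix.vecMul, dotProduct, mul_comm] using hB l

/-! ### The sample quantities along a filter: limits and the angle. -/

section Deterministic

variable {n : Fin 2 → ℕ} {ι : Type*} {L : Filter ι} {p : ι → ℕ}

theorem tendsto_sqrt_eigval (M : Population) (k : Fin 2) {l : ℕ} (hl : l < M.numSpikes k) :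
    Tendsto (fun p : ℕ => (√(p : ℝ))⁻¹ * √(M.eigval k p l)) atTop (𝓝 (√(M.spikeSq k l))) := by
  have h1 : Tendsto (fun p : ℕ => M.spikeSq k l + M.tailSq k l / p) atTop
      (𝓝 (M.spikeSq k l + 0)) :=
    tendsto_const_nhds.add (tendsto_const_div_atTop_nhds_zero_nat _)
  rw [add_zero] at h1
  refine ((Real.continuous_sqrt.tendsto _).comp h1).congr' ?_
  filter_upwards [eventually_gt_atTop 0] with p hp
  have hp' : (0 : ℝ) < p := by exact_mod_cast hp
  simp only [Function.comp, Population.eigval, if_pos hl]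
  rw [← Real.sqrt_inv, ← Real.sqrt_mul (by positivity)]
  congr 1
  field_simp

set_option maxHeartbeats 1000000 in
/-- The scaled training data satisfy `SpikeLimit` along a filter along which the spike scores
converge and the noise parts are asymptotically white and orthogonal to the signal. -/
theorem exists_spikeLimit [L.NeBot] (M : Population) (hn : ∀ k, 0 < n k) (hp : Tendsto p L atTop)
    (h₁ : M.MeanGrowth) (h₂ : M.Spiked)
    {m : ℕ} {u : (p : ℕ) → Fin m → Vec p} (h₅ : M.CommonBasis m u)
    {t : ℝ} (ht : 0 < t)
    {x : ∀ i, (k : Fin 2) → Fin (n k) → Vec (p i)}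
    {ζ : ι → SampleIdx n → ℕ → ℝ} {ζ₀ : SampleIdx n → ℕ → ℝ}
    (hζ : ∀ s l, Tendsto (fun i => ζ i s l) L (𝓝 (ζ₀ s l))) (hG : M.GoodScores ζ₀)
    (hscore : ∀ᶠ i in L, ∀ (s : SampleIdx n) (l : ℕ), l < M.numSpikes s.1 →
      inner ℝ (M.eigvecAt s.1 (p i) l) (x i s.1 s.2 - M.mean s.1 (p i)) =
        √(M.eigval s.1 (p i) l) * ζ i s l)
    (hE₁ : ∀ (s : SampleIdx n) a, Tendsto (fun i => (√(p i : ℝ))⁻¹ * inner ℝ (u (p i) a)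
      (M.noisePart s.1 (x i s.1 s.2 - M.mean s.1 (p i)))) L (𝓝 0))
    (hE₂ : ∀ r s : SampleIdx n, Tendsto (fun i => (p i : ℝ)⁻¹ * inner ℝ
      (M.noisePart r.1 (x i r.1 r.2 - M.mean r.1 (p i)))
      (M.noisePart s.1 (x i s.1 s.2 - M.mean s.1 (p i)))) L (𝓝 (if r = s then t else 0)))
    (hE₃ : ∀ s : SampleIdx n, Tendsto (fun i => (p i : ℝ)⁻¹ * inner ℝ
      (M.noisePart s.1 (x i s.1 s.2 - M.mean s.1 (p i))) (M.meanDiff (p i))) L (𝓝 0)) :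
    ∃ (W : EuclideanSpace ℝ (SampleIdx n) →L[ℝ] EuclideanSpace ℝ (Fin m))
      (η : EuclideanSpace ℝ (Fin m)) (κ : ℝ),
      SpikeLimit L (fun i => scaledData (x i) fun k => M.mean k (p i))
        (fun i => combination (u (p i)))
        (fun i => (√(p i : ℝ))⁻¹ • sampleDiff (x i)) W (centering n) η t κ := by
  obtain ⟨R, -, hR, hrank⟩ := h₅.coords
  obtain ⟨δ, -, hδ⟩ := h₁
  choose θ hθ using h₅.angles
  have hu := hp.eventually h₅.orthonormal
  have hspan := hp.eventually h₅.span_eq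
  set Q : ∀ i, EuclideanSpace ℝ (Fin m) →L[ℝ] Vec (p i) := fun i => combination (u (p i)) with hQdef
  have hQ : ∀ᶠ i in L, (Q i)‡ ∘L Q i = 1 := by
    filter_upwards [hu] with i hi using adjoint_comp_combination hi
  -- limits of the coordinates
  let col : (s : SampleIdx n) → Fin (M.numSpikes s.1) → EuclideanSpace ℝ (Fin m) := fun s l =>
    WithLp.toLp 2 fun a => R s.1 a l
  let w : SampleIdx n → EuclideanSpace ℝ (Fin m) := fun s =>
    ∑ l : Fin (M.numSpikes s.1), (√(M.spikeSq s.1 l) * ζ₀ s l) • col s l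
  let ν : EuclideanSpace ℝ (Fin m) := WithLp.toLp 2 fun a => Real.cos (θ a) * δ
  let y : ∀ i, SampleIdx n → Vec (p i) := fun i => scaledObs (x i) fun k => M.mean k (p i)
  let e : ∀ i, SampleIdx n → Vec (p i) := fun i s =>
    (√(p i : ℝ))⁻¹ • M.noisePart s.1 (x i s.1 s.2 - M.mean s.1 (p i))
  let g : ∀ i, SampleIdx n → Vec (p i) := fun i s =>
    (√(p i : ℝ))⁻¹ • M.spikePart s.1 (x i s.1 s.2 - M.mean s.1 (p i))
  let A : ∀ i, SampleIdx n → EuclideanSpace ℝ (Fin m) := fun i s => (Q i)‡ (g i s)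
  let μ : ∀ i, Vec (p i) := fun i => (√(p i : ℝ))⁻¹ • M.meanDiff (p i)
  have hsq : ∀ i, (√(p i : ℝ))⁻¹ * (√(p i : ℝ))⁻¹ = (p i : ℝ)⁻¹ := fun i => by
    rw [← mul_inv, Real.mul_self_sqrt (Nat.cast_nonneg _)]
  have hyge : ∀ i s, y i s = g i s + e i s := by
    intro i s
    simp only [y, g, e, scaledObs, Population.noisePart, ← smul_add]
    congr 1
    abel
  -- Spike parts lie in the common eigenspace, so inner products with them can be computed in the
  -- fixed space of coordinates.
  have hQA : ∀ᶠ i in L, ∀ s, Q i (A i s) = g i s := by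
    filter_upwards [hu, hspan] with i hi hsi s
    refine combination_adjoint_of_mem_span hi ?_
    rw [hsi]
    exact Submodule.smul_mem _ _ (M.spikePart_mem _ _)
  have hA : ∀ s, Tendsto (fun i => A i s) L (𝓝 (w s)) := by
    intro s
    have h1 : ∀ l : Fin (M.numSpikes s.1), Tendsto (fun i => (Q i)‡ (M.eigvecAt s.1 (p i) l)) L
        (𝓝 (col s l)) := by
      intro l
      refine tendsto_euclidean fun a => ?_
      simp only [Q, adjoint_combination_apply]
      exact (hR s.1 a l).comp hp
    have h2 : Tendsto (fun i => ∑ l : Fin (M.numSpikes s.1),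
        ((√(p i : ℝ))⁻¹ * √(M.eigval s.1 (p i) l) * ζ i s l) •
          (Q i)‡ (M.eigvecAt s.1 (p i) l)) L (𝓝 (w s)) :=
      tendsto_finsetSum _ fun l _ =>
        (((tendsto_sqrt_eigval M s.1 l.2).comp hp).mul (hζ s l)).smul (h1 l)
    refine h2.congr' ?_
    filter_upwards [hscore] with i hi
    simp only [A, g, Population.spikePart, map_smul, map_sum, Finset.smul_sum, smul_smul]
    refine Finset.sum_congr rfl fun l _ => ?_
    rw [hi s l l.2, mul_assoc]
  have he : ∀ s, Tendsto (fun i => (Q i)‡ (e i s)) L (𝓝 0) := by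
    intro s
    refine tendsto_euclidean fun a => ?_
    simp only [Q, adjoint_combination_apply, e, inner_smul_right]
    exact hE₁ s a
  have hee : ∀ r s, Tendsto (fun i => inner ℝ (e i r) (e i s)) L (𝓝 (if r = s then t else 0)) := by
    intro r s
    refine (hE₂ r s).congr fun i => ?_
    rw [real_inner_smul_left, real_inner_smul_right, ← mul_assoc, hsq]
  have hy : ∀ s, Tendsto (fun i => (Q i)‡ (y i s)) L (𝓝 (w s)) := by
    intro s
    have := (hA s).add (he s)
    rw [add_zero] at this
    refine this.congr fun i => ?_
    rw [hyge, map_add]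
  -- The mixed spike–noise terms equal inner products of `A` with `Q‡ e`, which tends to zero.
  have hyy : ∀ r s, Tendsto (fun i => inner ℝ (y i r) (y i s)) L
      (𝓝 (inner ℝ (w r) (w s) + if r = s then t else 0)) := by
    intro r s
    have h1 := (((hA r).inner (𝕜 := ℝ) (hA s)).add ((hA r).inner (𝕜 := ℝ) (he s))).add
      ((he r).inner (𝕜 := ℝ) (hA s)) |>.add (hee r s)
    rw [inner_zero_left, inner_zero_right, add_zero, add_zero] at h1
    refine h1.congr' ?_
    filter_upwards [hQA, hQ] with i hi hQi
    have h2 : ∀ z, (Q i)‡ (Q i z) = z := fun z =>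
      congrArg (fun T : _ →L[ℝ] _ => T z) hQi
    have h3 : inner ℝ (A i r) (A i s) = inner ℝ (Q i (A i r)) (Q i (A i s)) := by
      rw [← ContinuousLinearMap.adjoint_inner_right (Q i) (A i r) (Q i (A i s)), h2]
    rw [hyge, hyge, inner_add_left, inner_add_right, inner_add_right, h3,
      ContinuousLinearMap.adjoint_inner_right, ContinuousLinearMap.adjoint_inner_left, hi, hi]
    ring
  have hμ : Tendsto (fun i => (Q i)‡ (μ i)) L (𝓝 ν) := by
    refine tendsto_euclidean fun a => ?_
    simp only [Q, adjoint_combination_apply, μ, inner_smul_right]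
    -- The coordinates of the mean difference are cosine times norm, as each `u a` is a unit vector.
    have h1 := ((Real.continuous_cos.tendsto _).comp (hθ a).2).mul hδ
    refine (h1.comp hp).congr' ?_
    filter_upwards [hu] with i hi
    simp only [Function.comp]
    rw [← InnerProductGeometry.cos_angle_mul_norm_mul_norm (u (p i) a), hi.1 a]
    ring
  have hyμ : ∀ s, Tendsto (fun i => inner ℝ (y i s) (μ i)) L (𝓝 (inner ℝ (w s) ν)) := by
    intro s
    have h1 := ((hA s).inner (𝕜 := ℝ) hμ).add (hE₃ s)
    rw [add_zero] at h1
    refine h1.congr' ?_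
    filter_upwards [hQA] with i hi
    rw [hyge, inner_add_left, ContinuousLinearMap.adjoint_inner_right, hi]
    simp only [e, μ, inner_smul_left, inner_smul_right, conj_trivial]
    rw [← hsq]
    ring
  have hμμ : Tendsto (fun i => ‖μ i‖ ^ 2) L (𝓝 (δ ^ 2)) := by
    refine ((hδ.comp hp).pow 2).congr fun i => ?_
    simp only [Function.comp, μ]
    rw [norm_smul, norm_inv, Real.norm_of_nonneg (Real.sqrt_nonneg _)]
    ring
  -- General position of the scores gives `σ_l (R_kᵀ z)_l = 0` for both classes; the rank condition
  -- on the concatenated matrix then gives `z = 0`.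
  have hw : ∀ z : EuclideanSpace ℝ (Fin m),
      (∀ k j j', inner ℝ (w ⟨k, j⟩) z = inner ℝ (w ⟨k, j'⟩) z) → z = 0 := by
    intro z hz
    have h1 : ∀ k, (fun l : Fin (M.numSpikes k) => √(M.spikeSq k l) * ∑ a, R k a l * z a) = 0 := by
      intro k
      refine hG k _ fun j j' => ?_
      have h2 : ∀ j, ∑ l : Fin (M.numSpikes k),
          √(M.spikeSq k l) * (∑ a, R k a l * z a) * ζ₀ ⟨k, j⟩ l = inner ℝ (w ⟨k, j⟩) z := by
        intro j
        simp only [w, sum_inner, real_inner_smul_left]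
        refine Finset.sum_congr rfl fun l _ => ?_
        have : inner ℝ (col ⟨k, j⟩ l) z = ∑ a, R k a l * z a := by
          rw [← dotProduct_ofLp]
          rfl
        rw [this]
        ring
      rw [h2, h2]
      exact hz k j j'
    have h3 : ∀ k l, ∑ a, R k a l * z a = 0 := by
      intro k l
      have := congrFun (h1 k) l
      simp only [Pi.zero_apply, mul_eq_zero] at this
      have hpos := Real.sqrt_pos.2 (h₂.spikeSq_pos k l l.2)
      exact this.resolve_left hpos.ne'
    have := eq_zero_of_rank_fromCols hrank (h3 0) (h3 1)
    ext a
    exact congrFun this a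
  obtain ⟨κ, hκ⟩ := spikeLimit_of_tendsto hn ht hQ hy hyy hμ hyμ hμμ hw
  have hd : (fun i => (√(p i : ℝ))⁻¹ • sampleDiff (x i)) =
      fun i => combination (y i) (contrast n) + μ i := by
    funext i
    exact (scaled_sampleDiff hn (x i) fun k => M.mean k (p i)).symm
  rw [hd]
  exact ⟨_, _, κ, hκ⟩

end Deterministic

section Deterministic

variable {n : Fin 2 → ℕ} {ι : Type*} {L : Filter ι} {p : ι → ℕ}

theorem mem_signalSpace {p m : ℕ} (U : OrthonormalBasis (Fin p) ℝ (Vec p)) (w : Vec p)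
    {l : Fin p} (hl : l < m) : U l ∈ signalSpace m U w :=
  Submodule.subset_span (Or.inl ⟨l, hl, rfl⟩)

theorem scaledRidge_mem_signalSpace {p m r : ℕ} {α c : ℝ} {lam : Fin p → ℝ}
    {U : OrthonormalBasis (Fin p) ℝ (Vec p)} {d w : Vec p}
    (h : ∑ l ∈ Finset.univ.filter (fun l : Fin p => r ≤ l.val), inner ℝ (U l) d • U l ∈
      Submodule.span ℝ {w}) : scaledRidge m r α lam U (c • d) ∈ signalSpace m U w := by
  refine Submodule.add_mem _ (Submodule.sum_mem _ fun l hl => Submodule.smul_mem _ _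
    (mem_signalSpace U w (by simpa using hl))) ?_
  have h1 : ∑ l ∈ Finset.univ.filter (fun l : Fin p => r ≤ l.val), inner ℝ (U l) (c • d) • U l =
      c • ∑ l ∈ Finset.univ.filter (fun l : Fin p => r ≤ l.val), inner ℝ (U l) d • U l := by
    rw [Finset.smul_sum]
    refine Finset.sum_congr rfl fun l _ => ?_
    rw [inner_smul_right, mul_smul]
  rw [h1]
  exact Submodule.smul_mem _ _ (Submodule.span_mono (by simp) h)

/-- Along a filter as in `exists_spikeLimit`, the ridged discriminant vector with ridge parameter
tending to `-t` is asymptotically orthogonal to the projected signal. -/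
theorem tendsto_angle_ridgeDir [L.NeBot] (M : Population) (hn : ∀ k, 0 < n k)
    (hp : Tendsto p L atTop) (h₁ : M.MeanGrowth) (h₂ : M.Spiked)
    {m : ℕ} {u : (p : ℕ) → Fin m → Vec p} (h₅ : M.CommonBasis m u)
    {t : ℝ} (ht : 0 < t)
    {x : ∀ i, (k : Fin 2) → Fin (n k) → Vec (p i)}
    {ζ : ι → SampleIdx n → ℕ → ℝ} {ζ₀ : SampleIdx n → ℕ → ℝ}
    (hζ : ∀ s l, Tendsto (fun i => ζ i s l) L (𝓝 (ζ₀ s l))) (hG : M.GoodScores ζ₀)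
    (hscore : ∀ᶠ i in L, ∀ (s : SampleIdx n) (l : ℕ), l < M.numSpikes s.1 →
      inner ℝ (M.eigvecAt s.1 (p i) l) (x i s.1 s.2 - M.mean s.1 (p i)) =
        √(M.eigval s.1 (p i) l) * ζ i s l)
    (hE₁ : ∀ (s : SampleIdx n) a, Tendsto (fun i => (√(p i : ℝ))⁻¹ * inner ℝ (u (p i) a)
      (M.noisePart s.1 (x i s.1 s.2 - M.mean s.1 (p i)))) L (𝓝 0))
    (hE₂ : ∀ r s : SampleIdx n, Tendsto (fun i => (p i : ℝ)⁻¹ * inner ℝ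
      (M.noisePart r.1 (x i r.1 r.2 - M.mean r.1 (p i)))
      (M.noisePart s.1 (x i s.1 s.2 - M.mean s.1 (p i)))) L (𝓝 (if r = s then t else 0)))
    (hE₃ : ∀ s : SampleIdx n, Tendsto (fun i => (p i : ℝ)⁻¹ * inner ℝ
      (M.noisePart s.1 (x i s.1 s.2 - M.mean s.1 (p i))) (M.meanDiff (p i))) L (𝓝 0))
    {lam : ∀ i, Fin (p i) → ℝ} {U : ∀ i, OrthonormalBasis (Fin (p i)) ℝ (Vec (p i))}
    (hU : ∀ᶠ i in L, IsEigenDecomp (withinScatter (x i)) (lam i) (U i))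
    {w : ∀ i, Vec (p i)} (hw : ∀ᶠ i in L, IsMDP (x i) (w i))
    {α : ι → ℝ} (hα : Tendsto α L (𝓝 (-t))) (a : Fin m) :
    Tendsto (fun i => InnerProductGeometry.angle
      (ridgeDir m (n 0 + n 1) (α i) (lam i) (U i) (sampleDiff (x i)))
      ((signalSpace m (U i) (w i)).starProjection (u (p i) a))) L (𝓝 (Real.pi / 2)) ∧
    ∀ᶠ i in L, ¬ ((∃ l : Fin (p i), (l : ℕ) < m ∧ lam i l + α i * (p i : ℝ) = 0) ∨
      ridgeVec m (n 0 + n 1) (α i) (lam i) (U i) (sampleDiff (x i)) = 0 ∨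
      (signalSpace m (U i) (w i)).starProjection (u (p i) a) = 0) := by
  obtain ⟨W, η, κ, h⟩ := exists_spikeLimit M hn hp h₁ h₂ h₅ ht hζ hG hscore hE₁ hE₂ hE₃
  have hN : 2 ≤ n 0 + n 1 := by
    have := hn 0
    have := hn 1
    omega
  have hpos : ∀ᶠ i in L, 0 < p i := hp.eventually_gt_atTop 0
  have hb : ∀ᶠ i in L, IsEigenbasis (scaledData (x i) fun k => M.mean k (p i))
      (fun l => lam i l / p i) (U i) := by
    filter_upwards [hU] with i hi using hi.isEigenbasis hn _
  have hfr := finrank_range_centering hn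
  have hfm : Module.finrank ℝ (EuclideanSpace ℝ (Fin m)) = m := finrank_euclideanSpace_fin
  have hmem : ∀ᶠ i in L, scaledRidge m (n 0 + n 1 - 2) (α i) (fun l => lam i l / p i) (U i)
      ((√(p i : ℝ))⁻¹ • sampleDiff (x i)) ∈ signalSpace m (U i) (w i) := by
    filter_upwards [hb, h.eventually_ne_zero hb, hU, hw, hpos] with i hbi hnz hUi hwi hpi
    have hpi' : (0 : ℝ) < p i := by exact_mod_cast hpi
    refine scaledRidge_mem_signalSpace (hwi.tail_mem_span hn hUi ?_ ?_ ?_)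
    · intro l
      have := hbi.nonneg l
      simpa [le_div_iff₀ hpi'] using this
    · intro l hl
      have := hnz l (by rwa [hfr])
      intro h0
      simp [h0] at this
    · intro l hl
      have := h.eigenvalue_eq_zero (lam := fun i l => lam i l / p i) (b := U) hbi l (by rwa [hfr])
      simpa [hpi'.ne'] using this
  have hx : EuclideanSpace.single a (1 : ℝ) ≠ 0 := by simp
  have key := h.tendsto_angle hb hα (fun i => signalSpace m (U i) (w i))
    (Eventually.of_forall fun i l hl => mem_signalSpace _ _ (by rwa [hfm] at hl))
    (by rwa [hfr, hfm]) hx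
  have hne := h.eventually_add_ne_zero hb hα
  simp only [hfr, hfm, combination_single] at key hne
  obtain ⟨k1, k2, k3⟩ := key
  constructor
  · refine k1.congr' ?_
    filter_upwards [hpos] with i hi
    have hs : 0 < √(p i : ℝ) := Real.sqrt_pos.2 (by exact_mod_cast hi)
    rw [angle_ridgeDir, ridgeVec_eq hi hN, InnerProductGeometry.angle_smul_left_of_pos _ _ hs]
  · filter_upwards [k2, k3, hne, hpos] with i h2 h3 h4 hi
    have hi' : (0 : ℝ) < p i := by exact_mod_cast hi
    rintro (⟨l, hl, h0⟩ | h0 | h0)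
    · refine h4 l hl ?_
      rw [div_add' _ _ _ hi'.ne', h0, zero_div]
    · rw [ridgeVec_eq hi hN, smul_eq_zero] at h0
      have hs : 0 < √(p i : ℝ) := Real.sqrt_pos.2 hi'
      exact h2 (h0.resolve_left hs.ne')
    · exact h3 h0

end Deterministic

/-! ### From statements along filters to convergence in probability. -/

section Transfer

variable {Ω : Type*} [MeasurableSpace Ω] {P : Measure Ω} [IsProbabilityMeasure P]

/-- A deterministic implication along filters, assuming the convergence of finitely many error
terms and of a tight random element, yields convergence in probability. -/
theorem tendsto_measure_bad {Z : Type*} [TopologicalSpace Z] [MeasurableSpace Z] [BorelSpace Z]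
    [PolishSpace Z] {ζ : Ω → Z} (hζ : Measurable ζ) {G : Set Z} (hG : MeasurableSet G)
    (hGae : ∀ᵐ ω ∂P, ζ ω ∈ G) {J : Type*} [Finite J] {err : J → ℕ → Ω → ℝ}
    (herr : ∀ j, TendstoInMeasure P (err j) atTop fun _ => 0) {reg bad : ℕ → Ω → Prop}
    (hreg : ∀ᶠ p in atTop, ∀ᵐ ω ∂P, reg p ω)
    (H : ∀ L : Filter (ℕ × Ω), L.NeBot → Tendsto Prod.fst L atTop → (∀ᶠ x in L, reg x.1 x.2) →
      (∀ j, Tendsto (fun x => err j x.1 x.2) L (𝓝 0)) → ∀ z ∈ G,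
      Tendsto (fun x => ζ x.2) L (𝓝 z) → ∀ᶠ x in L, ¬ bad x.1 x.2) :
    Tendsto (fun p => P {ω | bad p ω}) atTop (𝓝 0) := by
  have : Fintype J := Fintype.ofFinite J
  rw [ENNReal.tendsto_nhds_zero]
  intro ε hε
  have hε2 : ε / 2 ≠ 0 := (ENNReal.half_pos hε.ne').ne'
  -- `ζ` does not vary with `p`, so inner regularity of its single law provides one compact set,
  -- inside `G`, for all `p`.
  obtain ⟨K, hKG, hK, hlt⟩ := hG.exists_isCompact_lt_add (μ := P.map ζ) (measure_ne_top _ _) hε2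
  have := Measure.isProbabilityMeasure_map (μ := P) hζ.aemeasurable
  have hKout : P {ω | ζ ω ∉ K} ≤ ε / 2 := by
    have h1 : P.map ζ G = 1 := by
      rw [Measure.map_apply hζ hG]
      exact (prob_compl_eq_zero_iff (hζ hG)).1 hGae
    rw [h1] at hlt
    have h2 : P {ω | ζ ω ∉ K} = 1 - P.map ζ K := by
      rw [← prob_compl_eq_one_sub hK.measurableSet, Measure.map_apply hζ hK.measurableSet.compl]
      rfl
    rw [h2, tsub_le_iff_left]
    exact hlt.le
  obtain ⟨N, hN⟩ : ∃ N : ℕ, ∀ p ≥ N, ∀ ω, reg p ω → ζ ω ∈ K →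
      (∀ j, |err j p ω| < 1 / ((N : ℝ) + 1)) → ¬ bad p ω := by
    by_contra! hcon
    choose f hf g hg1 hg2 hg3 hg4 using hcon
    -- If no `N` works, the counterexamples form a sequence. Along an ultrafilter compactness makes
    -- `ζ` converge within `K`, and the hypothesis `H` is contradicted.
    let L : Ultrafilter (ℕ × Ω) := (hyperfilter ℕ).map fun N => (f N, g N)
    have hLe : ∀ {Q : ℕ × Ω → Prop}, (∀ᶠ N in atTop, Q (f N, g N)) → ∀ᶠ x in L, Q x := by
      intro Q hQ
      exact (Nat.hyperfilter_le_atTop hQ : ∀ᶠ N in (hyperfilter ℕ : Filter ℕ), Q (f N, g N))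
    have hLt : ∀ {Y : Type _} {h : ℕ × Ω → Y} {F : Filter Y},
        Tendsto (fun N => h (f N, g N)) atTop F → Tendsto h L F := by
      intro Y h F hh
      exact hh.mono_left Nat.hyperfilter_le_atTop
    obtain ⟨z, hz, hzL⟩ := hK.ultrafilter_le_nhds (L.map fun x : ℕ × Ω => ζ x.2) (by
      rw [le_principal_iff]
      exact hLe (Eventually.of_forall hg2))
    have hbad := H L inferInstance (hLt (h := Prod.fst) (tendsto_atTop_mono hf tendsto_id))
      (hLe (Eventually.of_forall hg1))
      (fun j => hLt (h := fun x : ℕ × Ω => err j x.1 x.2) ?_) z (hKG hz) hzL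
    · have h1 : ∀ᶠ x : ℕ × Ω in L, bad x.1 x.2 := hLe (Eventually.of_forall hg4)
      obtain ⟨x, hx1, hx2⟩ := (h1.and hbad).exists
      exact hx2 hx1
    · rw [tendsto_zero_iff_abs_tendsto_zero]
      exact squeeze_zero (fun N => abs_nonneg _) (fun N => (hg3 N j).le)
        tendsto_one_div_add_atTop_nhds_zero_nat
  have hδ : (0 : ℝ) < 1 / ((N : ℝ) + 1) := by positivity
  have hsum : Tendsto (fun p => ∑ j, P {ω | 1 / ((N : ℝ) + 1) ≤ ‖err j p ω - 0‖}) atTop (𝓝 0) := by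
    have := tendsto_finsetSum Finset.univ fun j _ => (tendstoInMeasure_iff_norm.1 (herr j)) _ hδ
    simpa using this
  filter_upwards [eventually_ge_atTop N, hreg,
    (ENNReal.tendsto_nhds_zero.1 hsum) (ε / 2) (ENNReal.half_pos hε.ne')] with p hp hr hs
  have hsub : {ω | bad p ω} ⊆ ({ω | ¬ reg p ω} ∪ {ω | ζ ω ∉ K}) ∪
      ⋃ j, {ω | 1 / ((N : ℝ) + 1) ≤ ‖err j p ω - 0‖} := by
    intro ω hω
    by_contra hcon
    simp only [Set.mem_union, Set.mem_ofPred_eq, Set.mem_iUnion, not_or, not_not, not_exists,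
      not_le, sub_zero, Real.norm_eq_abs] at hcon
    exact hN p hp ω hcon.1.1 hcon.1.2 hcon.2 hω
  calc P {ω | bad p ω} ≤ _ := measure_mono hsub
    _ ≤ (P {ω | ¬ reg p ω} + P {ω | ζ ω ∉ K}) +
      ∑ j, P {ω | 1 / ((N : ℝ) + 1) ≤ ‖err j p ω - 0‖} :=
        (measure_union_le _ _).trans (add_le_add (measure_union_le _ _)
          (measure_iUnion_fintype_le _ _))
    _ ≤ (0 + ε / 2) + ε / 2 := by
      gcongr
      exact (le_of_eq hr)
    _ = ε := by rw [zero_add, ENNReal.add_halves]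

/-- Convergence in measure to zero from the convergence of second moments. -/
theorem tendstoInMeasure_zero_of_sq_le {f : ℕ → Ω → ℝ} {a : ℕ → ℝ}
    (hf : ∀ᶠ p in atTop, Integrable (fun ω => f p ω ^ 2) P ∧ ∫ ω, f p ω ^ 2 ∂P ≤ a p)
    (ha : Tendsto a atTop (𝓝 0)) : TendstoInMeasure P f atTop fun _ => 0 := by
  rw [tendstoInMeasure_iff_norm]
  intro ε hε
  have h1 : Tendsto (fun p => ENNReal.ofReal (a p / ε ^ 2)) atTop (𝓝 0) := by
    have := (ENNReal.continuous_ofReal.tendsto _).comp (ha.div_const (ε ^ 2))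
    rw [zero_div, ENNReal.ofReal_zero] at this
    exact this
  refine tendsto_of_tendsto_of_tendsto_of_le_of_le' tendsto_const_nhds h1
    (Eventually.of_forall fun _ => zero_le) ?_
  filter_upwards [hf] with p hp
  have h2 : {ω | ε ≤ ‖f p ω - 0‖} = {ω | ε ^ 2 ≤ f p ω ^ 2} := by
    ext ω
    simp only [sub_zero, Real.norm_eq_abs, Set.mem_ofPred_eq]
    rw [← sq_abs (f p ω)]
    exact (pow_le_pow_iff_left₀ hε.le (abs_nonneg _) two_ne_zero).symm
  have h3 := mul_meas_ge_le_integral_of_nonneg (Eventually.of_forall fun ω => sq_nonneg (f p ω))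
    hp.1 (ε ^ 2)
  rw [h2, ← ofReal_measureReal]
  refine ENNReal.ofReal_le_ofReal ?_
  rw [le_div_iff₀ (by positivity), mul_comm]
  exact h3.trans hp.2

end Transfer

/-! ### Covariance bounds under rho-mixing. -/

section Mixing

variable {Ω : Type*} [mΩ : MeasurableSpace Ω] {P : Measure Ω} [IsProbabilityMeasure P]

/-- The variances of `f + g` and `f - g` are nonnegative. -/
theorem abs_covariance_le_half_add {f g : Ω → ℝ} (hf : MemLp f 2 P) (hg : MemLp g 2 P) :
    |cov[f, g; P]| ≤ (Var[f; P] + Var[g; P]) / 2 := by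
  have h1 := variance_add hf hg
  have h2 := variance_sub hf hg
  have h3 := variance_nonneg (f + g) P
  have h4 := variance_nonneg (f - g) P
  rw [abs_le]
  constructor <;> linarith

theorem covariance_eq_zero_of_variance_eq_zero {f g : Ω → ℝ} (hf : MemLp f 2 P)
    (h : Var[f; P] = 0) : cov[f, g; P] = 0 := by
  have h := ae_eq_integral_of_variance_eq_zero hf h
  rw [covariance]
  refine integral_eq_zero_of_ae ?_
  filter_upwards [h] with ω hω
  simp [hω]

end Mixing

theorem abs_covariance_le_of_maxCorr_le {Ω : Type*} {m₁ m₂ mΩ : MeasurableSpace Ω} {P : Measure Ω}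
    [IsProbabilityMeasure P] {f g : Ω → ℝ}
    (hf : Measurable[m₁] f) (hf2 : MemLp f 2 P) (hg : Measurable[m₂] g) (hg2 : MemLp g 2 P)
    {ρ C : ℝ} (hρ : 0 ≤ ρ) (h : maxCorr m₁ m₂ P ≤ ENNReal.ofReal ρ)
    (hfC : Var[f; P] ≤ C) (hgC : Var[g; P] ≤ C) : |cov[f, g; P]| ≤ ρ * C := by
  have hC : 0 ≤ C := (variance_nonneg f P).trans hfC
  have h1 : ENNReal.ofReal |corr f g P| ≤ ENNReal.ofReal ρ := by
    refine le_trans ?_ h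
    exact le_iSup₂_of_le f g (le_iSup₂_of_le ⟨hf, hf2⟩ ⟨hg, hg2⟩ le_rfl)
  have h2 : |corr f g P| ≤ ρ := (ENNReal.ofReal_le_ofReal_iff hρ).1 h1
  rw [corr, abs_div, abs_of_nonneg (a := _ * _) (by positivity)] at h2
  -- With a vanishing variance `corr` is a division by zero and bounds nothing, but the covariance
  -- is then zero anyway.
  by_cases hf0 : Var[f; P] = 0
  · rw [covariance_eq_zero_of_variance_eq_zero hf2 hf0, abs_zero]
    positivity
  by_cases hg0 : Var[g; P] = 0
  · rw [covariance_comm, covariance_eq_zero_of_variance_eq_zero hg2 hg0, abs_zero]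
    positivity
  have hf1 : 0 < √Var[f; P] := Real.sqrt_pos.2 ((variance_nonneg _ _).lt_of_ne' hf0)
  have hg1 : 0 < √Var[g; P] := Real.sqrt_pos.2 ((variance_nonneg _ _).lt_of_ne' hg0)
  rw [div_le_iff₀ (by positivity)] at h2
  refine h2.trans ?_
  gcongr
  calc √Var[f; P] * √Var[g; P] ≤ √C * √C := by gcongr
    _ = C := Real.mul_self_sqrt hC

section Mixing

variable {Ω : Type*} [mΩ : MeasurableSpace Ω] {P : Measure Ω} [IsProbabilityMeasure P]

/-- The covariances of the squares of a rho-mixing sequence are small at large gaps. -/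
theorem RhoMixing.abs_covariance_sq_le {y : ℕ → Ω → ℝ} (h : RhoMixing P y) {C : ℝ}
    (hy : ∀ i, MemLp (fun ω => y i ω ^ 2) 2 P) (hC : ∀ i, Var[fun ω => y i ω ^ 2; P] ≤ C)
    {ε : ℝ} (hε : 0 < ε) : ∃ l : ℕ, ∀ i j, i + l ≤ j →
      |cov[fun ω => y i ω ^ 2, fun ω => y j ω ^ 2; P]| ≤ ε * C := by
  have h1 := (ENNReal.tendsto_nhds_zero.1 h) (ENNReal.ofReal ε) (ENNReal.ofReal_pos.2 hε)
  obtain ⟨l, hl⟩ := h1.exists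
  have hmeas : ∀ (I : Set ℕ) (i : ℕ), i ∈ I →
      Measurable[sigmaField y I] (fun ω => y i ω ^ 2) := by
    intro I i hi
    have h2 : Measurable[MeasurableSpace.comap (y i) inferInstance] (fun ω => y i ω ^ 2) :=
      (measurable_id.pow_const 2).comp (comap_measurable (y i))
    exact h2.mono (le_iSup₂_of_le i hi le_rfl) le_rfl
  refine ⟨l, fun i j hij => ?_⟩
  refine abs_covariance_le_of_maxCorr_le (m₁ := sigmaField y (Set.Iic i))
    (m₂ := sigmaField y (Set.Ici (i + l))) (hmeas _ _ (Set.mem_Iic.2 le_rfl)) (hy i)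
    (hmeas _ _ (Set.mem_Ici.2 hij)) (hy j) hε.le ?_ (hC i) (hC j)
  exact (le_iSup (fun i => maxCorr (sigmaField y (Set.Iic i)) (sigmaField y (Set.Ici (i + l))) P)
    i).trans hl

end Mixing

/-! ### Spike and noise parts in the eigenbasis, and their second moments. -/

theorem Population.spikePart_eq (M : Population) (k : Fin 2) {p : ℕ} (v : Vec p) :
    M.spikePart k v = ∑ i ∈ Finset.univ.filter (fun i : Fin p => i.val < M.numSpikes k),
      inner ℝ (M.eigvec k p i) v • M.eigvec k p i := by
  have h1 : M.spikePart k v = ∑ l ∈ Finset.range (M.numSpikes k),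
      if l < p then inner ℝ (M.eigvecAt k p l) v • M.eigvecAt k p l else 0 := by
    rw [Population.spikePart, Finset.sum_range]
    refine Finset.sum_congr rfl fun l _ => ?_
    by_cases h : l.val < p
    · rw [if_pos h]
    · simp [Population.eigvecAt, h]
  have h2 : ∑ i ∈ Finset.univ.filter (fun i : Fin p => i.val < M.numSpikes k),
      inner ℝ (M.eigvec k p i) v • M.eigvec k p i = ∑ l ∈ Finset.range p,
      if l < M.numSpikes k then inner ℝ (M.eigvecAt k p l) v • M.eigvecAt k p l else 0 := by
    rw [Finset.sum_filter, Finset.sum_range]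
    refine Finset.sum_congr rfl fun i _ => ?_
    simp [Population.eigvecAt]
  rw [h1, h2, ← Finset.sum_filter, ← Finset.sum_filter]
  refine Finset.sum_congr ?_ fun _ _ => rfl
  ext l
  simp [and_comm]

theorem Population.noisePart_eq (M : Population) (k : Fin 2) {p : ℕ} (v : Vec p) :
    M.noisePart k v = ∑ i ∈ Finset.univ.filter (fun i : Fin p => M.numSpikes k ≤ i.val),
      inner ℝ (M.eigvec k p i) v • M.eigvec k p i := by
  rw [Population.noisePart, M.spikePart_eq, sub_eq_iff_eq_add]
  nth_rw 1 [← (M.eigvec k p).sum_repr' v]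
  rw [← Finset.sum_filter_add_sum_filter_not Finset.univ
    (fun i : Fin p => M.numSpikes k ≤ i.val)]
  simp only [not_le]

theorem Population.inner_noisePart (M : Population) (k : Fin 2) {p : ℕ} (v z : Vec p) :
    inner ℝ (M.noisePart k v) z =
      ∑ i ∈ Finset.univ.filter (fun i : Fin p => M.numSpikes k ≤ i.val),
        inner ℝ (M.eigvec k p i) v * inner ℝ (M.eigvec k p i) z := by
  rw [M.noisePart_eq, sum_inner]
  refine Finset.sum_congr rfl fun i _ => ?_
  rw [real_inner_smul_left]

theorem Population.noisePart_measurable (M : Population) (k : Fin 2) {p : ℕ} :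
    Measurable (M.noisePart k : Vec p → Vec p) := by
  have : (M.noisePart k : Vec p → Vec p) = fun v =>
      ∑ i ∈ Finset.univ.filter (fun i : Fin p => M.numSpikes k ≤ i.val),
      inner ℝ (M.eigvec k p i) v • M.eigvec k p i := funext fun v => M.noisePart_eq k v
  rw [this]
  exact Continuous.measurable (by fun_prop)

theorem Population.eigval_of_le (M : Population) {k : Fin 2} {p i : ℕ} (h : M.numSpikes k ≤ i) :
    M.eigval k p i = M.tailSq k i := by
  rw [Population.eigval, if_neg (not_lt.2 h)]

section Moments

variable {Ω : Type*} [MeasurableSpace Ω] {P : Measure Ω}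
  {M : Population} {n : Fin 2 → ℕ} {X : (p : ℕ) → (k : Fin 2) → Fin (n k) → Ω → Vec p}

/-- A sum of products of uncorrelated and independent factors has an explicit second moment. -/
theorem integral_sum_mul_sq {ι : Type*} [DecidableEq ι] (s : Finset ι) {A B : ι → Ω → ℝ}
    {a : ι → ℝ}
    (hA : ∀ i l, Integrable (fun ω => A i ω * A l ω) P)
    (hB : ∀ i l, Integrable (fun ω => B i ω * B l ω) P)
    (hAB : ∀ i l, IndepFun (fun ω => A i ω * A l ω) (fun ω => B i ω * B l ω) P)
    (ha : ∀ i l, ∫ ω, A i ω * A l ω ∂P = if i = l then a i else 0) :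
    Integrable (fun ω => (∑ i ∈ s, A i ω * B i ω) ^ 2) P ∧
      ∫ ω, (∑ i ∈ s, A i ω * B i ω) ^ 2 ∂P = ∑ i ∈ s, a i * ∫ ω, B i ω * B i ω ∂P := by
  have h1 : (fun ω => (∑ i ∈ s, A i ω * B i ω) ^ 2) =
      fun ω => ∑ i ∈ s, ∑ l ∈ s, (A i ω * A l ω) * (B i ω * B l ω) := by
    funext ω
    rw [sq, Finset.sum_mul_sum]
    refine Finset.sum_congr rfl fun i _ => Finset.sum_congr rfl fun l _ => ?_
    ring
  have hint : ∀ i l, Integrable (fun ω => (A i ω * A l ω) * (B i ω * B l ω)) P := fun i l =>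
    (hAB i l).integrable_mul (hA i l) (hB i l)
  rw [h1]
  refine ⟨integrable_finsetSum _ fun i _ => integrable_finsetSum _ fun l _ => hint i l, ?_⟩
  rw [integral_finsetSum _ fun i _ => integrable_finsetSum _ fun l _ => hint i l]
  refine Finset.sum_congr rfl fun i hi => ?_
  rw [integral_finsetSum _ fun l _ => hint i l]
  have h2 : ∀ l, ∫ ω, (A i ω * A l ω) * (B i ω * B l ω) ∂P =
      if i = l then a i * ∫ ω, B i ω * B i ω ∂P else 0 := by
    intro l
    rw [(hAB i l).integral_fun_mul_eq_mul_integral (hA i l).1 (hB i l).1, ha]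
    by_cases h : i = l
    · subst h; simp
    · simp [h]
  simp only [h2, Finset.sum_ite_eq, hi, if_true]

variable [IsProbabilityMeasure P]

namespace TrainingSample

theorem memLp_inner (hX : TrainingSample M P n X) (p : ℕ) (k : Fin 2) (j : Fin (n k)) (z : Vec p) :
    MemLp (fun ω => inner ℝ z (X p k j ω - M.mean k p)) 2 P := by
  have : (fun ω => inner ℝ z (X p k j ω - M.mean k p)) =
      fun ω => ∑ a, z a * (X p k j ω a - M.mean k p a) := by
    funext ω
    rw [← dotProduct_ofLp]
    rfl
  rw [this]
  exact memLp_finsetSum _ fun a _ => ((hX.memLp p k j a).sub (memLp_const _)).const_mul _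

theorem integrable_inner_mul_inner (hX : TrainingSample M P n X) (p : ℕ) (k : Fin 2)
    (j : Fin (n k)) (z z' : Vec p) :
    Integrable (fun ω => inner ℝ z (X p k j ω - M.mean k p) *
      inner ℝ z' (X p k j ω - M.mean k p)) P :=
  (hX.memLp_inner p k j z).integrable_mul (hX.memLp_inner p k j z')

theorem integral_inner_mul_inner (hX : TrainingSample M P n X) (p : ℕ) (k : Fin 2)
    (j : Fin (n k)) (i l : Fin p) :
    ∫ ω, inner ℝ (M.eigvec k p i) (X p k j ω - M.mean k p) *
      inner ℝ (M.eigvec k p l) (X p k j ω - M.mean k p) ∂P =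
        if i = l then M.eigval k p i else 0 := by
  set e := M.eigvec k p
  have hint : ∀ a b, Integrable (fun ω => (X p k j ω a - M.mean k p a) *
      (X p k j ω b - M.mean k p b)) P := fun a b =>
    ((hX.memLp p k j a).sub (memLp_const _)).integrable_mul
      ((hX.memLp p k j b).sub (memLp_const _))
  have h1 : ∀ ω, inner ℝ (e i) (X p k j ω - M.mean k p) *
      inner ℝ (e l) (X p k j ω - M.mean k p) = ∑ a, ∑ b, (e i a * e l b) *
        ((X p k j ω a - M.mean k p a) * (X p k j ω b - M.mean k p b)) := by
    intro ω
    rw [← dotProduct_ofLp, ← dotProduct_ofLp, dotProduct, dotProduct, Finset.sum_mul_sum]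
    refine Finset.sum_congr rfl fun a _ => Finset.sum_congr rfl fun b _ => ?_
    simp only [WithLp.ofLp_sub, Pi.sub_apply]
    ring
  simp only [h1]
  rw [integral_finsetSum _ fun a _ => integrable_finsetSum _ fun b _ => (hint a b).const_mul _]
  have h2 : ∀ a b, ∫ ω, (X p k j ω a - M.mean k p a) * (X p k j ω b - M.mean k p b) ∂P =
      covMatrix P (X p k j) a b := by
    intro a b
    rw [covMatrix, Matrix.of_apply, covariance, hX.mean_eq, hX.mean_eq]
  have h3 : ∀ a, ∫ ω, ∑ b, (e i a * e l b) * ((X p k j ω a - M.mean k p a) *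
      (X p k j ω b - M.mean k p b)) ∂P = e i a * (covMatrix P (X p k j) *ᵥ (e l).ofLp) a := by
    intro a
    rw [integral_finsetSum _ fun b _ => (hint a b).const_mul _, Matrix.mulVec, dotProduct,
      Finset.mul_sum]
    refine Finset.sum_congr rfl fun b _ => ?_
    rw [integral_const_mul, h2]
    ring
  simp only [h3]
  have h4 : ∑ a, e i a * (covMatrix P (X p k j) *ᵥ (e l).ofLp) a =
      M.eigval k p l * inner ℝ (e i) (e l) := by
    rw [hX.cov_eigen p k j l, ← dotProduct_ofLp, dotProduct, Finset.mul_sum]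
    refine Finset.sum_congr rfl fun a _ => ?_
    simp only [Pi.smul_apply, smul_eq_mul]
    ring
  rw [h4, e.inner_eq_ite]
  by_cases h : i = l
  · subst h; simp
  · simp [h]

/-- The second moment of the noise in a fixed direction. -/
theorem integral_inner_noisePart_sq_le (hX : TrainingSample M P n X) {C : ℝ}
    (hC : ∀ k i, M.tailSq k i ≤ C) (hC0 : ∀ k i, 0 < M.tailSq k i) (p : ℕ) (k : Fin 2)
    (j : Fin (n k)) (z : Vec p) :
    Integrable (fun ω => inner ℝ (M.noisePart k (X p k j ω - M.mean k p)) z ^ 2) P ∧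
      ∫ ω, inner ℝ (M.noisePart k (X p k j ω - M.mean k p)) z ^ 2 ∂P ≤ C * ‖z‖ ^ 2 := by
  have h := integral_sum_mul_sq (P := P)
    (Finset.univ.filter (fun i : Fin p => M.numSpikes k ≤ i.val))
    (A := fun i ω => inner ℝ (M.eigvec k p i) (X p k j ω - M.mean k p))
    (B := fun i _ => inner ℝ (M.eigvec k p i) z) (a := fun i => M.eigval k p i)
    (fun i l => hX.integrable_inner_mul_inner p k j _ _) (fun i l => integrable_const _)
    (fun i l => indepFun_const_right _ _) (fun i l => hX.integral_inner_mul_inner p k j i l)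
  simp only [M.inner_noisePart]
  refine ⟨h.1, h.2.trans_le ?_⟩
  rw [← sum_sq_inner (M.eigvec k p), Finset.mul_sum]
  have hC' : 0 ≤ C := (hC0 0 0).le.trans (hC 0 0)
  refine (Finset.sum_le_sum fun i hi => ?_).trans
    (Finset.sum_le_univ_sum_of_nonneg fun i => by positivity)
  rw [M.eigval_of_le (by simpa using hi)]
  simp only [integral_const, probReal_univ, one_smul]
  rw [← sq]
  exact mul_le_mul_of_nonneg_right (hC _ _) (sq_nonneg _)

/-- The noise parts of two different observations are nearly orthogonal. -/
theorem integral_inner_noisePart_noisePart_sq_le (hX : TrainingSample M P n X) {C : ℝ}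
    (hC : ∀ k i, M.tailSq k i ≤ C) (hC0 : ∀ k i, 0 < M.tailSq k i) (p : ℕ)
    {r s : SampleIdx n} (hrs : r ≠ s) :
    Integrable (fun ω => inner ℝ (M.noisePart r.1 (X p r.1 r.2 ω - M.mean r.1 p))
      (M.noisePart s.1 (X p s.1 s.2 ω - M.mean s.1 p)) ^ 2) P ∧
    ∫ ω, inner ℝ (M.noisePart r.1 (X p r.1 r.2 ω - M.mean r.1 p))
      (M.noisePart s.1 (X p s.1 s.2 ω - M.mean s.1 p)) ^ 2 ∂P ≤ C * C * p := by
  have hC' : 0 ≤ C := (hC0 0 0).le.trans (hC 0 0)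
  have hB : ∀ z : Vec p, Integrable (fun ω => inner ℝ z
      (M.noisePart s.1 (X p s.1 s.2 ω - M.mean s.1 p)) ^ 2) P ∧
      ∫ ω, inner ℝ z (M.noisePart s.1 (X p s.1 s.2 ω - M.mean s.1 p)) ^ 2 ∂P ≤ C * ‖z‖ ^ 2 := by
    intro z
    have := hX.integral_inner_noisePart_sq_le hC hC0 p s.1 s.2 z
    simpa only [real_inner_comm z] using this
  have hBm : ∀ z : Vec p, Measurable fun v : Vec p =>
      inner ℝ z (M.noisePart s.1 (v - M.mean s.1 p)) := by
    intro z
    exact ((innerSL ℝ z).continuous.measurable.comp (M.noisePart_measurable _)).comp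
      (measurable_id.sub_const _)
  have hB2 : ∀ z : Vec p, MemLp (fun ω => inner ℝ z
      (M.noisePart s.1 (X p s.1 s.2 ω - M.mean s.1 p))) 2 P := by
    intro z
    rw [memLp_two_iff_integrable_sq]
    · exact (hB z).1
    · exact ((hBm z).comp (hX.measurable p s.1 s.2)).aestronglyMeasurable
  have hind : ∀ i l : Fin p, IndepFun
      (fun ω => inner ℝ (M.eigvec r.1 p i) (X p r.1 r.2 ω - M.mean r.1 p) *
        inner ℝ (M.eigvec r.1 p l) (X p r.1 r.2 ω - M.mean r.1 p))
      (fun ω => inner ℝ (M.eigvec r.1 p i) (M.noisePart s.1 (X p s.1 s.2 ω - M.mean s.1 p)) *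
        inner ℝ (M.eigvec r.1 p l) (M.noisePart s.1 (X p s.1 s.2 ω - M.mean s.1 p))) P := by
    intro i l
    have h1 : IndepFun (X p r.1 r.2) (X p s.1 s.2) P := (hX.indep p).indepFun hrs
    refine h1.comp (φ := fun v => inner ℝ (M.eigvec r.1 p i) (v - M.mean r.1 p) *
        inner ℝ (M.eigvec r.1 p l) (v - M.mean r.1 p))
      (ψ := fun v => inner ℝ (M.eigvec r.1 p i) (M.noisePart s.1 (v - M.mean s.1 p)) *
        inner ℝ (M.eigvec r.1 p l) (M.noisePart s.1 (v - M.mean s.1 p))) ?_ ?_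
    · exact Continuous.measurable (by fun_prop)
    · exact (hBm _).mul (hBm _)
  -- Both noise vectors are expanded in the eigenbasis of the class of `r`. The coordinates of `r`
  -- are uncorrelated and independent of those of `s`, so only diagonal terms survive, each at most
  -- `C * C`.
  have h := integral_sum_mul_sq (P := P)
    (Finset.univ.filter (fun i : Fin p => M.numSpikes r.1 ≤ i.val))
    (fun i l => hX.integrable_inner_mul_inner p r.1 r.2 _ _)
    (fun i l => (hB2 (M.eigvec r.1 p i)).integrable_mul (hB2 (M.eigvec r.1 p l))) hind
    (fun i l => hX.integral_inner_mul_inner p r.1 r.2 i l)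
  simp only [M.inner_noisePart r.1]
  refine ⟨h.1, h.2.trans_le ?_⟩
  calc _ ≤ ∑ i ∈ Finset.univ.filter (fun i : Fin p => M.numSpikes r.1 ≤ i.val), C * C := by
        refine Finset.sum_le_sum fun i hi => ?_
        rw [M.eigval_of_le (by simpa using hi)]
        have h2 := (hB (M.eigvec r.1 p i)).2
        simp only [(M.eigvec r.1 p).norm_eq_one, mul_one, sq] at h2
        exact mul_le_mul (hC _ _) h2 (integral_nonneg fun ω => mul_self_nonneg _) hC'
    _ ≤ ∑ i : Fin p, C * C := Finset.sum_le_univ_sum_of_nonneg fun i => by positivity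
    _ = C * C * p := by simp [mul_comm]

end TrainingSample
end Moments

/-! ### Variances of weighted averages of squared mixing scores. -/

section LargeNumbers

variable {Ω : Type*} [MeasurableSpace Ω] {P : Measure Ω} [IsProbabilityMeasure P]

/-- `π` injects the set into the integers at distance less than `l` from `a`. -/
theorem card_filter_dist_lt_le (π : Equiv.Perm ℕ) (s : Finset ℕ) (a l : ℕ) :
    (s.filter fun i => π i < a + l ∧ a < π i + l).card ≤ 2 * l := by
  have h1 : (s.filter fun i => π i < a + l ∧ a < π i + l).card ≤
      (Finset.Ico (a + 1 - l) (a + l)).card := by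
    refine Finset.card_le_card_of_injOn π ?_ π.injective.injOn
    intro i hi
    have := (Finset.mem_filter.1 hi).2
    simp only [Finset.coe_Ico, Set.mem_Ico]
    omega
  rw [Nat.card_Ico] at h1
  omega

/-- Pairs are sorted by the distance of their positions in the mixing order. Distant pairs have
covariance at most `ε * C`; each index has at most `2 * l` close partners, and those are bounded
trivially. -/
theorem variance_sum_le {y : ℕ → Ω → ℝ} {π : Equiv.Perm ℕ} {C ε : ℝ} {l : ℕ} (hε : 0 ≤ ε)
    (hy : ∀ i, MemLp (fun ω => y i ω ^ 2) 2 P) (hC : ∀ i, Var[fun ω => y i ω ^ 2; P] ≤ C)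
    (hmix : ∀ i j, i + l ≤ j →
      |cov[fun ω => y (π i) ω ^ 2, fun ω => y (π j) ω ^ 2; P]| ≤ ε * C)
    {c : ℕ → ℝ} {B : ℝ} (hc : ∀ i, 0 ≤ c i) (hcB : ∀ i, c i ≤ B) (s : Finset ℕ) :
    Var[fun ω => ∑ i ∈ s, c i * y i ω ^ 2; P] ≤
      B ^ 2 * (s.card * (s.card * (ε * C) + 2 * l * C)) := by
  have hC0 : 0 ≤ C := (variance_nonneg _ _).trans (hC 0)
  have hB0 : 0 ≤ B := (hc 0).trans (hcB 0)
  have hpair : ∀ i j, |cov[fun ω => y i ω ^ 2, fun ω => y j ω ^ 2; P]| ≤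
      ε * C + if π.symm j < π.symm i + l ∧ π.symm i < π.symm j + l then C else 0 := by
    intro i j
    by_cases h : π.symm j < π.symm i + l ∧ π.symm i < π.symm j + l
    · rw [if_pos h]
      have := abs_covariance_le_half_add (hy i) (hy j)
      have := hC i
      have := hC j
      have : 0 ≤ ε * C := by positivity
      linarith
    · rw [if_neg h, add_zero]
      rcases le_or_gt (π.symm i + l) (π.symm j) with h1 | h1
      · simpa using hmix _ _ h1
      · have h2 : π.symm j + l ≤ π.symm i := by omega
        rw [covariance_comm]
        simpa using hmix _ _ h2
  have hm : ∀ i ∈ s, MemLp (fun ω => c i * y i ω ^ 2) 2 P := fun i _ => (hy i).const_mul _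
  rw [← covariance_self (memLp_finsetSum s hm).aemeasurable,
    covariance_fun_sum_fun_sum' hm hm]
  calc _ ≤ ∑ i ∈ s, ∑ j ∈ s, B ^ 2 * (ε * C +
        if π.symm j < π.symm i + l ∧ π.symm i < π.symm j + l then C else 0) := by
        refine Finset.sum_le_sum fun i _ => Finset.sum_le_sum fun j _ => ?_
        rw [covariance_const_mul_left, covariance_const_mul_right, ← mul_assoc]
        refine (le_abs_self _).trans ?_
        rw [abs_mul, abs_of_nonneg (mul_nonneg (hc i) (hc j))]
        refine mul_le_mul ?_ (hpair i j) (abs_nonneg _) (by positivity)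
        rw [sq]
        exact mul_le_mul (hcB i) (hcB j) (hc j) hB0
    _ ≤ ∑ i ∈ s, B ^ 2 * (s.card * (ε * C) + 2 * l * C) := by
        refine Finset.sum_le_sum fun i _ => ?_
        rw [← Finset.mul_sum, Finset.sum_add_distrib, Finset.sum_const, nsmul_eq_mul,
          ← Finset.sum_filter, Finset.sum_const, nsmul_eq_mul]
        gcongr
        have := card_filter_dist_lt_le π.symm s (π.symm i) l
        exact_mod_cast this
    _ = _ := by rw [Finset.sum_const, nsmul_eq_mul]; ring

/-- The variance of weighted averages of the squares of a permuted rho-mixing sequence. -/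
theorem tendsto_variance_average {y : ℕ → Ω → ℝ} {π : Equiv.Perm ℕ} {C : ℝ}
    (hy : ∀ i, MemLp (fun ω => y i ω ^ 2) 2 P) (hC : ∀ i, Var[fun ω => y i ω ^ 2; P] ≤ C)
    (hmix : RhoMixing P fun i => y (π i)) {c : ℕ → ℝ} {B : ℝ} (hc : ∀ i, 0 ≤ c i)
    (hcB : ∀ i, c i ≤ B) (m : ℕ) :
    Tendsto (fun p : ℕ => Var[fun ω => (p : ℝ)⁻¹ * ∑ i ∈ Finset.Ico m p, c i * y i ω ^ 2; P])
      atTop (𝓝 0) := by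
  have hC0 : 0 ≤ C := (variance_nonneg _ _).trans (hC 0)
  rw [Metric.tendsto_nhds]
  intro δ hδ
  -- With this `ε` distant pairs contribute at most `δ / 2`; close pairs contribute `O(1/p)`. The
  -- summands `1` guard against zero denominators.
  obtain ⟨l, hl⟩ := hmix.abs_covariance_sq_le (fun i => hy (π i)) (fun i => hC (π i))
    (ε := δ / (2 * (B ^ 2 + 1) * (C + 1))) (by positivity)
  have h2 : Tendsto (fun p : ℕ => (B ^ 2 * (2 * l * C)) / (p : ℝ)) atTop (𝓝 0) :=
    tendsto_const_div_atTop_nhds_zero_nat _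
  filter_upwards [h2.eventually_lt_const (half_pos hδ), eventually_gt_atTop 0] with p hp hp0
  have hp' : (0 : ℝ) < p := by exact_mod_cast hp0
  rw [Real.dist_eq, sub_zero, abs_of_nonneg (variance_nonneg _ _), variance_const_mul]
  have h3 := variance_sum_le (by positivity) hy hC hl hc hcB (Finset.Ico m p)
  set ε := δ / (2 * (B ^ 2 + 1) * (C + 1)) with hε
  have hcard : ((Finset.Ico m p).card : ℝ) ≤ p := by
    rw [Nat.card_Ico]
    exact_mod_cast Nat.sub_le p m
  have hε0 : 0 ≤ ε := by positivity
  calc _ ≤ ((p : ℝ)⁻¹) ^ 2 * (B ^ 2 * (p * (p * (ε * C) + 2 * l * C))) := by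
        gcongr
        refine h3.trans ?_
        gcongr
    _ = B ^ 2 * C * ε + (B ^ 2 * (2 * l * C)) / p := by field_simp
    _ < δ / 2 + δ / 2 := by
        refine add_lt_add_of_le_of_lt ?_ hp
        rw [hε, ← mul_div_assoc, div_le_iff₀ (by positivity)]
        nlinarith [sq_nonneg B, mul_nonneg (sq_nonneg B) hC0, mul_nonneg hδ.le (sq_nonneg B),
          mul_nonneg hδ.le hC0]
    _ = δ := by ring

theorem integral_sub_const_sq {f : Ω → ℝ} (hf : MemLp f 2 P) (t : ℝ) :
    ∫ ω, (f ω - t) ^ 2 ∂P = Var[f; P] + (∫ ω, f ω ∂P - t) ^ 2 := by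
  have h1 : Integrable f P := hf.integrable (by norm_num)
  have h2 := hf.integrable_sq
  rw [variance_eq_sub hf]
  have h3 : ∀ ω, (f ω - t) ^ 2 = f ω ^ 2 - 2 * t * f ω + t ^ 2 := fun ω => by ring
  simp only [h3]
  have h4 : Integrable (fun ω => f ω ^ 2 - 2 * t * f ω) P := h2.sub (h1.const_mul _)
  rw [integral_add h4 (integrable_const _),
    integral_sub h2 (h1.const_mul _), integral_const_mul, integral_const]
  simp only [Pi.pow_apply, probReal_univ, one_smul]
  ring

theorem memLp_sq_of_memLp_four {f : Ω → ℝ} (hf : MemLp f 4 P) :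
    MemLp (fun ω => f ω ^ 2) 2 P := by
  have hm : AEStronglyMeasurable (fun ω => f ω ^ 2) P := hf.1.pow 2
  rw [memLp_two_iff_integrable_sq hm]
  have := hf.integrable_norm_pow (p := 4) (by norm_num)
  refine this.congr (Eventually.of_forall fun ω => ?_)
  simp only [Real.norm_eq_abs]
  rw [Even.pow_abs (by decide : Even 4), ← pow_mul]

theorem variance_sq_le {f : Ω → ℝ} (hf : MemLp f 4 P) {C : ℝ} (h : ∫ ω, f ω ^ 4 ∂P ≤ C) :
    Var[fun ω => f ω ^ 2; P] ≤ C := by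
  refine (variance_le_expectation_sq (memLp_sq_of_memLp_four hf).1).trans ?_
  refine le_trans (le_of_eq ?_) h
  refine integral_congr_ae (Eventually.of_forall fun ω => ?_)
  simp only [Pi.pow_apply, ← pow_mul]

end LargeNumbers

/-! ### The law of large numbers for the noise. -/

section Noise

variable {Ω : Type*} [MeasurableSpace Ω] {P : Measure Ω} [IsProbabilityMeasure P]
  {M : Population} {n : Fin 2 → ℕ} {X : (p : ℕ) → (k : Fin 2) → Fin (n k) → Ω → Vec p}

theorem Population.Spiked.eigval_pos (h : M.Spiked) (k : Fin 2) (p i : ℕ) :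
    0 < M.eigval k p i := by
  have h1 := h.tailSq_pos k i
  rw [Population.eigval]
  split_ifs with hi
  · have := h.spikeSq_pos k i hi
    positivity
  · exact h1

theorem inner_eq_sqrt_mul_score (h : M.Spiked) (k : Fin 2) {p : ℕ} (x : Vec p) (i : Fin p) :
    inner ℝ (M.eigvec k p i) (x - M.mean k p) = √(M.eigval k p i) * score M k x i := by
  have := Real.sqrt_pos.2 (h.eigval_pos k p i)
  rw [score, ← mul_assoc, mul_inv_cancel₀ this.ne', one_mul]

theorem norm_sq_noisePart (k : Fin 2) {p : ℕ} (v : Vec p) :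
    inner ℝ (M.noisePart k v) (M.noisePart k v) =
      ∑ i ∈ Finset.univ.filter (fun i : Fin p => M.numSpikes k ≤ i.val),
        inner ℝ (M.eigvec k p i) v ^ 2 := by
  rw [M.inner_noisePart]
  refine Finset.sum_congr rfl fun i hi => ?_
  rw [M.noisePart_eq, inner_sum_filter_smul, if_pos (by simpa using hi), sq]

/-- The score sequence is the same in all dimensions, so the `i`-th second moment can be read off in
dimension `i + 1`, the first in which it occurs. -/
theorem integral_score_sq (hX : TrainingSample M P n X) (h : M.Spiked) {k : Fin 2} {j : Fin (n k)}
    {z : ℕ → Ω → ℝ} (hz : ∀ p (i : Fin p), ∀ᵐ ω ∂P, score M k (X p k j ω) i = z i ω) (i : ℕ) :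
    ∫ ω, z i ω ^ 2 ∂P = 1 := by
  have h1 := hX.integral_inner_mul_inner (i + 1) k j (Fin.last i) (Fin.last i)
  have hpos := h.eigval_pos k (i + 1) i
  have h2 : ∫ ω, inner ℝ (M.eigvec k (i + 1) (Fin.last i)) (X (i + 1) k j ω - M.mean k (i + 1)) *
      inner ℝ (M.eigvec k (i + 1) (Fin.last i)) (X (i + 1) k j ω - M.mean k (i + 1)) ∂P =
      M.eigval k (i + 1) i * ∫ ω, z i ω ^ 2 ∂P := by
    rw [← integral_const_mul]
    refine integral_congr_ae ?_
    filter_upwards [hz (i + 1) (Fin.last i)] with ω hω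
    rw [inner_eq_sqrt_mul_score h, hω]
    simp only [Fin.val_last]
    have := Real.mul_self_sqrt hpos.le
    calc _ = (√(M.eigval k (i + 1) i) * √(M.eigval k (i + 1) i)) * z i ω ^ 2 := by ring
      _ = _ := by rw [this]
  rw [h2, if_pos rfl, Fin.val_last] at h1
  exact mul_left_cancel₀ hpos.ne' (by rw [h1, mul_one])

theorem norm_sq_noisePart_eq (h : M.Spiked) (k : Fin 2) {p : ℕ} (x : Vec p) {z : ℕ → ℝ}
    (hz : ∀ i : Fin p, score M k x i = z i) :
    inner ℝ (M.noisePart k (x - M.mean k p)) (M.noisePart k (x - M.mean k p)) =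
      ∑ i ∈ Finset.Ico (M.numSpikes k) p, M.tailSq k i * z i ^ 2 := by
  rw [norm_sq_noisePart]
  have h1 : ∑ i ∈ Finset.Ico (M.numSpikes k) p, M.tailSq k i * z i ^ 2 =
      ∑ i ∈ Finset.range p, if M.numSpikes k ≤ i then M.tailSq k i * z i ^ 2 else 0 := by
    rw [← Finset.sum_filter]
    refine Finset.sum_congr ?_ fun _ _ => rfl
    ext i
    simp [and_comm]
  rw [h1, Finset.sum_range, Finset.sum_filter]
  refine Finset.sum_congr rfl fun i _ => ?_
  split_ifs with hi
  · rw [inner_eq_sqrt_mul_score h, hz, mul_pow, Real.sq_sqrt (h.eigval_pos k p i).le,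
      M.eigval_of_le hi]
  · rfl

theorem tendsto_average_Ico {a : ℕ → ℝ} {t : ℝ}
    (h : Tendsto (fun p : ℕ => (p : ℝ)⁻¹ * ∑ i ∈ Finset.range p, a i) atTop (𝓝 t)) (m : ℕ) :
    Tendsto (fun p : ℕ => (p : ℝ)⁻¹ * ∑ i ∈ Finset.Ico m p, a i) atTop (𝓝 t) := by
  have h1 : Tendsto (fun p : ℕ => (∑ i ∈ Finset.range m, a i) / (p : ℝ)) atTop (𝓝 0) :=
    tendsto_const_div_atTop_nhds_zero_nat _
  have h2 := h.sub h1
  rw [sub_zero] at h2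
  refine h2.congr' ?_
  filter_upwards [eventually_ge_atTop m] with p hp
  rw [Finset.sum_Ico_eq_sub _ hp]
  ring

/-- The law of large numbers for the squared norm of the noise. -/
theorem tendstoInMeasure_norm_sq_noisePart (hX : TrainingSample M P n X) (h : M.Spiked)
    (hs : RegularScores M P n X) (k : Fin 2) (j : Fin (n k)) :
    TendstoInMeasure P (fun (p : ℕ) ω => (p : ℝ)⁻¹ * inner ℝ (M.noisePart k (X p k j ω - M.mean k p))
      (M.noisePart k (X p k j ω - M.mean k p)) - M.tauSq k) atTop fun _ => 0 := by
  obtain ⟨z, hzm, hz, ⟨C, hC⟩, hmix⟩ := hs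
  obtain ⟨π, hπ⟩ := hmix k j
  obtain ⟨B, hB⟩ := h.tailSq_bdd
  have hL2 : ∀ i, MemLp (fun ω => z k j i ω ^ 2) 2 P := fun i =>
    memLp_sq_of_memLp_four (hC k j i).1
  have hvar := tendsto_variance_average hL2 (fun i => variance_sq_le (hC k j i).1 (hC k j i).2) hπ
    (fun i => (h.tailSq_pos k i).le) (hB k) (M.numSpikes k)
  have hmean := tendsto_average_Ico (h.tendsto_tauSq k) (M.numSpikes k)
  -- Mean square error as variance plus squared bias: mixing controls the first, convergence of the
  -- averaged tail eigenvalues the second.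
  have hlim : Tendsto (fun p : ℕ =>
      Var[fun ω => (p : ℝ)⁻¹ * ∑ i ∈ Finset.Ico (M.numSpikes k) p,
        M.tailSq k i * z k j i ω ^ 2; P] +
      ((p : ℝ)⁻¹ * ∑ i ∈ Finset.Ico (M.numSpikes k) p, M.tailSq k i - M.tauSq k) ^ 2)
      atTop (𝓝 0) := by
    have := hvar.add ((hmean.sub_const (M.tauSq k)).pow 2)
    simpa using this
  refine tendstoInMeasure_zero_of_sq_le (Eventually.of_forall fun p => ?_) hlim
  have hae : (fun ω => ((p : ℝ)⁻¹ * inner ℝ (M.noisePart k (X p k j ω - M.mean k p))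
      (M.noisePart k (X p k j ω - M.mean k p)) - M.tauSq k) ^ 2) =ᵐ[P]
      fun ω => ((p : ℝ)⁻¹ * ∑ i ∈ Finset.Ico (M.numSpikes k) p,
        M.tailSq k i * z k j i ω ^ 2 - M.tauSq k) ^ 2 := by
    filter_upwards [ae_all_iff.2 fun i : Fin p => hz p k j i] with ω hω
    rw [norm_sq_noisePart_eq h k (X p k j ω) (z := fun i => z k j i ω) hω]
  have hm : MemLp (fun ω => (p : ℝ)⁻¹ * ∑ i ∈ Finset.Ico (M.numSpikes k) p,
      M.tailSq k i * z k j i ω ^ 2) 2 P :=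
    (memLp_finsetSum _ fun i _ => (hL2 i).const_mul _).const_mul _
  constructor
  · exact ((hm.sub (memLp_const _)).integrable_sq).congr hae.symm
  · rw [integral_congr_ae hae, integral_sub_const_sq hm, integral_const_mul,
      integral_finsetSum _ fun i _ => ((hL2 i).integrable (by norm_num)).const_mul _]
    simp only [integral_const_mul, integral_score_sq hX h (hz := fun p i => hz p k j i), mul_one]
    exact le_rfl

end Noise

/-! ### General position of independent vectors with absolutely continuous laws. -/

section GeneralPosition

variable {Ω : Type*} [MeasurableSpace Ω] {P : Measure Ω} [IsProbabilityMeasure P]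

/-- The exceptional `y` form a translate of the span of `q < p` vectors, a Lebesgue null set. -/
theorem linearIndependent_snoc_diff_null {p q : ℕ} (hq : q < p) {ν : Measure (Vec p)}
    (hν : ν ≪ volume) (h : Fin (q + 1) → Vec p)
    (hh : LinearIndependent ℝ fun j : Fin q => h j.succ - h 0) :
    ν {y | ¬ LinearIndependent ℝ
      (Fin.snoc (fun j : Fin q => h j.succ - h 0) (y - h 0) : Fin (q + 1) → Vec p)} = 0 := by
  refine hν ?_
  set S := Submodule.span ℝ (Set.range fun j : Fin q => h j.succ - h 0) with hS
  have hne : S ≠ ⊤ := by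
    intro htop
    have h1 : Module.finrank ℝ S ≤ q := by
      have := finrank_range_le_card (R := ℝ) fun j : Fin q => h j.succ - h 0
      simpa [Set.finrank, hS] using this
    rw [htop, finrank_top, finrank_euclideanSpace_fin] at h1
    omega
  have h2 : {y | ¬ LinearIndependent ℝ
      (Fin.snoc (fun j : Fin q => h j.succ - h 0) (y - h 0) : Fin (q + 1) → Vec p)} =
      (fun y => y - h 0) ⁻¹' (S : Set (Vec p)) := by
    ext y
    simp only [Set.mem_ofPred_eq, linearIndependent_finSnoc, hh, true_and, not_not,
      Set.mem_preimage, SetLike.mem_coe, hS]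
  have h3 : (fun y : Vec p => y - h 0) = fun y => y + -h 0 := funext fun y => sub_eq_add_neg _ _
  rw [h2, h3, measure_preimage_add_right]
  exact Measure.addHaar_submodule _ _ hne

/-- Independent random vectors with absolutely continuous laws are almost surely in general
position. -/
theorem ae_linearIndependent_diff {p : ℕ} (q : ℕ) (hq : q ≤ p) {Y : Fin (q + 1) → Ω → Vec p}
    (hm : ∀ j, Measurable (Y j)) (hY : iIndepFun Y P) (hac : ∀ j, P.map (Y j) ≪ volume) :
    ∀ᵐ ω ∂P, LinearIndependent ℝ fun j : Fin q => Y j.succ ω - Y 0 ω := by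
  induction q with
  | zero => exact Eventually.of_forall fun ω => linearIndependent_empty_type
  | succ q ih =>
    have ih' := ih (by omega) (Y := fun j => Y j.castSucc) (fun j => hm _)
      (hY.precomp (Fin.castSucc_injective _)) (fun j => hac _)
    let T : Ω → (Fin (q + 1) → Vec p) := fun ω j => Y j.castSucc ω
    have hT : Measurable T := measurable_pi_lambda _ fun j => hm _
    have hind : IndepFun T (Y (Fin.last (q + 1))) P := by
      have h1 := hY.indepFun_finset (Finset.univ.filter (· ≠ Fin.last (q + 1)))
        {Fin.last (q + 1)} (by simp) hm
      refine h1.comp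
        (φ := fun v (j : Fin (q + 1)) => v ⟨j.castSucc, by simp [Fin.castSucc_ne_last]⟩)
        (ψ := fun v => v ⟨Fin.last (q + 1), by simp⟩) ?_ ?_
      · exact measurable_pi_lambda _ fun j => measurable_pi_apply _
      · exact measurable_pi_apply _
    let D : (Fin (q + 1) → Vec p) × Vec p → Fin (q + 1) → Vec p := fun x =>
      Fin.snoc (fun j : Fin q => x.1 j.succ - x.1 0) (x.2 - x.1 0)
    have hDc : Continuous D := by
      refine Continuous.finSnoc ?_ ?_ <;> fun_prop
    -- The event that the last vector is the first to destroy independence. It is null by Fubini,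
    -- each slice over the earlier vectors being null.
    let B : Set ((Fin (q + 1) → Vec p) × Vec p) :=
      {x | (LinearIndependent ℝ fun j : Fin q => x.1 j.succ - x.1 0) ∧ ¬ LinearIndependent ℝ (D x)}
    have hB : MeasurableSet B := by
      refine MeasurableSet.inter ?_ (MeasurableSet.compl ?_)
      · have : Continuous fun (x : (Fin (q + 1) → Vec p) × Vec p) (j : Fin q) =>
          x.1 j.succ - x.1 0 := by fun_prop
        exact (isOpen_setOfPred_linearIndependent.preimage this).measurableSet
      · exact (isOpen_setOfPred_linearIndependent.preimage hDc).measurableSet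
    have hnull : P.map (fun ω => (T ω, Y (Fin.last (q + 1)) ω)) B = 0 := by
      rw [(indepFun_iff_map_prod_eq_prod_map_map hT.aemeasurable (hm _).aemeasurable).1 hind,
        Measure.measure_prod_null hB]
      refine Eventually.of_forall fun h => ?_
      by_cases hh : LinearIndependent ℝ fun j : Fin q => h j.succ - h 0
      · refine measure_mono_null ?_ (linearIndependent_snoc_diff_null (by omega) (hac _) h hh)
        intro y hy
        exact hy.2
      · have : Prod.mk h ⁻¹' B = ∅ := by
          ext y
          simp [B, hh]
        simp [this]
    rw [Measure.map_apply (hT.prodMk (hm _)) hB] at hnull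
    have hae : ∀ᵐ ω ∂P, (T ω, Y (Fin.last (q + 1)) ω) ∉ B := by
      rw [ae_iff]
      simp only [not_not]
      exact hnull
    filter_upwards [ih', hae] with ω h1 h2
    have h3 : LinearIndependent ℝ (D (T ω, Y (Fin.last (q + 1)) ω)) := by
      by_contra h4
      exact h2 ⟨h1, h4⟩
    convert h3 using 1
    funext j
    refine Fin.lastCases ?_ (fun j => ?_) j
    · simp [D, T]
    · simp [D, T]

end GeneralPosition

/-! ### Almost sure general position of the spike scores. -/

namespace Population

variable {M : Population} {n : Fin 2 → ℕ}

/-- The score sequences for which the first spike scores of each class are in general position. -/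
def generalScores (M : Population) (hn : ∀ k, M.numSpikes k < n k) :
    Set (SampleIdx n → ℕ → ℝ) :=
  {ζ | ∀ k, LinearIndependent ℝ fun (j : Fin (M.numSpikes k)) (l : Fin (M.numSpikes k)) =>
    ζ ⟨k, Fin.castLE (hn k) j.succ⟩ l - ζ ⟨k, Fin.castLE (hn k) 0⟩ l}

theorem measurableSet_generalScores (hn : ∀ k, M.numSpikes k < n k) :
    MeasurableSet (M.generalScores hn) := by
  have : M.generalScores hn = ⋂ k, {ζ | LinearIndependent ℝ
      fun (j : Fin (M.numSpikes k)) (l : Fin (M.numSpikes k)) =>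
        ζ ⟨k, Fin.castLE (hn k) j.succ⟩ l - ζ ⟨k, Fin.castLE (hn k) 0⟩ l} := by
    ext ζ
    simp [generalScores]
  rw [this]
  refine MeasurableSet.iInter fun k => ?_
  have hc : Continuous fun (ζ : SampleIdx n → ℕ → ℝ) (j : Fin (M.numSpikes k))
      (l : Fin (M.numSpikes k)) =>
      ζ ⟨k, Fin.castLE (hn k) j.succ⟩ l - ζ ⟨k, Fin.castLE (hn k) 0⟩ l := by fun_prop
  exact (isOpen_setOfPred_linearIndependent.preimage hc).measurableSet

/-- As many independent score differences as there are spikes span the whole coordinate space; `y`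
annihilates all of them, hence also itself. -/
theorem goodScores_of_mem {hn : ∀ k, M.numSpikes k < n k} {ζ : SampleIdx n → ℕ → ℝ}
    (h : ζ ∈ M.generalScores hn) : M.GoodScores ζ := by
  intro k y hy
  have htop := (h k).span_eq_top_of_card_eq_finrank' (by simp)
  have h1 : ∀ v : Fin (M.numSpikes k) → ℝ, ∑ l, y l * v l = 0 := by
    intro v
    have hv : v ∈ Submodule.span ℝ (Set.range fun (j : Fin (M.numSpikes k))
        (l : Fin (M.numSpikes k)) =>
        ζ ⟨k, Fin.castLE (hn k) j.succ⟩ l - ζ ⟨k, Fin.castLE (hn k) 0⟩ l) := by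
      rw [htop]; trivial
    refine Submodule.span_induction (p := fun v _ => ∑ l, y l * v l = 0) ?_ ?_ ?_ ?_ hv
    · rintro _ ⟨j, rfl⟩
      have := hy (Fin.castLE (hn k) j.succ) (Fin.castLE (hn k) 0)
      simp only [mul_sub, Finset.sum_sub_distrib, this, sub_self]
    · simp
    · intro v w _ _ hv hw
      simp only [Pi.add_apply, mul_add, Finset.sum_add_distrib, hv, hw, add_zero]
    · intro c v _ hv
      simp only [Pi.smul_apply, smul_eq_mul, mul_left_comm _ c, ← Finset.mul_sum, hv, mul_zero]
  have h2 := h1 y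
  rw [Finset.sum_eq_zero_iff_of_nonneg fun l _ => mul_self_nonneg _] at h2
  funext l
  exact mul_self_eq_zero.1 (h2 l (Finset.mem_univ l))

end Population

section Scores

variable {Ω : Type*} [MeasurableSpace Ω] {P : Measure Ω} [IsProbabilityMeasure P]
  {M : Population} {n : Fin 2 → ℕ} {X : (p : ℕ) → (k : Fin 2) → Fin (n k) → Ω → Vec p}

/-- In dimension `p = M.numSpikes k` the map from observation differences to score differences is an
injective linear map, so it carries general position of the observations to the spike scores. These
do not depend on `p`. -/
theorem ae_mem_generalScores (hX : TrainingSample M P n X) (h : M.Spiked)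
    (hn : ∀ k, M.numSpikes k < n k) {z : (k : Fin 2) → Fin (n k) → ℕ → Ω → ℝ}
    (hz : ∀ p k j (i : Fin p), ∀ᵐ ω ∂P, score M k (X p k j ω) i = z k j i ω) :
    ∀ᵐ ω ∂P, (fun (s : SampleIdx n) i => z s.1 s.2 i ω) ∈ M.generalScores hn := by
  have hk : ∀ k, ∀ᵐ ω ∂P, LinearIndependent ℝ fun (j : Fin (M.numSpikes k))
      (l : Fin (M.numSpikes k)) =>
      z k (Fin.castLE (hn k) j.succ) l ω - z k (Fin.castLE (hn k) 0) l ω := by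
    intro k
    set q := M.numSpikes k with hq
    have h1 := ae_linearIndependent_diff (P := P) (p := q) q le_rfl
      (Y := fun j => X q k (Fin.castLE (hn k) j)) (fun j => hX.measurable q k _)
      ((hX.indep q).precomp (g := fun j : Fin (q + 1) =>
        (⟨k, Fin.castLE (hn k) j⟩ : (k : Fin 2) × Fin (n k))) (by
          intro a b hab
          simpa using hab)) (fun j => hX.absCont q k _)
    let T : Vec q →ₗ[ℝ] (Fin q → ℝ) := LinearMap.pi fun i =>
      (√(M.eigval k q i))⁻¹ • (innerSL ℝ (M.eigvec k q i)).toLinearMap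
    have hT : T.ker = ⊥ := by
      rw [LinearMap.ker_eq_bot']
      intro v hv
      have h2 : ∀ i, inner ℝ (M.eigvec k q i) v = 0 := by
        intro i
        have h3 := congrFun hv i
        have h4 := Real.sqrt_pos.2 (h.eigval_pos k q i)
        have h5 : (√(M.eigval k q i))⁻¹ * inner ℝ (M.eigvec k q i) v = 0 := h3
        exact (mul_eq_zero.1 h5).resolve_left (inv_pos.2 h4).ne'
      rw [← (M.eigvec k q).sum_repr' v]
      simp [h2]
    have hz' : ∀ᵐ ω ∂P, ∀ (j : Fin (n k)) (i : Fin q), score M k (X q k j ω) i = z k j i ω :=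
      ae_all_iff.2 fun j => ae_all_iff.2 fun i => hz q k j i
    filter_upwards [h1, hz'] with ω hω hzω
    have h2 := hω.map' T hT
    have h3 : (fun (j l : Fin q) => z k (Fin.castLE (hn k) j.succ) l ω -
        z k (Fin.castLE (hn k) 0) l ω) = T ∘ fun j : Fin q =>
          X q k (Fin.castLE (hn k) j.succ) ω - X q k (Fin.castLE (hn k) 0) ω := by
      funext j l
      rw [← hzω, ← hzω, score, score, ← mul_sub, ← inner_sub_right, sub_sub_sub_cancel_right]
      rfl
    rw [h3]
    exact h2
  filter_upwards [ae_all_iff.2 hk] with ω hω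
  exact hω

end Scores

/-! ### Vanishing of the noise deviations in probability. -/

section NoiseLimits

variable {Ω : Type*} [MeasurableSpace Ω] {P : Measure Ω} [IsProbabilityMeasure P]
  {M : Population} {n : Fin 2 → ℕ} {X : (p : ℕ) → (k : Fin 2) → Fin (n k) → Ω → Vec p}

theorem tendstoInMeasure_zero_of_scaled_sq_le {f : ℕ → Ω → ℝ} {c a : ℕ → ℝ}
    (hf : ∀ᶠ p in atTop, Integrable (fun ω => f p ω ^ 2) P ∧ ∫ ω, f p ω ^ 2 ∂P ≤ a p)
    (ha : Tendsto (fun p => c p ^ 2 * a p) atTop (𝓝 0)) :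
    TendstoInMeasure P (fun (p : ℕ) ω => c p * f p ω) atTop fun _ => 0 := by
  refine tendstoInMeasure_zero_of_sq_le (a := fun p => c p ^ 2 * a p) ?_ ha
  filter_upwards [hf] with p hp
  simp only [mul_pow]
  refine ⟨hp.1.const_mul _, ?_⟩
  rw [integral_const_mul]
  exact mul_le_mul_of_nonneg_left hp.2 (sq_nonneg _)

theorem tendstoInMeasure_inner_basis_noisePart (hX : TrainingSample M P n X) (h₂ : M.Spiked)
    {m : ℕ} {u : (p : ℕ) → Fin m → Vec p} (hu : ∀ᶠ p in atTop, Orthonormal ℝ (u p))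
    (s : SampleIdx n) (a : Fin m) :
    TendstoInMeasure P (fun (p : ℕ) ω => (√(p : ℝ))⁻¹ * inner ℝ (u p a)
      (M.noisePart s.1 (X p s.1 s.2 ω - M.mean s.1 p))) atTop fun _ => 0 := by
  obtain ⟨C, hC⟩ := h₂.tailSq_bdd
  refine tendstoInMeasure_zero_of_scaled_sq_le (a := fun _ => C) ?_ ?_
  · filter_upwards [hu] with p hp
    have := hX.integral_inner_noisePart_sq_le hC h₂.tailSq_pos p s.1 s.2 (u p a)
    simpa only [real_inner_comm, hp.1 a, one_pow, mul_one] using this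
  · have : ∀ p : ℕ, (√(p : ℝ))⁻¹ ^ 2 * C = C / (p : ℝ) := fun p => by
      rw [inv_pow, Real.sq_sqrt (Nat.cast_nonneg p), div_eq_inv_mul]
    simp only [this]
    exact tendsto_const_div_atTop_nhds_zero_nat C

theorem tendstoInMeasure_inner_noisePart_noisePart (hX : TrainingSample M P n X)
    (h₂ : M.Spiked) {r s : SampleIdx n} (hrs : r ≠ s) :
    TendstoInMeasure P (fun (p : ℕ) ω => (p : ℝ)⁻¹ * inner ℝ
      (M.noisePart r.1 (X p r.1 r.2 ω - M.mean r.1 p))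
      (M.noisePart s.1 (X p s.1 s.2 ω - M.mean s.1 p))) atTop fun _ => 0 := by
  obtain ⟨C, hC⟩ := h₂.tailSq_bdd
  refine tendstoInMeasure_zero_of_scaled_sq_le (a := fun p => C * C * (p : ℝ))
    (Eventually.of_forall fun p =>
      hX.integral_inner_noisePart_noisePart_sq_le hC h₂.tailSq_pos p hrs) ?_
  refine (tendsto_const_div_atTop_nhds_zero_nat (C * C)).congr fun p => ?_
  rcases eq_or_ne p 0 with rfl | hp
  · simp
  · field_simp

theorem tendstoInMeasure_inner_noisePart_meanDiff (hX : TrainingSample M P n X)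
    (h₁ : M.MeanGrowth) (h₂ : M.Spiked) (s : SampleIdx n) :
    TendstoInMeasure P (fun (p : ℕ) ω => (p : ℝ)⁻¹ * inner ℝ
      (M.noisePart s.1 (X p s.1 s.2 ω - M.mean s.1 p)) (M.meanDiff p)) atTop fun _ => 0 := by
  obtain ⟨C, hC⟩ := h₂.tailSq_bdd
  obtain ⟨δ, -, hδ⟩ := h₁
  refine tendstoInMeasure_zero_of_scaled_sq_le (a := fun p => C * ‖M.meanDiff p‖ ^ 2)
    (Eventually.of_forall fun p =>
      hX.integral_inner_noisePart_sq_le hC h₂.tailSq_pos p s.1 s.2 _) ?_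
  have h := (tendsto_const_div_atTop_nhds_zero_nat C).mul (hδ.pow 2)
  rw [zero_mul] at h
  refine h.congr fun p => ?_
  rw [div_pow, Real.sq_sqrt (Nat.cast_nonneg p)]
  ring

/-- The deviations that vanish in probability. -/
def deviation (M : Population) (X : (p : ℕ) → (k : Fin 2) → Fin (n k) → Ω → Vec p) {m : ℕ}
    (u : (p : ℕ) → Fin m → Vec p) (α : ℕ → Ω → ℝ) (t : ℝ) :
    (SampleIdx n × Fin m) ⊕ (SampleIdx n × SampleIdx n) ⊕ SampleIdx n ⊕ Unit → ℕ → Ω → ℝ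
  | .inl (s, a), p, ω => (√(p : ℝ))⁻¹ * inner ℝ (u p a)
      (M.noisePart s.1 (X p s.1 s.2 ω - M.mean s.1 p))
  | .inr (.inl (r, s)), p, ω => (p : ℝ)⁻¹ * inner ℝ
      (M.noisePart r.1 (X p r.1 r.2 ω - M.mean r.1 p))
      (M.noisePart s.1 (X p s.1 s.2 ω - M.mean s.1 p)) - if r = s then t else 0
  | .inr (.inr (.inl s)), p, ω => (p : ℝ)⁻¹ * inner ℝ
      (M.noisePart s.1 (X p s.1 s.2 ω - M.mean s.1 p)) (M.meanDiff p)
  | .inr (.inr (.inr _)), p, ω => α p ω + t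

theorem tendstoInMeasure_deviation (hX : TrainingSample M P n X) (h₁ : M.MeanGrowth)
    (h₂ : M.Spiked) (h₃ : RegularScores M P n X) {m : ℕ} {u : (p : ℕ) → Fin m → Vec p}
    (hu : ∀ᶠ p in atTop, Orthonormal ℝ (u p)) {α : ℕ → Ω → ℝ} {t : ℝ}
    (ht : ∀ k, M.tauSq k = t) (hα : TendstoInMeasure P α atTop fun _ => -t)
    (j : (SampleIdx n × Fin m) ⊕ (SampleIdx n × SampleIdx n) ⊕ SampleIdx n ⊕ Unit) :
    TendstoInMeasure P (deviation M X u α t j) atTop fun _ => 0 := by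
  rcases j with ⟨s, a⟩ | ⟨r, s⟩ | s | _
  · exact tendstoInMeasure_inner_basis_noisePart hX h₂ hu s a
  · by_cases hrs : r = s
    · subst hrs
      -- Both classes have the same limiting noise level here, so the diagonal limit does not depend
      -- on the class of `r`.
      have := tendstoInMeasure_norm_sq_noisePart hX h₂ h₃ r.1 r.2
      rw [ht, tendstoInMeasure_iff_norm] at this
      rw [tendstoInMeasure_iff_norm]
      simpa [deviation] using this
    · have := tendstoInMeasure_inner_noisePart_noisePart hX h₂ hrs
      rw [tendstoInMeasure_iff_norm] at this ⊢
      simpa [deviation, hrs] using this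
  · exact tendstoInMeasure_inner_noisePart_meanDiff hX h₁ h₂ s
  · rw [tendstoInMeasure_iff_norm] at hα ⊢
    simpa [deviation] using hα

end NoiseLimits

end DataPiling

end

/-! ### Assembly of the deterministic and the probabilistic parts. -/

theorem mainTheorem7 {Ω : Type*} [MeasurableSpace Ω] (P : Measure Ω) [IsProbabilityMeasure P]
    (M : DataPiling.Population) (n : Fin 2 → ℕ)
    (X : (p : ℕ) → (k : Fin 2) → Fin (n k) → Ω → DataPiling.Vec p)
    (hX : DataPiling.TrainingSample M P n X)
    (hn : ∀ k, M.numSpikes k < n k)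
    (h₁ : M.MeanGrowth) (h₂ : M.Spiked) (h₃ : DataPiling.RegularScores M P n X)
    (h₄ : M.LeadingAngles)
    (m : ℕ) (u : (p : ℕ) → Fin m → DataPiling.Vec p) (h₅ : M.CommonBasis m u)
    (hτ : M.tauSq 0 = M.tauSq 1)
    -- an ordered eigendecomposition of the within-class scatter matrix
    (lam : (p : ℕ) → Ω → Fin p → ℝ)
    (U : (p : ℕ) → Ω → OrthonormalBasis (Fin p) ℝ (DataPiling.Vec p))
    (hU_meas : ∀ p i, AEMeasurable (fun ω => U p ω i) P)
    (hU : ∀ p, ∀ᵐ ω ∂P,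
      DataPiling.IsEigenDecomp (DataPiling.withinScatter fun k j => X p k j ω) (lam p ω) (U p ω))
    -- the maximal data piling direction
    (w : (p : ℕ) → Ω → DataPiling.Vec p)
    (hw_meas : ∀ p, AEMeasurable (w p) P)
    (hw : ∀ᶠ p in atTop, ∀ᵐ ω ∂P, DataPiling.IsMDP (fun k j => X p k j ω) (w p ω))
    -- a consistent estimator of the negative tail eigenvalue
    (α : ℕ → Ω → ℝ) (hα_meas : ∀ p, AEMeasurable (α p) P)
    (hα : TendstoInMeasure P α atTop fun _ => -M.tauSq 0) :
    ∀ i : Fin m,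
      TendstoInMeasure P
        (fun p ω => InnerProductGeometry.angle
          (DataPiling.ridgeDir m (n 0 + n 1) (α p ω) (lam p ω) (U p ω)
            (DataPiling.sampleDiff fun k j => X p k j ω))
          ((DataPiling.signalSpace m (U p ω) (w p ω)).starProjection (u p i)))
        atTop (fun _ => Real.pi / 2) ∧
      -- the angle is defined with probability tending to one
      Tendsto
        (fun p => P {ω | (∃ l : Fin p, (l : ℕ) < m ∧ lam p ω l + α p ω * (p : ℝ) = 0) ∨
          DataPiling.ridgeVec m (n 0 + n 1) (α p ω) (lam p ω) (U p ω)
            (DataPiling.sampleDiff fun k j => X p k j ω) = 0 ∨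
          (DataPiling.signalSpace m (U p ω) (w p ω)).starProjection (u p i) = 0})
        atTop (𝓝 0) := by
  classical
  have hn' : ∀ k, 0 < n k := fun k => (Nat.zero_le _).trans_lt (hn k)
  have hτ' : ∀ k, M.tauSq k = M.tauSq 0 := by
    intro k
    fin_cases k
    · rfl
    · exact hτ.symm
  have hs := h₃
  obtain ⟨z, hzm, hz, -, -⟩ := hs
  -- The whole array of score sequences is one random element of a Polish space, common to all `p`.
  have hζm : Measurable fun ω => fun (s : DataPiling.SampleIdx n) (i : ℕ) => z s.1 s.2 i ω :=
    measurable_pi_iff.2 fun s => measurable_pi_iff.2 fun i => hzm s.1 s.2 i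
  have hGae := DataPiling.ae_mem_generalScores hX h₂ hn hz
  have herr := DataPiling.tendstoInMeasure_deviation hX h₁ h₂ h₃ h₅.orthonormal hτ' hα
  let reg : ℕ → Ω → Prop := fun p ω =>
    (∀ (s : DataPiling.SampleIdx n) (l : ℕ), l < M.numSpikes s.1 →
      inner ℝ (M.eigvecAt s.1 p l) (X p s.1 s.2 ω - M.mean s.1 p) =
        √(M.eigval s.1 p l) * z s.1 s.2 l ω) ∧
    DataPiling.IsEigenDecomp (DataPiling.withinScatter fun k j => X p k j ω) (lam p ω) (U p ω) ∧
    DataPiling.IsMDP (fun k j => X p k j ω) (w p ω)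
  have hreg : ∀ᶠ p in atTop, ∀ᵐ ω ∂P, reg p ω := by
    filter_upwards [hw, eventually_ge_atTop (M.numSpikes 0), eventually_ge_atTop (M.numSpikes 1)]
      with p hwp h0 h1
    have hpk : ∀ k, M.numSpikes k ≤ p := by
      intro k
      fin_cases k
      · exact h0
      · exact h1
    have hzp : ∀ᵐ ω ∂P, ∀ (s : DataPiling.SampleIdx n) (i : Fin p),
        DataPiling.score M s.1 (X p s.1 s.2 ω) i = z s.1 s.2 i ω :=
      ae_all_iff.2 fun s => ae_all_iff.2 fun i => hz p s.1 s.2 i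
    filter_upwards [hwp, hU p, hzp] with ω hω1 hω2 hω3
    refine ⟨fun s l hl => ?_, hω2, hω1⟩
    have hlp : l < p := hl.trans_le (hpk s.1)
    have := DataPiling.inner_eq_sqrt_mul_score h₂ s.1 (X p s.1 s.2 ω) ⟨l, hlp⟩
    rw [hω3] at this
    rw [DataPiling.Population.eigvecAt, dif_pos hlp]
    exact this
  intro i
  -- The purely deterministic claim, with the dimension and the sample point varying jointly along
  -- `L`; it serves both conclusions.
  have key : ∀ L : Filter (ℕ × Ω), L.NeBot → Tendsto Prod.fst L atTop →
      (∀ᶠ y in L, reg y.1 y.2) →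
      (∀ j, Tendsto (fun y => DataPiling.deviation M X u α (M.tauSq 0) j y.1 y.2) L (𝓝 0)) →
      ∀ ζ₀ ∈ M.generalScores hn,
      Tendsto (fun y => fun (s : DataPiling.SampleIdx n) (i : ℕ) => z s.1 s.2 i y.2) L (𝓝 ζ₀) →
      Tendsto (fun y => InnerProductGeometry.angle
        (DataPiling.ridgeDir m (n 0 + n 1) (α y.1 y.2) (lam y.1 y.2) (U y.1 y.2)
          (DataPiling.sampleDiff fun k j => X y.1 k j y.2))
        ((DataPiling.signalSpace m (U y.1 y.2) (w y.1 y.2)).starProjection (u y.1 i))) L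
        (𝓝 (Real.pi / 2)) ∧
      ∀ᶠ y in L, ¬ ((∃ l : Fin y.1, (l : ℕ) < m ∧ lam y.1 y.2 l + α y.1 y.2 * (y.1 : ℝ) = 0) ∨
        DataPiling.ridgeVec m (n 0 + n 1) (α y.1 y.2) (lam y.1 y.2) (U y.1 y.2)
          (DataPiling.sampleDiff fun k j => X y.1 k j y.2) = 0 ∨
        (DataPiling.signalSpace m (U y.1 y.2) (w y.1 y.2)).starProjection (u y.1 i) = 0) := by
    intro L hL hfst hr he ζ₀ hζ₀ hζ
    have he₂ : ∀ r s : DataPiling.SampleIdx n, Tendsto (fun y : ℕ × Ω => (y.1 : ℝ)⁻¹ * inner ℝ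
        (M.noisePart r.1 (X y.1 r.1 r.2 y.2 - M.mean r.1 y.1))
        (M.noisePart s.1 (X y.1 s.1 s.2 y.2 - M.mean s.1 y.1))) L
        (𝓝 (if r = s then M.tauSq 0 else 0)) := by
      intro r s
      have := (he (.inr (.inl (r, s)))).add_const (if r = s then M.tauSq 0 else 0)
      simpa [DataPiling.deviation] using this
    have he₄ : Tendsto (fun y : ℕ × Ω => α y.1 y.2) L (𝓝 (-M.tauSq 0)) := by
      have := (he (.inr (.inr (.inr ())))).add_const (-M.tauSq 0)
      simpa [DataPiling.deviation] using this
    exact DataPiling.tendsto_angle_ridgeDir (n := n) (L := L) (p := Prod.fst) M hn' hfst h₁ h₂ h₅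
      (h₂.tauSq_pos 0) (x := fun y k j => X y.1 k j y.2)
      (ζ := fun y s l => z s.1 s.2 l y.2) (ζ₀ := ζ₀)
      (fun s l => tendsto_pi_nhds.1 (tendsto_pi_nhds.1 hζ s) l)
      (DataPiling.Population.goodScores_of_mem hζ₀) (hr.mono fun y hy => hy.1)
      (fun s a => he (.inl (s, a))) he₂ (fun s => he (.inr (.inr (.inl s))))
      (lam := fun y => lam y.1 y.2) (U := fun y => U y.1 y.2)
      (hr.mono fun y hy => hy.2.1) (w := fun y => w y.1 y.2) (hr.mono fun y hy => hy.2.2)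
      he₄ i
  constructor
  · rw [tendstoInMeasure_iff_norm]
    intro ε hε
    refine DataPiling.tendsto_measure_bad hζm
      (DataPiling.Population.measurableSet_generalScores hn) hGae herr hreg ?_
    intro L hL hfst hr he ζ₀ hζ₀ hζ
    have := (key L hL hfst hr he ζ₀ hζ₀ hζ).1
    filter_upwards [Metric.tendsto_nhds.1 this ε hε] with y hy
    rw [Real.dist_eq] at hy
    exact not_le.2 hy
  · refine DataPiling.tendsto_measure_bad hζm
      (DataPiling.Population.measurableSet_generalScores hn) hGae herr hreg ?_
    intro L hL hfst hr he ζ₀ hζ₀ hζ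
    exact (key L hL hfst hr he ζ₀ hζ₀ hζ).2
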